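/- Let $\mu>0$, $\rho>0$, $\tilde\lambda\ge 0$. Let $L^1_s(\mathcal R)$ be the Banach space of sequences $f=(f_N)_{N\ge0}$ of functions $f_N\in L^1(\mathbb R^N)$, symmetric under permutations of their variables (with $f_0\in\mathbb R$), with norm $\|f\|_1=\sum_N\|f_N\|_{L^1(\mathbb R^N)}<\infty$, and let $D^1=\{f\in L^1_s(\mathcal R):\sum_N N^2\|f_N\|_{L^1(\mathbb R^N)}<\infty\}$. A probability distribution is an $f\in L^1_s(\mathcal R)$ with $f_N\ge0$ almost everywhere for every $N$ and $\|f\|_1=1$. Define the generator $\mathcal L$ by $$(\mathcal L f)_N=\mu\big((\mathcal I f)_N-f_N\big)+\rho\big((\mathcal O f)_N-Nf_N\big)+\tilde\lambda\sum_{1\le i<j\le N}(R_{i,j}f_N-f_N),$$ where $$(\mathcal I f)_N(v)=\frac1N\sum_{i=1}^N e^{-\pi v_i^2}f_{N-1}(v_1,\dots,v_{i-1},v_{i+1},\dots,v_N)\quad(N\ge1),\qquad (\mathcal I f)_0=0,$$ $$(\mathcal O f)_N(v)=\sum_{i=1}^{N+1}\int_{\mathbb R} f_{N+1}(v_1,\dots,v_{i-1},w,v_i,\dots,v_N)\,dw,$$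 $$(R_{i,j}f_N)(v)=\frac1{2\pi}\int_0^{2\pi}f_N(\dots,v_i\cos\theta-v_j\sin\theta,\dots,v_i\sin\theta+v_j\cos\theta,\dots)\,d\theta .$$ Let $\Gamma_N=a_N\gamma_N$ be the grand canonical steady state, with $a_N=\frac{(\mu/\rho)^N}{N!}e^{-\mu/\rho}$ and $\gamma_N(v)=e^{-\pi|v|^2}$, and for $f=h\Gamma$ (that is, $f_N=h_N\Gamma_N$ for all $N$) let $$\mathcal S(f\,|\,\Gamma)=\sum_N a_N\int_{\mathbb R^N}h_N\log h_N\,\gamma_N\,dv,\qquad 0\log0=0.$$ Let $f=h\Gamma\in D^1$ be a probability distribution such that $\Gamma h\log h=(\Gamma_N h_N\log h_N)_{N\ge0}\in D^1$. Then the master equation $\frac{d}{dt}f(t)=\mathcal L f(t)$ (derivative in the norm of $L^1_s(\mathcal R)$, one-sided at $t=0$) has exactly one solution $f(t)\in D^1$, $t\ge0$, with $f(0)=f$. For every $t\ge0$, $f(t)$ is a probability distribution, the sum of integrals defining $\mathcal S(f(t)\,|\,\Gamma)$ converges absolutely, and $$\mathcal S(f(t)\,|\,\Gamma)\le e^{-\rho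 t}\,\mathcal S(f(0)\,|\,\Gamma).$$ In particular the rate $\rho$ depends neither on the mean particle number $\mu/\rho$ nor on $\tilde\lambda$, and the bound includes the case $\tilde\lambda=0$ of no collisions. -/

import Mathlib

open MeasureTheory

noncomputable section

namespace KacReservoir

/-- A sequence `(f_N)` of real functions `f_N : ℝᴺ → ℝ`, `N = 0, 1, 2, …`; here `ℝ⁰` is a single
point of mass `1`, so that `f_0` is a number. -/
abbrev FunSeq : Type := (N : ℕ) → (Fin N → ℝ) → ℝ

/-- The Banach space `⨁_N L¹(ℝᴺ)` with the norm `∑_N ‖f_N‖₁`. -/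
abbrev L1 : Type := lp (fun N : ℕ => Lp ℝ 1 (volume : Measure (Fin N → ℝ))) 1

/-- The (almost everywhere defined) functions `f_N` of an element of `⨁_N L¹(ℝᴺ)`. -/
def L1.fn (f : L1) : FunSeq := fun N v => (f N) v

/-- Symmetry of every `f_N` under permutations of its variables, almost everywhere. -/
def IsSymm (f : FunSeq) : Prop :=
  ∀ (N : ℕ) (σ : Equiv.Perm (Fin N)), (fun v : Fin N → ℝ => f N (v ∘ σ)) =ᵐ[volume] f N

/-- The sequence defines an element of `L¹_s(ℛ)`, the space of the sequences of symmetric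
functions with `∑_N ‖f_N‖₁ < ∞`. -/
structure MemL1s (f : FunSeq) : Prop where
  symm : IsSymm f
  integrable : ∀ N, Integrable (f N) volume
  summable : Summable fun N => ∫ v, |f N v|

/-- The sequence defines an element of the domain `D¹`, the space of the states in `L¹_s(ℛ)` with
`∑_N N² ‖f_N‖₁ < ∞`. -/
structure MemD1 (f : FunSeq) : Prop extends MemL1s f where
  summable_sq : Summable fun N : ℕ => (N : ℝ) ^ 2 * ∫ v, |f N v|

/-- Probability distributions: states in `L¹_s(ℛ)` that are positive and have norm one. -/
structure IsProbDist (f : FunSeq) : Prop extends MemL1s f where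
  nonneg : ∀ N, 0 ≤ᵐ[volume] f N
  norm_eq_one : ∑' N, ∫ v, |f N v| = 1

/-- The *in* operator
`(ℐf)_N(v) = N⁻¹ ∑_i exp(-π v_i²) f_{N-1}(v_1, …, v_{i-1}, v_{i+1}, …, v_N)`, `(ℐf)_0 = 0`. -/
def inOp (f : FunSeq) : FunSeq
  | 0 => fun _ => 0
  | N + 1 => fun v =>
      (1 / ((N : ℝ) + 1)) *
        ∑ i : Fin (N + 1), Real.exp (-Real.pi * v i ^ 2) * f N (fun j => v (i.succAbove j))

/-- The *out* operator
`(𝒪f)_N(v) = ∑_{i=1}^{N+1} ∫ f_{N+1}(v_1, …, v_{i-1}, w, v_i, …, v_N) dw`. -/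
def outOp (f : FunSeq) : FunSeq := fun N v =>
  ∑ i : Fin (N + 1), ∫ w : ℝ, f (N + 1) (i.insertNth (α := fun _ => ℝ) w v)

/-- The rotation by the angle `θ` in the plane of the variables `v_i`, `v_j`. -/
def rotate {N : ℕ} (i j : Fin N) (θ : ℝ) (v : Fin N → ℝ) : Fin N → ℝ := fun k =>
  if k = i then v i * Real.cos θ - v j * Real.sin θ
  else if k = j then v i * Real.sin θ + v j * Real.cos θ
  else v k

/-- The collision of the particles `i` and `j`: `R_{i,j} f` is the average of `f` over all
rotations in the plane of `v_i`, `v_j`. -/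
def collide {N : ℕ} (i j : Fin N) (f : (Fin N → ℝ) → ℝ) : (Fin N → ℝ) → ℝ := fun v =>
  (1 / (2 * Real.pi)) * ∫ θ in (0 : ℝ)..(2 * Real.pi), f (rotate i j θ v)

/-- The Kac collision operator `(𝒦f)_N = ∑_{i<j} (R_{i,j} f_N - f_N)`. -/
def collOp (f : FunSeq) : FunSeq := fun N v =>
  ∑ i : Fin N, ∑ j ∈ Finset.Ioi i, (collide i j (f N) v - f N v)

/-- The generator `ℒ = μ(ℐ - Id) + ρ(𝒪 - 𝒩) + lam 𝒦`, where `(𝒩f)_N = N f_N`. -/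
def generator (μ ρ lam : ℝ) (f : FunSeq) : FunSeq := fun N v =>
  μ * (inOp f N v - f N v) + ρ * (outOp f N v - N * f N v) + lam * collOp f N v

/-- `u` is a solution on `[0, ∞)` of the master equation `u' = ℒ u`: the state `u t` lies in `D¹`
for all `t ≥ 0`, and the derivative exists in the norm of `L¹` (one-sided at `t = 0`). -/
structure IsSolution (μ ρ lam : ℝ) (u : ℝ → L1) : Prop where
  mem_D1 : ∀ t, 0 ≤ t → MemD1 (u t).fn
  master : ∀ t, 0 ≤ t → ∃ w : L1,
    (∀ N, w.fn N =ᵐ[volume] generator μ ρ lam (u t).fn N) ∧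
      HasDerivWithinAt u w (Set.Ici 0) t

/-- The Poisson weights `a_N = (μ/ρ)ᴺ exp(-μ/ρ) / N!`. -/
def poissonWeight (μ ρ : ℝ) (N : ℕ) : ℝ :=
  (μ / ρ) ^ N * Real.exp (-(μ / ρ)) / (N.factorial : ℝ)

/-- The Maxwellian `γ_N(v) = ∏_i exp(-π v_i²)`. -/
def maxwellian (N : ℕ) (v : Fin N → ℝ) : ℝ := ∏ i, Real.exp (-Real.pi * v i ^ 2)

/-- The grand canonical steady state `Γ_N = a_N γ_N`. -/
def steadyState (μ ρ : ℝ) : FunSeq := fun N v => poissonWeight μ ρ N * maxwellian N v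

/-- The relative density `h` of `f`, that is `f = Γ h`. -/
def relDensity (μ ρ : ℝ) (f : FunSeq) : FunSeq := fun N v => f N v / steadyState μ ρ N v

/-- The sequence `Γ h log h` (with `0 log 0 = 0`), where `f = Γ h`. -/
def entropyDensity (μ ρ : ℝ) (f : FunSeq) : FunSeq := fun N v =>
  steadyState μ ρ N v * (relDensity μ ρ f N v * Real.log (relDensity μ ρ f N v))

/-- The relative entropy `S(f | Γ) = ∑_N a_N ∫ h_N log h_N γ_N dv`. -/
def relEntropy (μ ρ : ℝ) (f : FunSeq) : ℝ :=
  ∑' N, poissonWeight μ ρ N *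
    ∫ v, relDensity μ ρ f N v * Real.log (relDensity μ ρ f N v) * maxwellian N v

end KacReservoir

end

/-! The reservoir is approximated by `k` independent slots. Each slot is refreshed at rate `ρ`: its
content is discarded, and it becomes occupied by a Maxwellian particle with probability `q = μ / (ρ
k)`. In equilibrium the number of occupied slots is binomial, and the Poisson law of `Γ` is its
limit as `k → ∞`.

For finite `k` the decay comes from independence. Let `e_j` be the mean of `h log h` after `j` slots
have been averaged out of `h`. By symmetry it does not matter which slots are chosen, and `e_0 - 2
e_1 + e_2 ≥ 0`, because conditionally on the other slots this is a relative entropy with respect to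
a product of marginals (`two_variable_entropy`). Hence the sequence `e_j` is convex, and averaging
out one slot removes at least the fraction `1 / k` of the entropy
(`IsDensity.slotMean_mulLog_slotAvg_le`). The `k` slots are refreshed at total rate `ρ k`, which
gives the rate `ρ` whatever `μ` is. Collisions preserve the Maxwellian and by Jensen do not increase
the entropy, so `lam` does not enter. The entropy is never differentiated: a small explicit Euler
step is a convex combination of refreshing and colliding, and the decay is proved step by step
(`IsDensity.slotMean_mulLog_slotStep_le`).

The slot generators are bounded and dissipative. Conjugated by the weights `(N + 1) ^ p` they
generate semigroups whose growth rate is independent of `k`, and they differ from the true generator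
by `O((N + 1) ^ 3 / k)`. Duhamel's formula then gives convergence in the weighted space that
represents `D¹`, and the limit solves the master equation (`exists_limit_semigroup`,
`exists_solution_of_weightInv`). Dissipativity gives uniqueness (`eq_zero_of_dissipative`).

Finally, the initial state is approximated by bounded slot densities with nearly the same entropy
(`exists_slot_approximation`). Their Euler iterates converge to `f(t)` in `L¹`, and the entropy
bound survives by Fatou: all masses being one, `x log x` may be replaced by the nonnegative `x log x
- x + 1` (`IsSlotLimit.tsum_lintegral_entropyFun_le`). -/

open MeasureTheory Filter Topology Set
noncomputable section

namespace KacReservoir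

/-! ### Bounded operators on `ℓ¹` direct sums -/

section Direct

variable {E : ℕ → Type*} [∀ N, NormedAddCommGroup (E N)] [∀ N, NormedSpace ℝ (E N)]
variable {F : Type*} [NormedAddCommGroup F] [NormedSpace ℝ F]

omit [∀ N, NormedSpace ℝ (E N)] in
theorem lp_one_hasSum_norm (f : lp E 1) : HasSum (fun N => ‖f N‖) ‖f‖ := by
  simpa using lp.hasSum_norm (p := 1) (by simp) f

theorem lp_one_hasSum_apply (T : lp E 1 →L[ℝ] F) (f : lp E 1) :
    HasSum (fun N => T (lp.single 1 N (f N))) (T f) :=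
  T.hasSum (lp.hasSum_single (by simp) f)

/-- In an `ℓ¹` sum the operator norm is the supremum over the columns, so all norm estimates of
generators below reduce to a fixed particle number. -/
theorem lp_one_opNorm_le (T : lp E 1 →L[ℝ] F) {K : ℝ} (hK : 0 ≤ K)
    (h : ∀ N x, ‖T (lp.single 1 N x)‖ ≤ K * ‖x‖) : ‖T‖ ≤ K := by
  refine T.opNorm_le_bound hK fun f => ?_
  have h1 := lp_one_hasSum_apply T f
  have h2 := (lp_one_hasSum_norm f).mul_left K
  exact h1.norm_le_of_bounded h2 fun N => h N _

theorem lp_one_clm_ext {S T : lp E 1 →L[ℝ] F}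
    (h : ∀ N x, S (lp.single 1 N x) = T (lp.single 1 N x)) : S = T := by
  ext f
  have h1 := lp_one_hasSum_apply S f
  simp only [h] at h1
  exact h1.unique (lp_one_hasSum_apply T f)

/-- The continuous linear map on an `ℓ¹` sum given by its restrictions to the summands. -/
def ofColumns [CompleteSpace F] (C : ∀ N, E N →L[ℝ] F) (h : ∃ K, ∀ N, ‖C N‖ ≤ K) :
    lp E 1 →L[ℝ] F :=
  have hs : ∀ f : lp E 1, Summable fun N => C N (f N) := fun f =>
    .of_norm_bounded ((lp_one_hasSum_norm f).summable.mul_left h.choose) fun N =>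
      (C N).le_of_opNorm_le (h.choose_spec N) _
  LinearMap.mkContinuous
    { toFun := fun f => ∑' N, C N (f N)
      map_add' := fun f g => by
        simp only [lp.coeFn_add, Pi.add_apply, map_add]
        exact (hs f).tsum_add (hs g)
      map_smul' := fun c f => by
        simp only [lp.coeFn_smul, Pi.smul_apply, map_smul, RingHom.id_apply]
        exact (hs f).tsum_const_smul c }
    h.choose fun f => by
      have h2 := (lp_one_hasSum_norm f).mul_left h.choose
      exact (hs f).hasSum.norm_le_of_bounded h2 fun N =>
        (C N).le_of_opNorm_le (h.choose_spec N) _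

theorem ofColumns_single [CompleteSpace F] (C : ∀ N, E N →L[ℝ] F) (h : ∃ K, ∀ N, ‖C N‖ ≤ K)
    (N : ℕ) (x : E N) : ofColumns C h (lp.single 1 N x) = C N x := by
  change ∑' M, C M ((lp.single 1 N x) M) = C N x
  rw [tsum_eq_single N]
  · rw [lp.single_apply_self]
  · intro M hM
    rw [lp.single_apply_ne _ _ _ hM, map_zero]

end Direct

/-! ### Exponentials of bounded operators, limits of semigroups, uniqueness -/

section Semigroup

variable {X : Type*} [NormedAddCommGroup X] [NormedSpace ℝ X] [CompleteSpace X]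

open NormedSpace in
omit [CompleteSpace X] in
theorem norm_exp_le_exp_norm_clm (A : X →L[ℝ] X) : ‖exp A‖ ≤ Real.exp ‖A‖ := by
  rw [exp_eq_tsum ℝ]
  have h := NormedSpace.expSeries_div_summable (𝔸 := ℝ) ‖A‖
  have h2 : HasSum (fun n : ℕ => ‖A‖ ^ n / (n.factorial : ℝ)) (Real.exp ‖A‖) := by
    rw [Real.exp_eq_exp_ℝ]; exact NormedSpace.expSeries_div_hasSum_exp ‖A‖
  refine tsum_of_norm_bounded h2 fun n => ?_
  rw [norm_smul, norm_inv, Real.norm_natCast, div_eq_inv_mul]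
  gcongr
  rcases Nat.eq_zero_or_pos n with rfl | hn
  -- The space may be trivial, so only `‖1‖ ≤ 1` is available.
  · rw [pow_zero, pow_zero]; exact ContinuousLinearMap.norm_id_le
  · exact norm_pow_le' A hn

open NormedSpace in
/-- If `1 + A / d` has norm at most `1 + ω / d`, then `exp (t A)` grows at most like `exp (ω t)`. -/
theorem norm_exp_smul_le (A : X →L[ℝ] X) {d ω : ℝ} (hd : 0 < d)
    (h : ‖1 + d⁻¹ • A‖ ≤ 1 + ω / d) {t : ℝ} (ht : 0 ≤ t) :
    ‖exp (t • A)‖ ≤ Real.exp (ω * t) := by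
  -- Splitting off the scalar `-t d` leaves `exp(-t d) exp(t d (1 + A / d))`, where the two factors
  -- combine to `exp(ω t)`; the direct bound `exp(t ‖A‖)` would depend on the size of `A`.
  have e : t • A = (t * d) • (1 + d⁻¹ • A) + (-(t * d)) • (1 : X →L[ℝ] X) := by
    rw [smul_add, smul_smul, mul_assoc, mul_inv_cancel₀ hd.ne', mul_one, neg_smul]; abel
  have e2 : exp ((-(t * d)) • (1 : X →L[ℝ] X)) = Real.exp (-(t * d)) • (1 : X →L[ℝ] X) := by
    have := (algebraMap_exp_comm (𝔸 := X →L[ℝ] X) (-(t * d))).symm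
    rw [Algebra.algebraMap_eq_smul_one, Algebra.algebraMap_eq_smul_one] at this
    rw [this, Real.exp_eq_exp_ℝ]
  have hc : Commute ((t * d) • (1 + d⁻¹ • A)) ((-(t * d)) • (1 : X →L[ℝ] X)) :=
    (Commute.one_right _).smul_right _
  let _ : NormedAlgebra ℚ (X →L[ℝ] X) := .restrictScalars ℚ ℝ _
  rw [e, exp_add_of_commute hc, e2, mul_smul_comm, mul_one, norm_smul,
    Real.norm_eq_abs, Real.abs_exp]
  calc _ ≤ Real.exp (-(t * d)) * Real.exp (t * d * (1 + ω / d)) := by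
        gcongr
        refine (norm_exp_le_exp_norm_clm _).trans (Real.exp_le_exp.2 ?_)
        rw [norm_smul, Real.norm_of_nonneg (by positivity)]
        gcongr
    _ = _ := by
        rw [← Real.exp_add]; congr 1; field_simp; ring

theorem hasDerivAt_exp_smul_apply (A : X →L[ℝ] X) (x : X) (t : ℝ) :
    HasDerivAt (fun s : ℝ => NormedSpace.exp (s • A) x) (NormedSpace.exp (t • A) (A x)) t := by
  have := (hasDerivAt_exp_smul_const (𝕂 := ℝ) A t).clm_apply (hasDerivAt_const t x)
  simpa using this

theorem hasDerivAt_exp_smul_apply' (A : X →L[ℝ] X) (x : X) (t : ℝ) :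
    HasDerivAt (fun s : ℝ => NormedSpace.exp (s • A) x) (A (NormedSpace.exp (t • A) x)) t := by
  have := (hasDerivAt_exp_smul_const' (𝕂 := ℝ) A t).clm_apply (hasDerivAt_const t x)
  simpa using this

omit [CompleteSpace X] in
-- Telescoping: for contractions the local errors of a scheme simply add up.
theorem norm_pow_sub_pow_le (a b : X →L[ℝ] X) (ha : ‖a‖ ≤ 1) (hb : ‖b‖ ≤ 1) (n : ℕ) :
    ‖a ^ n - b ^ n‖ ≤ n * ‖a - b‖ := by
  induction n with
  | zero => simp
  | succ n ih =>
    have e : a ^ (n + 1) - b ^ (n + 1) = a * (a ^ n - b ^ n) + (a - b) * b ^ n := by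
      rw [pow_succ', pow_succ']; noncomm_ring
    have hbn : ‖b ^ n‖ ≤ 1 := by
      rcases Nat.eq_zero_or_pos n with rfl | hn
      · rw [pow_zero]; exact ContinuousLinearMap.norm_id_le
      · exact (norm_pow_le' b hn).trans (pow_le_one₀ (norm_nonneg _) hb)
    rw [e]
    calc _ ≤ ‖a‖ * ‖a ^ n - b ^ n‖ + ‖a - b‖ * ‖b ^ n‖ :=
          (norm_add_le _ _).trans (add_le_add (norm_mul_le _ _) (norm_mul_le _ _))
      _ ≤ 1 * (n * ‖a - b‖) + ‖a - b‖ * 1 := by gcongr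
      _ = _ := by push_cast; ring

omit [CompleteSpace X] in
-- For steps `s ≤ 1 / d` the Euler step is a convex combination of `1` and `1 + A / d`.
theorem norm_one_add_smul_le (A : X →L[ℝ] X) {d : ℝ} (hd : 0 < d) (h : ‖1 + d⁻¹ • A‖ ≤ 1)
    {s : ℝ} (hs : 0 ≤ s) (hsd : s * d ≤ 1) : ‖1 + s • A‖ ≤ 1 := by
  have e : 1 + s • A = (1 - s * d) • (1 : X →L[ℝ] X) + (s * d) • (1 + d⁻¹ • A) := by
    rw [smul_add, smul_smul, mul_assoc, mul_inv_cancel₀ hd.ne', mul_one, sub_smul, one_smul]; abel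
  rw [e]
  refine (norm_add_le _ _).trans ?_
  rw [norm_smul, norm_smul, Real.norm_of_nonneg (by linarith), Real.norm_of_nonneg (by positivity)]
  have h1 : ‖(1 : X →L[ℝ] X)‖ ≤ 1 := ContinuousLinearMap.norm_id_le
  nlinarith [mul_le_mul_of_nonneg_left h1 (by linarith : 0 ≤ 1 - s * d),
    mul_le_mul_of_nonneg_left h (by positivity : 0 ≤ s * d)]

/-- Convergence of the explicit Euler scheme for a bounded dissipative operator. -/
theorem tendsto_euler (A : X →L[ℝ] X) {d : ℝ} (hd : 0 < d) (h : ‖1 + d⁻¹ • A‖ ≤ 1)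
    {t : ℝ} (ht : 0 ≤ t) :
    Tendsto (fun n : ℕ => (1 + (t / n) • A) ^ n) atTop (𝓝 (NormedSpace.exp (t • A))) := by
  have h0 : Tendsto (fun n : ℕ => t / (n : ℝ)) atTop (𝓝 0) :=
    tendsto_const_div_atTop_nhds_zero_nat t
  have hder : HasDerivAt (fun s : ℝ => NormedSpace.exp (s • A)) A 0 := by
    have := hasDerivAt_exp_smul_const (𝕂 := ℝ) A 0
    simpa using this
  rw [hasDerivAt_iff_isLittleO] at hder
  have hlo := hder.comp_tendsto h0
  rw [tendsto_iff_norm_sub_tendsto_zero]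
  rw [Asymptotics.isLittleO_iff] at hlo
  rw [Metric.tendsto_atTop]
  intro ε hε
  -- The tolerance is relative to the step `t / n`; after `n` steps it amounts to `ε t / (t + 1) <
  -- ε`, also for `t = 0`.
  have hc : 0 < ε / (t + 1) := by positivity
  have hsmall : ∀ᶠ n : ℕ in atTop, t / (n : ℝ) * d ≤ 1 := by
    have := (h0.mul_const d)
    rw [zero_mul] at this
    filter_upwards [this.eventually (gt_mem_nhds one_pos)] with n hn using hn.le
  obtain ⟨n0, hn0⟩ := ((hlo hc).and (hsmall.and (eventually_gt_atTop 0))).exists_forall_of_atTop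
  refine ⟨n0, fun n hn => ?_⟩
  obtain ⟨h1, h2, h3⟩ := hn0 n hn
  have hnpos : (0 : ℝ) < n := by exact_mod_cast h3
  simp only [Function.comp, sub_zero, zero_smul, NormedSpace.exp_zero] at h1
  have hb1 : ‖NormedSpace.exp ((t / n) • A)‖ ≤ 1 := by
    have := norm_exp_smul_le A (ω := 0) hd (by simpa using h) (div_nonneg ht hnpos.le)
    simpa using this
  let _ : NormedAlgebra ℚ (X →L[ℝ] X) := .restrictScalars ℚ ℝ _
  have hpow : NormedSpace.exp (t • A) = NormedSpace.exp ((t / n) • A) ^ n := by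
    rw [← NormedSpace.exp_nsmul, ← Nat.cast_smul_eq_nsmul ℝ, smul_smul]
    congr 2; field_simp
  rw [Real.dist_eq, sub_zero, abs_norm, hpow]
  refine (norm_pow_sub_pow_le _ _ (norm_one_add_smul_le A hd h (by positivity) h2) hb1 n).trans_lt ?_
  have e : ‖1 + (t / n) • A - NormedSpace.exp ((t / n) • A)‖
      = ‖NormedSpace.exp ((t / n) • A) - 1 - (t / (n : ℝ)) • A‖ := by
    rw [← norm_neg]; congr 1; abel
  rw [e]
  calc (n : ℝ) * _ ≤ n * (ε / (t + 1) * ‖t / (n : ℝ)‖) := by gcongr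
    _ = ε * (t / (t + 1)) := by
        rw [Real.norm_of_nonneg (by positivity)]; field_simp
    _ < ε := by
        have : t / (t + 1) < 1 := by rw [div_lt_one (by positivity)]; linarith
        nlinarith

/-- Duhamel's formula: the path `s ↦ exp((t - s) A) exp(s B) x` joins the two values, and its
derivative is `-exp((t - s) A) (A - B) exp(s B) x`. -/
theorem norm_exp_sub_exp_apply_le (A B : X →L[ℝ] X) {ω : ℝ} (hω : 0 ≤ ω)
    (hA : ∀ t, 0 ≤ t → ‖NormedSpace.exp (t • A)‖ ≤ Real.exp (ω * t)) (x : X) {T t c : ℝ}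
    (ht : t ∈ Icc 0 T)
    (hc : ∀ s ∈ Icc 0 t, ‖(A - B) (NormedSpace.exp (s • B) x)‖ ≤ c) :
    ‖NormedSpace.exp (t • A) x - NormedSpace.exp (t • B) x‖ ≤ Real.exp (ω * T) * c * T := by
  have hc0 : 0 ≤ c := (norm_nonneg _).trans (hc 0 ⟨le_rfl, ht.1⟩)
  set φ : ℝ → X := fun s => NormedSpace.exp ((t - s) • A) (NormedSpace.exp (s • B) x) with hφ
  have hder : ∀ s, HasDerivAt φ
      (-(NormedSpace.exp ((t - s) • A) ((A - B) (NormedSpace.exp (s • B) x)))) s := by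
    intro s
    have h1 : HasDerivAt (fun s : ℝ => NormedSpace.exp ((t - s) • A))
        (-(NormedSpace.exp ((t - s) • A) * A)) s := by
      have := (hasDerivAt_exp_smul_const (𝕂 := ℝ) A (t - s)).scomp s
        ((hasDerivAt_id s).const_sub t)
      simpa using! this
    have h2 := h1.clm_apply (hasDerivAt_exp_smul_apply' B x s)
    convert h2 using 1
    simp only [sub_apply, map_sub, neg_apply,
      mul_apply_eq_comp]
    abel
  have := norm_image_sub_le_of_norm_deriv_le_segment' (f := φ) (a := 0) (b := t)
    (C := Real.exp (ω * T) * c) (fun s _ => (hder s).hasDerivWithinAt) (fun s hs => ?_) t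
    ⟨ht.1, le_rfl⟩
  · rw [← norm_neg]
    have e : -(NormedSpace.exp (t • A) x - NormedSpace.exp (t • B) x) = φ t - φ 0 := by
      simp [hφ]
    rw [e]
    refine this.trans ?_
    have : 0 ≤ Real.exp (ω * T) * c := by positivity
    nlinarith [ht.2]
  · rw [norm_neg]
    refine (ContinuousLinearMap.le_opNorm _ _).trans ?_
    have h1 := hA (t - s) (by linarith [hs.2])
    have h2 := hc s ⟨hs.1, hs.2.le⟩
    have h3 : Real.exp (ω * (t - s)) ≤ Real.exp (ω * T) := by
      apply Real.exp_le_exp.2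
      have := ht.2; have := hs.1
      nlinarith
    calc _ ≤ Real.exp (ω * T) * c := mul_le_mul (h1.trans h3) h2 (norm_nonneg _) (by positivity)

/-- Convergence of semigroups with bounded generators that converge on a dense invariant
subspace. -/
theorem exists_limit_semigroup (L L' : ℕ → X →L[ℝ] X) (ι : X →L[ℝ] X) {ω ω' : ℝ} (hω : 0 ≤ ω)
    (hω' : 0 ≤ ω')
    (hL : ∀ k t, 0 ≤ t → ‖NormedSpace.exp (t • L k)‖ ≤ Real.exp (ω * t))
    (hL' : ∀ k t, 0 ≤ t → ‖NormedSpace.exp (t • L' k)‖ ≤ Real.exp (ω' * t))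
    (hι : DenseRange ι)
    (hcomm : ∀ (k : ℕ) (s : ℝ),
      NormedSpace.exp (s • L k) ∘L ι = ι ∘L NormedSpace.exp (s • L' k))
    (ε : ℕ → ℝ) (hε : Tendsto ε atTop (𝓝 0))
    (hLL : ∀ k m x, ‖(L k - L m) (ι x)‖ ≤ (ε k + ε m) * ‖x‖) (g : X) :
    ∃ v : ℝ → X, ContinuousOn v (Ici 0) ∧
      ∀ T : ℝ, TendstoUniformlyOn (fun k t => NormedSpace.exp (t • L k) g) v atTop (Icc 0 T) := by
  -- The signs of the `ε k` are not assumed; they follow from `hLL` as soon as there is a nonzero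
  -- vector.
  have hε0 : ∀ k m y, 0 < ‖y‖ → 0 ≤ ε k + ε m := fun k m y hy =>
    nonneg_of_mul_nonneg_left ((norm_nonneg _).trans (hLL k m y)) hy
  have hC : ∀ T : ℝ, UniformCauchySeqOn (fun k t => NormedSpace.exp (t • L k) g) atTop (Icc 0 T) := by
    intro T
    rw [Metric.uniformCauchySeqOn_iff]
    intro δ hδ
    rcases lt_or_ge T 0 with hT | hT
    · exact ⟨0, fun m _ n _ x hx => absurd (hx.1.trans hx.2) (not_le.2 hT)⟩
    set K := Real.exp (ω * T) with hK
    have hK0 : 0 < K := Real.exp_pos _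
    -- An `ε / 3` argument. Replacing `g` by `ι y` costs a uniformly small error; on the range of
    -- `ι`, which the semigroups leave invariant by `hcomm`, the generators are close in norm and
    -- Duhamel's formula applies.
    obtain ⟨y, hy⟩ : ∃ y, ‖g - ι y‖ < δ / (3 * K) := by
      have := Metric.denseRange_iff.1 hι g (δ / (3 * K)) (by positivity)
      simpa [dist_eq_norm] using this
    have hlim : Tendsto (fun k : ℕ => K * (2 * ε k * (Real.exp (ω' * T) * ‖y‖)) * T) atTop (𝓝 0) := by
      have := (((hε.const_mul 2).mul_const (Real.exp (ω' * T) * ‖y‖)).const_mul K).mul_const T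
      simpa using this
    obtain ⟨n0, hn0⟩ := (hlim.eventually (gt_mem_nhds (show 0 < δ / 3 by positivity))).exists_forall_of_atTop
    refine ⟨n0, fun m hm n hn t ht => ?_⟩
    have hbd : ∀ k, ‖NormedSpace.exp (t • L k)‖ ≤ K := fun k =>
      (hL k t ht.1).trans (Real.exp_le_exp.2 (by nlinarith [ht.2]))
    have hmid := norm_exp_sub_exp_apply_le (L m) (L n) hω (hL m) (ι y) ht
      (c := (ε m + ε n) * (Real.exp (ω' * T) * ‖y‖)) (by
        intro s hs
        have hc := congrArg (fun f : X →L[ℝ] X => f y) (hcomm n s)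
        simp only [ContinuousLinearMap.comp_apply] at hc
        rw [hc]
        refine (hLL m n _).trans ?_
        have h1 : ‖NormedSpace.exp (s • L' n) y‖ ≤ Real.exp (ω' * T) * ‖y‖ := by
          refine (ContinuousLinearMap.le_opNorm _ _).trans ?_
          gcongr
          exact (hL' n s hs.1).trans (Real.exp_le_exp.2 (by nlinarith [ht.2, hs.2]))
        rcases (norm_nonneg (NormedSpace.exp (s • L' n) y)).eq_or_lt with h0 | h0
        · rw [← h0, mul_zero]
          rcases (norm_nonneg y).eq_or_lt with h0' | h0'
          · rw [← h0']; simp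
          · have := hε0 m n y h0'; positivity
        · exact mul_le_mul_of_nonneg_left h1 (hε0 m n _ h0))
    have h3 : K * ((ε m + ε n) * (Real.exp (ω' * T) * ‖y‖)) * T < δ / 3 := by
      have a := hn0 m hm; have b := hn0 n hn
      nlinarith
    have h1 : ∀ k, ‖NormedSpace.exp (t • L k) g - NormedSpace.exp (t • L k) (ι y)‖ < δ / 3 := by
      intro k
      rw [← map_sub]
      calc _ ≤ K * ‖g - ι y‖ := (ContinuousLinearMap.le_opNorm _ _).trans (by gcongr; exact hbd k)
        _ < K * (δ / (3 * K)) := by gcongr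
        _ = δ / 3 := by field_simp
    rw [dist_eq_norm]
    have e : NormedSpace.exp (t • L m) g - NormedSpace.exp (t • L n) g
        = (NormedSpace.exp (t • L m) g - NormedSpace.exp (t • L m) (ι y))
          + (NormedSpace.exp (t • L m) (ι y) - NormedSpace.exp (t • L n) (ι y))
          - (NormedSpace.exp (t • L n) g - NormedSpace.exp (t • L n) (ι y)) := by abel
    rw [e]
    refine (norm_sub_le _ _).trans_lt ?_
    have := norm_add_le (NormedSpace.exp (t • L m) g - NormedSpace.exp (t • L m) (ι y))
      (NormedSpace.exp (t • L m) (ι y) - NormedSpace.exp (t • L n) (ι y))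
    linarith [h1 m, h1 n, hmid]
  have hp : ∀ t : ℝ, ∃ y, 0 ≤ t → Tendsto (fun k => NormedSpace.exp (t • L k) g) atTop (𝓝 y) := by
    intro t
    by_cases ht : 0 ≤ t
    · obtain ⟨y, hy⟩ := cauchySeq_tendsto_of_complete ((hC t).cauchySeq ⟨ht, le_rfl⟩)
      exact ⟨y, fun _ => hy⟩
    · exact ⟨0, fun h => absurd h ht⟩
  choose v hv using hp
  have hu : ∀ T : ℝ, TendstoUniformlyOn (fun k t => NormedSpace.exp (t • L k) g) v atTop (Icc 0 T) :=
    fun T => (hC T).tendstoUniformlyOn_of_tendsto fun t ht => hv t ht.1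
  refine ⟨v, fun t ht => ?_, hu⟩
  have hcont : ContinuousOn v (Icc 0 (t + 1)) := (hu (t + 1)).continuousOn
    (Frequently.of_forall fun k => (continuous_iff_continuousAt.2 fun s =>
      (hasDerivAt_exp_smul_apply (L k) g s).continuousAt).continuousOn)
  refine (hcont t ⟨ht, by linarith⟩).mono_of_mem_nhdsWithin ?_
  rw [← Ici_inter_Iic]
  exact inter_mem self_mem_nhdsWithin (mem_nhdsWithin_of_mem_nhds (Iic_mem_nhds (by linarith)))

/-- The limit of the semigroups solves the limiting equation, read through `ι`. -/
theorem hasDerivWithinAt_limit_semigroup (L : ℕ → X →L[ℝ] X) (ι B : X →L[ℝ] X) {ω K : ℝ}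
    (hω : 0 ≤ ω)
    (hL : ∀ k t, 0 ≤ t → ‖NormedSpace.exp (t • L k)‖ ≤ Real.exp (ω * t))
    (hK : ∀ k, ‖ι ∘L L k‖ ≤ K)
    (hB : ∀ x, Tendsto (fun k => ι (L k x)) atTop (𝓝 (B x))) (g : X) (v : ℝ → X)
    (hv : ContinuousOn v (Ici 0))
    (hlim : ∀ t, 0 ≤ t → Tendsto (fun k => NormedSpace.exp (t • L k) g) atTop (𝓝 (v t))) :
    ∀ t, 0 ≤ t → HasDerivWithinAt (fun t => ι (v t)) (B (v t)) (Ici 0) t := by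
  -- Freezing `v` at negative times makes the integrand continuous on the whole line, so the
  -- integral has a two-sided derivative even at `0`.
  have hv' : Continuous fun s => B (v (max s 0)) :=
    B.continuous.comp (hv.comp_continuous (by fun_prop) fun s => mem_Ici.2 (le_max_right _ _))
  have hK0 : 0 ≤ K := (norm_nonneg _).trans (hK 0)
  have hint : ∀ t, 0 ≤ t → ι (v t) = ι g + ∫ s in (0 : ℝ)..t, B (v (max s 0)) := by
    intro t ht
    have hk : ∀ k, ι (NormedSpace.exp (t • L k) g)
        = ι g + ∫ s in (0 : ℝ)..t, ι (L k (NormedSpace.exp (s • L k) g)) := by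
      intro k
      have hcont : Continuous fun s : ℝ => ι (L k (NormedSpace.exp (s • L k) g)) :=
        ι.continuous.comp ((L k).continuous.comp (continuous_iff_continuousAt.2 fun s =>
          (hasDerivAt_exp_smul_apply (L k) g s).continuousAt))
      rw [intervalIntegral.integral_eq_sub_of_hasDerivAt
        (f := fun s : ℝ => ι (NormedSpace.exp (s • L k) g))
        (fun s _ => ι.hasFDerivAt.comp_hasDerivAt s (hasDerivAt_exp_smul_apply' (L k) g s))
        (hcont.intervalIntegrable _ _)]
      simp
    have h1 : Tendsto (fun k => ι (NormedSpace.exp (t • L k) g)) atTop (𝓝 (ι (v t))) :=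
      (ι.continuous.tendsto _).comp (hlim t ht)
    refine tendsto_nhds_unique h1 ?_
    simp only [hk]
    refine tendsto_const_nhds.add ?_
    refine intervalIntegral.tendsto_integral_filter_of_dominated_convergence
      (fun _ => K * (Real.exp (ω * t) * ‖g‖)) ?_ ?_ ?_ ?_
    · refine Eventually.of_forall fun k => Continuous.aestronglyMeasurable ?_
      exact ι.continuous.comp ((L k).continuous.comp (continuous_iff_continuousAt.2 fun s =>
          (hasDerivAt_exp_smul_apply (L k) g s).continuousAt))
    · refine Eventually.of_forall fun k => Eventually.of_forall fun s hs => ?_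
      rw [uIoc_of_le ht] at hs
      refine ((ι ∘L L k).le_of_opNorm_le (hK k) _).trans ?_
      gcongr
      refine (ContinuousLinearMap.le_opNorm _ _).trans ?_
      gcongr
      exact (hL k s hs.1.le).trans (Real.exp_le_exp.2 (by nlinarith [hs.2]))
    · exact intervalIntegrable_const
    · refine Eventually.of_forall fun s hs => ?_
      rw [uIoc_of_le ht] at hs
      rw [max_eq_left hs.1.le]
      have h2 := hB (v s)
      have h3 : Tendsto (fun k => ι (L k (NormedSpace.exp (s • L k) g - v s))) atTop (𝓝 0) := by
        refine squeeze_zero_norm (fun k => (ι ∘L L k).le_of_opNorm_le (hK k) _) ?_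
        have := (tendsto_iff_norm_sub_tendsto_zero.1 (hlim s hs.1.le)).const_mul K
        simpa using this
      have := h3.add h2
      simpa using this
  intro t ht
  have hd : HasDerivAt (fun t => ι g + ∫ s in (0 : ℝ)..t, B (v (max s 0))) (B (v t)) t := by
    have := (intervalIntegral.integral_hasDerivAt_right (hv'.intervalIntegrable 0 t)
      (hv'.stronglyMeasurableAtFilter _ _) hv'.continuousAt).const_add (ι g)
    rwa [max_eq_left ht] at this
  exact hd.hasDerivWithinAt.congr (fun s hs => hint s hs) (hint t ht)

omit [CompleteSpace X] in
/-- Uniqueness for an evolution equation whose generator is a pointwise limit of bounded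
dissipative operators. -/
theorem eq_zero_of_dissipative (L : ℕ → X →L[ℝ] X) (d : ℕ → ℝ) (hd : ∀ k, 0 < d k)
    (hL : ∀ k s, 0 ≤ s → s * d k ≤ 1 → ‖1 + s • L k‖ ≤ 1) (z z' : ℝ → X)
    (hz : ∀ t, 0 ≤ t → HasDerivWithinAt z (z' t) (Ici 0) t)
    (hlim : ∀ t, 0 ≤ t → Tendsto (fun k => L k (z t)) atTop (𝓝 (z' t))) (h0 : z 0 = 0) :
    ∀ t, 0 ≤ t → z t = 0 := by
  intro T hT
  -- The norm of `z` is compared with the constant `0`: its right slopes are at most any `r > 0`,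
  -- because `z s` is close to `(1 + (s - t) L k) (z t)` and that operator is a contraction.
  have key := image_le_of_liminf_slope_right_le_deriv_boundary (f := fun t => ‖z t‖) (a := 0)
    (b := T) (B := fun _ => (0 : ℝ)) (B' := fun _ => 0)
    (continuous_norm.comp_continuousOn fun t ht =>
      ((hz t ht.1).continuousWithinAt).mono Icc_subset_Ici_self) (by simp [h0]) continuousOn_const
    (fun t _ => hasDerivWithinAt_const _ _ _) ?_
  · exact norm_le_zero_iff.1 (key ⟨hT, le_rfl⟩)
  · intro t ht r hr
    -- The index `k` is fixed first, by consistency at `z t`; only then is `s` taken so close to `t`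
    -- that `(s - t) d k ≤ 1`.
    obtain ⟨k, hk⟩ := ((tendsto_iff_norm_sub_tendsto_zero.1 (hlim t ht.1)).eventually
      (gt_mem_nhds (show 0 < r / 2 by positivity))).exists
    have hzt : HasDerivWithinAt z (z' t) (Ioi t) t :=
      (hz t ht.1).mono (Ioi_subset_Ici_self.trans (Ici_subset_Ici.2 ht.1))
    rw [hasDerivWithinAt_iff_isLittleO, Asymptotics.isLittleO_iff] at hzt
    have h1 := hzt (show 0 < r / 4 by positivity)
    have h2 : ∀ᶠ s in 𝓝[>] t, s < t + (d k)⁻¹ :=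
      mem_nhdsWithin_of_mem_nhds (Iio_mem_nhds (by linarith [inv_pos.2 (hd k)]))
    refine Eventually.frequently ?_
    filter_upwards [h1, h2, self_mem_nhdsWithin] with s hs1 hs2 hs3
    have hst : 0 < s - t := sub_pos.2 hs3
    rw [slope_def_field, div_lt_iff₀ hst]
    rw [Real.norm_of_nonneg hst.le] at hs1
    have h3 : ‖(1 + (s - t) • L k) (z t)‖ ≤ ‖z t‖ := by
      have h4 := hL k (s - t) hst.le (by
        have : s - t ≤ (d k)⁻¹ := by linarith
        calc _ ≤ (d k)⁻¹ * d k := by have := hd k; gcongr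
          _ = 1 := inv_mul_cancel₀ (hd k).ne')
      simpa using ContinuousLinearMap.le_of_opNorm_le _ h4 (z t)
    have e : z s = (1 + (s - t) • L k) (z t) + (z s - z t - (s - t) • z' t)
        - (s - t) • (L k (z t) - z' t) := by
      simp only [add_apply, one_apply_eq_self,
        smul_apply, smul_sub]
      abel
    have h5 : ‖z s‖ ≤ ‖z t‖ + r / 4 * (s - t) + (s - t) * (r / 2) := by
      rw [e]
      refine (norm_sub_le _ _).trans (add_le_add ((norm_add_le _ _).trans (add_le_add h3 hs1)) ?_)
      rw [norm_smul, Real.norm_of_nonneg hst.le]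
      gcongr
    nlinarith

end Semigroup

end KacReservoir
end

/-! ### Pointwise operators that induce contractions of `L¹` -/

noncomputable section

namespace KacReservoir

/-- An operator on functions, defined pointwise, that induces a contraction of `L¹` spaces. -/
structure IsL1Contraction {X Y : Type*} [MeasurableSpace X] [MeasurableSpace Y] (μ : Measure X)
    (ν : Measure Y) (Φ : (X → ℝ) → (Y → ℝ)) : Prop where
  integrable : ∀ f, Integrable f μ → Integrable (Φ f) ν
  add : ∀ f g, Integrable f μ → Integrable g μ → Φ (f + g) =ᵐ[ν] Φ f + Φ g
  smul : ∀ (c : ℝ) f, Φ (c • f) = c • Φ f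
  norm_le : ∀ f, Integrable f μ → ∫ y, |Φ f y| ∂ν ≤ ∫ x, |f x| ∂μ

namespace IsL1Contraction

variable {X Y : Type*} [MeasurableSpace X] [MeasurableSpace Y] {μ : Measure X} {ν : Measure Y}
  {Φ : (X → ℝ) → (Y → ℝ)}

/-- The norm bound kills null functions and additivity transfers this to differences, so a pointwise
formula descends to classes modulo null sets. -/
theorem congr_ae (h : IsL1Contraction μ ν Φ) {f g : X → ℝ} (hg : Integrable g μ)
    (hfg : f =ᵐ[μ] g) : Φ f =ᵐ[ν] Φ g := by
  have hf : Integrable f μ := hg.congr hfg.symm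
  have hd : Integrable (f - g) μ := hf.sub hg
  have h0 : ∫ x, |(f - g) x| ∂μ = 0 := by
    rw [integral_eq_zero_iff_of_nonneg (fun x => abs_nonneg _) hd.abs]
    filter_upwards [hfg] with x hx
    simp [hx]
  have h1 : ∫ y, |Φ (f - g) y| ∂ν = 0 :=
    le_antisymm ((h.norm_le _ hd).trans h0.le) (integral_nonneg fun y => abs_nonneg _)
  rw [integral_eq_zero_iff_of_nonneg (fun x => abs_nonneg _) (h.integrable _ hd).abs] at h1
  have h2 := h.add _ _ hd hg
  rw [sub_add_cancel] at h2
  filter_upwards [h1, h2] with y hy1 hy2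
  rw [hy2, Pi.add_apply, abs_eq_zero.1 hy1, zero_add]

/-- The contraction of `L¹` spaces induced by a pointwise operator. -/
def toL1 (h : IsL1Contraction μ ν Φ) : Lp ℝ 1 μ →L[ℝ] Lp ℝ 1 ν :=
  LinearMap.mkContinuous
    { toFun := fun f => (h.integrable f (L1.integrable_coeFn f)).toL1 (Φ f)
      map_add' := fun f g => by
        rw [← Integrable.toL1_add, Integrable.toL1_eq_toL1_iff]
        have hf := L1.integrable_coeFn f
        have hg := L1.integrable_coeFn g
        exact (h.congr_ae (hf.add hg) (Lp.coeFn_add f g)).trans (h.add _ _ hf hg)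
      map_smul' := fun c f => by
        have hf := L1.integrable_coeFn f
        rw [RingHom.id_apply, ← Integrable.toL1_smul, Integrable.toL1_eq_toL1_iff]
        have := h.congr_ae (hf.smul c) (Lp.coeFn_smul c f)
        rw [h.smul] at this
        exact this }
    1 fun f => by
      have hf := L1.integrable_coeFn f
      rw [one_mul, L1.norm_eq_integral_norm, L1.norm_eq_integral_norm]
      refine le_trans (le_of_eq ?_) (h.norm_le _ hf)
      refine integral_congr_ae ?_
      filter_upwards [(h.integrable f hf).coeFn_toL1] with y hy
      simp only [LinearMap.coe_mk, AddHom.coe_mk, hy, Real.norm_eq_abs]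

theorem coeFn_toL1 (h : IsL1Contraction μ ν Φ) (f : Lp ℝ 1 μ) : h.toL1 f =ᵐ[ν] Φ f :=
  (h.integrable f (L1.integrable_coeFn f)).coeFn_toL1

theorem coeFn_toL1_congr (h : IsL1Contraction μ ν Φ) {f : Lp ℝ 1 μ} {g : X → ℝ}
    (hg : f =ᵐ[μ] g) : h.toL1 f =ᵐ[ν] Φ g :=
  (h.coeFn_toL1 f).trans (h.congr_ae ((L1.integrable_coeFn f).congr hg) hg)

theorem norm_toL1_le (h : IsL1Contraction μ ν Φ) : ‖h.toL1‖ ≤ 1 :=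
  LinearMap.mkContinuous_norm_le _ zero_le_one _

end IsL1Contraction

/-- Averaging along the fibres of a measure preserving map is a contraction of `L¹`. -/
theorem isL1Contraction_integral {Ω X Y : Type*} [MeasurableSpace Ω] [MeasurableSpace X]
    [MeasurableSpace Y] {κ : Measure Ω} [SFinite κ] {μ : Measure X} {ν : Measure Y} [SFinite ν]
    {p : Ω × Y → X} (hp : MeasurePreserving p (κ.prod ν) μ) :
    IsL1Contraction μ ν fun f y => ∫ ω, f (p (ω, y)) ∂κ where
  integrable f hf := (hp.integrable_comp_of_integrable hf).integral_prod_right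
  add f g hf hg := by
    filter_upwards [(hp.integrable_comp_of_integrable hf).prod_left_ae,
      (hp.integrable_comp_of_integrable hg).prod_left_ae] with y h1 h2
    exact integral_add h1 h2
  smul c f := by
    ext y
    exact integral_const_mul _ _
  norm_le f hf := by
    have h1 := hp.integrable_comp_of_integrable hf
    calc ∫ y, |∫ ω, f (p (ω, y)) ∂κ| ∂ν ≤ ∫ y, ∫ ω, |f (p (ω, y))| ∂κ ∂ν :=
          integral_mono h1.integral_prod_right.abs h1.abs.integral_prod_right
            fun y => abs_integral_le_integral_abs
      _ = ∫ z, |f (p z)| ∂(κ.prod ν) := (integral_prod_symm _ h1.abs).symm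
      _ = ∫ x, |f x| ∂μ := by
          rw [← hp.map_eq, integral_map hp.measurable.aemeasurable]
          rw [hp.map_eq]
          exact hf.aestronglyMeasurable.norm

/-! ### Insertion, removal and rotation of particles -/

section Elementary

variable {n : ℕ}

theorem integral_exp_neg_pi_sq : ∫ w : ℝ, Real.exp (-Real.pi * w ^ 2) = 1 := by
  rw [integral_gaussian, div_self Real.pi_ne_zero, Real.sqrt_one]

theorem integrable_exp_neg_pi_sq : Integrable fun w : ℝ => Real.exp (-Real.pi * w ^ 2) :=
  integrable_exp_neg_mul_sq Real.pi_pos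

/-- Adding a Maxwellian particle at the position `i`. -/
theorem isL1Contraction_insert (i : Fin (n + 1)) :
    IsL1Contraction (volume : Measure (Fin n → ℝ)) (volume : Measure (Fin (n + 1) → ℝ))
      fun f v => Real.exp (-Real.pi * v i ^ 2) * f (fun j => v (i.succAbove j)) := by
  have hp := volume_preserving_piFinSuccAbove (fun _ : Fin (n + 1) => ℝ) i
  refine ⟨fun f hf => ?_, fun f g _ _ => ?_, fun c f => ?_, fun f hf => ?_⟩
  · exact hp.integrable_comp_of_integrable (integrable_exp_neg_pi_sq.mul_prod hf)
  · exact ae_of_all _ fun v => by simp [mul_add]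
  · ext v; simp; ring
  · refine le_of_eq ?_
    have h1 := hp.integral_comp' (g := fun z : ℝ × (Fin n → ℝ) =>
      Real.exp (-Real.pi * z.1 ^ 2) * |f z.2|)
    rw [show (volume : Measure (ℝ × (Fin n → ℝ))) = volume.prod volume from rfl,
      integral_prod_mul (fun w : ℝ => Real.exp (-Real.pi * w ^ 2)) (fun u => |f u|),
      integral_exp_neg_pi_sq, one_mul] at h1
    rw [← h1]
    refine integral_congr_ae (ae_of_all _ fun v => ?_)
    simp only [abs_mul, Real.abs_exp]
    rfl

/-- Removing the particle at the position `i`. -/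
theorem isL1Contraction_remove (i : Fin (n + 1)) :
    IsL1Contraction (volume : Measure (Fin (n + 1) → ℝ)) (volume : Measure (Fin n → ℝ))
      fun f v => ∫ w : ℝ, f (i.insertNth (α := fun _ => ℝ) w v) :=
  isL1Contraction_integral ((volume_preserving_piFinSuccAbove (fun _ : Fin (n + 1) => ℝ) i).symm _)

theorem continuous_rotate (i j : Fin n) :
    Continuous fun z : ℝ × (Fin n → ℝ) => rotate i j z.1 z.2 := by
  refine continuous_pi fun k => ?_
  unfold rotate
  split_ifs <;> fun_prop

theorem rotate_rotate {i j : Fin n} (hij : i ≠ j) (θ η : ℝ) (v : Fin n → ℝ) :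
    rotate i j θ (rotate i j η v) = rotate i j (θ + η) v := by
  ext k
  simp only [rotate, if_neg hij.symm, if_true, Real.cos_add, Real.sin_add]
  split_ifs <;> ring

theorem rotate_zero (i j : Fin n) (v : Fin n → ℝ) : rotate i j 0 v = v := by
  ext k
  simp only [rotate, Real.cos_zero, Real.sin_zero]
  split_ifs with h1 h2 <;> simp [*]

theorem sum_rotate_sq {i j : Fin n} (hij : i ≠ j) (θ : ℝ) (v : Fin n → ℝ) :
    ∑ k, rotate i j θ v k ^ 2 = ∑ k, v k ^ 2 := by
  have hj : j ∈ Finset.univ.erase i := by simp [hij.symm]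
  rw [← Finset.add_sum_erase _ _ (Finset.mem_univ i), ← Finset.add_sum_erase _ _ hj,
    ← Finset.add_sum_erase _ (fun k => v k ^ 2) (Finset.mem_univ i),
    ← Finset.add_sum_erase _ (fun k => v k ^ 2) hj, ← add_assoc, ← add_assoc]
  congr 1
  · simp only [rotate, if_neg hij.symm, if_true]
    nlinarith [Real.sin_sq_add_cos_sq θ]
  · refine Finset.sum_congr rfl fun k hk => ?_
    simp only [Finset.mem_erase] at hk
    simp [rotate, hk.1, hk.2.1]

/-- Rotations as linear isometries of the Euclidean space. -/
def rotateIsometry {i j : Fin n} (hij : i ≠ j) (θ : ℝ) :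
    EuclideanSpace ℝ (Fin n) ≃ₗᵢ[ℝ] EuclideanSpace ℝ (Fin n) where
  toFun x := WithLp.toLp 2 (rotate i j θ x.ofLp)
  invFun x := WithLp.toLp 2 (rotate i j (-θ) x.ofLp)
  map_add' x y := by
    ext k
    simp only [rotate, PiLp.add_apply]
    split_ifs <;> ring
  map_smul' c x := by
    ext k
    simp only [rotate, PiLp.smul_apply, smul_eq_mul, RingHom.id_apply]
    split_ifs <;> ring
  left_inv x := by simp [rotate_rotate hij, rotate_zero]
  right_inv x := by simp [rotate_rotate hij, rotate_zero]
  norm_map' x := by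
    rw [EuclideanSpace.norm_eq, EuclideanSpace.norm_eq]
    congr 1
    simpa using sum_rotate_sq hij θ x.ofLp

/-- Lebesgue measure on `Fin n → ℝ` agrees with that of the Euclidean space, where linear isometries
preserve volume. -/
theorem measurePreserving_rotate {i j : Fin n} (hij : i ≠ j) (θ : ℝ) :
    MeasurePreserving (rotate i j θ) volume volume := by
  have h1 := (rotateIsometry hij θ).measurePreserving
  have h2 := PiLp.volume_preserving_ofLp (Fin n)
  have h3 := PiLp.volume_preserving_toLp (Fin n)
  exact h2.comp (h1.comp h3)

/-- The uniform probability measure on `(0, 2π]`. -/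
def angleMeasure : Measure ℝ :=
  ENNReal.ofReal (1 / (2 * Real.pi)) • volume.restrict (Ioc 0 (2 * Real.pi))

instance : IsProbabilityMeasure angleMeasure := by
  constructor
  rw [angleMeasure, Measure.smul_apply, Measure.restrict_apply_univ, Real.volume_Ioc, smul_eq_mul,
    ← ENNReal.ofReal_mul (by positivity), sub_zero, one_div,
    inv_mul_cancel₀ (by positivity), ENNReal.ofReal_one]

theorem integral_angleMeasure (g : ℝ → ℝ) :
    ∫ θ, g θ ∂angleMeasure = (1 / (2 * Real.pi)) * ∫ θ in (0 : ℝ)..(2 * Real.pi), g θ := by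
  rw [angleMeasure, integral_smul_measure, intervalIntegral.integral_of_le (by positivity),
    ENNReal.toReal_ofReal (by positivity), smul_eq_mul]

theorem collide_eq (i j : Fin n) (f : (Fin n → ℝ) → ℝ) (v : Fin n → ℝ) :
    collide i j f v = ∫ θ, f (rotate i j θ v) ∂angleMeasure := (integral_angleMeasure _).symm

theorem measurePreserving_rotate_prod {i j : Fin n} (μ : Measure (Fin n → ℝ))
    [SFinite μ] (h : ∀ θ, MeasurePreserving (rotate i j θ) μ μ) :
    MeasurePreserving (fun z : ℝ × (Fin n → ℝ) => rotate i j z.1 z.2)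
      (angleMeasure.prod μ) μ := by
  have h1 : MeasurePreserving (fun z : ℝ × (Fin n → ℝ) => (id z.1, rotate i j z.1 z.2))
      (angleMeasure.prod μ) (angleMeasure.prod μ) :=
    (MeasurePreserving.id _).skew_product (continuous_rotate i j).measurable
      (ae_of_all _ fun θ => (h θ).map_eq)
  exact measurePreserving_snd.comp h1

/-- The collision average over the rotations. -/
theorem isL1Contraction_collide {i j : Fin n} (hij : i ≠ j) :
    IsL1Contraction (volume : Measure (Fin n → ℝ)) volume (collide i j) := by
  have : collide i j = fun f v => ∫ θ, f (rotate i j θ v) ∂angleMeasure := by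
    ext f v; exact collide_eq i j f v
  rw [this]
  exact isL1Contraction_integral
    (measurePreserving_rotate_prod volume (measurePreserving_rotate hij))

end Elementary

end KacReservoir
end

/-! ### In, out, replacement and collision operators with prescribed coefficients -/

noncomputable section

namespace KacReservoir

/-- The `N`-particle space `L¹(ℝᴺ)`. -/
abbrev LpN (N : ℕ) : Type := Lp ℝ 1 (volume : Measure (Fin N → ℝ))

/-- The inclusion of the `N`-particle space. -/
abbrev incl (N : ℕ) : LpN N →L[ℝ] L1 := lp.singleContinuousLinearMap ℝ LpN 1 N

theorem norm_incl_le (N : ℕ) : ‖incl N‖ ≤ 1 :=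
  (incl N).opNorm_le_bound zero_le_one fun x => by
    rw [one_mul]; exact (lp.norm_single one_pos N x).le

/-- The projection to the `N`-particle space. -/
abbrev coord (N : ℕ) : L1 →L[ℝ] LpN N := lp.evalCLM ℝ LpN 1 N

theorem coord_apply (N : ℕ) (f : L1) : coord N f = f N := rfl

/-- The in operator on `L¹(ℝᴺ)`. -/
def inL (N : ℕ) : LpN N →L[ℝ] LpN (N + 1) :=
  (1 / ((N : ℝ) + 1)) • ∑ i : Fin (N + 1), (isL1Contraction_insert i).toL1

/-- The out operator on `L¹(ℝᴺ⁺¹)`. -/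
def outL (N : ℕ) : LpN (N + 1) →L[ℝ] LpN N := ∑ i : Fin (N + 1), (isL1Contraction_remove i).toL1

/-- The sum over the particles of the replacement of one particle by a Maxwellian one. -/
def resL : (N : ℕ) → LpN N →L[ℝ] LpN N
  | 0 => 0
  | _ + 1 => ∑ i, (isL1Contraction_insert i).toL1 ∘L (isL1Contraction_remove i).toL1

/-- The sum of the collision averages over all pairs. -/
def collL (N : ℕ) : LpN N →L[ℝ] LpN N :=
  ∑ i : Fin N, ∑ j ∈ Finset.Ioi i,
    if h : i ≠ j then (isL1Contraction_collide h).toL1 else 0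

/-- The number of pairs of particles. -/
def pairs (N : ℕ) : ℝ := ∑ i : Fin N, ∑ _j ∈ Finset.Ioi i, 1

theorem pairs_nonneg (N : ℕ) : 0 ≤ pairs N :=
  Finset.sum_nonneg fun _ _ => Finset.sum_nonneg fun _ _ => zero_le_one

theorem pairs_le (N : ℕ) : pairs N ≤ (N : ℝ) ^ 2 := by
  have : pairs N ≤ ∑ i : Fin N, (N : ℝ) := by
    refine Finset.sum_le_sum fun i _ => ?_
    have h : (Finset.Ioi i).card ≤ N := (Finset.card_le_univ _).trans (by simp)
    simpa using (Nat.cast_le (α := ℝ)).2 h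
  refine this.trans (le_of_eq ?_)
  simp [sq]

theorem norm_inL_le (N : ℕ) : ‖inL N‖ ≤ 1 := by
  rw [inL, norm_smul, Real.norm_of_nonneg (by positivity)]
  have : ‖∑ i : Fin (N + 1), (isL1Contraction_insert i).toL1‖ ≤ (N : ℝ) + 1 := by
    refine (norm_sum_le_of_le _ fun i _ => (isL1Contraction_insert i).norm_toL1_le).trans ?_
    simp
  calc _ ≤ 1 / ((N : ℝ) + 1) * (N + 1) := by gcongr
    _ = 1 := by field_simp

theorem norm_outL_le (N : ℕ) : ‖outL N‖ ≤ (N : ℝ) + 1 := by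
  refine (norm_sum_le_of_le _ fun i _ => (isL1Contraction_remove i).norm_toL1_le).trans ?_
  simp

theorem norm_resL_le (N : ℕ) : ‖resL N‖ ≤ N := by
  cases N with
  | zero => simp [resL]
  | succ n =>
    have : ∀ i ∈ (Finset.univ : Finset (Fin (n + 1))),
        ‖(isL1Contraction_insert i).toL1 ∘L (isL1Contraction_remove i).toL1‖ ≤ 1 := fun i _ =>
      (ContinuousLinearMap.opNorm_comp_le _ _).trans
        (mul_le_one₀ (isL1Contraction_insert i).norm_toL1_le (norm_nonneg _)
          (isL1Contraction_remove i).norm_toL1_le)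
    refine (norm_sum_le_of_le _ this).trans ?_
    simp

theorem norm_collL_le (N : ℕ) : ‖collL N‖ ≤ pairs N := by
  refine norm_sum_le_of_le _ fun i _ => norm_sum_le_of_le _ fun j _ => ?_
  split_ifs with h
  · exact (isL1Contraction_collide h).norm_toL1_le
  · simp

/-- The out operator from the `N`-particle space. -/
def downL : (N : ℕ) → LpN N →L[ℝ] L1
  | 0 => 0
  | n + 1 => incl n ∘L outL n

theorem norm_downL_le (N : ℕ) : ‖downL N‖ ≤ N := by
  cases N with
  | zero => simp [downL]
  | succ n =>
    refine (ContinuousLinearMap.opNorm_comp_le _ _).trans ?_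
    have := norm_outL_le n
    push_cast
    calc _ ≤ 1 * ((n : ℝ) + 1) :=
          mul_le_mul (norm_incl_le n) this (norm_nonneg _) zero_le_one
      _ = _ := one_mul _

/-- The sum over the particles of the replacement of one particle by a Maxwellian one. -/
def resOp (f : FunSeq) : FunSeq
  | 0 => fun _ => 0
  | n + 1 => fun v => ∑ i : Fin (n + 1), Real.exp (-Real.pi * v i ^ 2)
      * ∫ w : ℝ, f (n + 1) (i.insertNth (α := fun _ => ℝ) w (fun j => v (i.succAbove j)))

/-- The coefficients, as functions of the number of particles before the transition, of the in
operator, the identity, the out operator, the replacement of particles, and the collisions. -/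
structure Coeffs where
  up : ℕ → ℝ
  diag : ℕ → ℝ
  down : ℕ → ℝ
  res : ℕ → ℝ
  coll : ℕ → ℝ

namespace Coeffs

/-- The operator with the given coefficients on the `N`-particle space. -/
def column (κ : Coeffs) (N : ℕ) : LpN N →L[ℝ] L1 :=
  κ.up N • (incl (N + 1) ∘L inL N) + κ.diag N • incl N + κ.down N • downL N
    + κ.res N • (incl N ∘L resL N) + κ.coll N • (incl N ∘L collL N)

theorem norm_column_le (κ : Coeffs) (N : ℕ) :
    ‖κ.column N‖ ≤ |κ.up N| + |κ.diag N| + |κ.down N| * N + |κ.res N| * N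
      + |κ.coll N| * pairs N := by
  have h1 : ‖incl (N + 1) ∘L inL N‖ ≤ 1 := (ContinuousLinearMap.opNorm_comp_le _ _).trans
    (mul_le_one₀ (norm_incl_le _) (norm_nonneg _) (norm_inL_le N))
  have h2 : ‖incl N ∘L resL N‖ ≤ N := (ContinuousLinearMap.opNorm_comp_le _ _).trans
    ((mul_le_mul (norm_incl_le N) (norm_resL_le N) (norm_nonneg _) zero_le_one).trans
      (one_mul _).le)
  have h3 : ‖incl N ∘L collL N‖ ≤ pairs N := (ContinuousLinearMap.opNorm_comp_le _ _).trans
    ((mul_le_mul (norm_incl_le N) (norm_collL_le N) (norm_nonneg _) zero_le_one).trans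
      (one_mul _).le)
  refine (norm_add_le_of_le (norm_add_le_of_le (norm_add_le_of_le (norm_add_le_of_le
    (norm_smul_le _ _) (norm_smul_le _ _)) (norm_smul_le _ _)) (norm_smul_le _ _))
    (norm_smul_le _ _)).trans ?_
  simp only [Real.norm_eq_abs]
  gcongr
  · exact mul_le_of_le_one_right (abs_nonneg _) h1
  · exact mul_le_of_le_one_right (abs_nonneg _) (norm_incl_le N)
  · exact norm_downL_le N

/-- The `N`-particle component of the in operator with coefficients `u`. -/
def upRow (u : ℕ → ℝ) : (N : ℕ) → L1 →L[ℝ] LpN N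
  | 0 => 0
  | n + 1 => u n • (inL n ∘L coord n)

/-- The `N`-particle component of the operator with the given coefficients. -/
def row (κ : Coeffs) (N : ℕ) : L1 →L[ℝ] LpN N :=
  upRow κ.up N + κ.diag N • coord N
    + κ.down (N + 1) • (outL N ∘L coord (N + 1)) + κ.res N • (resL N ∘L coord N)
    + κ.coll N • (collL N ∘L coord N)

theorem coord_incl_self (N : ℕ) (x : LpN N) : coord N (incl N x) = x :=
  lp.single_apply_self 1 _ _

theorem coord_incl_ne {M N : ℕ} (h : M ≠ N) (x : LpN N) : coord M (incl N x) = 0 :=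
  lp.single_apply_ne 1 _ _ h

/-- Columns are suited to norm bounds in `ℓ¹`, rows to pointwise formulas; this identity lets one
pass between them. -/
theorem coord_column (κ : Coeffs) (M N : ℕ) (x : LpN M) :
    coord N (κ.column M x) = κ.row N (incl M x) := by
  simp only [column, row, add_apply, smul_apply, ContinuousLinearMap.comp_apply, map_add, map_smul]
  have hdown : κ.down M • coord N (downL M x)
      = κ.down (N + 1) • outL N (coord (N + 1) (incl M x)) := by
    cases M with
    | zero => rw [coord_incl_ne (by omega)]; simp [downL]
    | succ m =>
      by_cases h : m = N
      · subst h
        rw [coord_incl_self]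
        simp only [downL, ContinuousLinearMap.comp_apply]
        rw [coord_incl_self]
      · rw [coord_incl_ne (by omega)]
        simp only [downL, ContinuousLinearMap.comp_apply]
        rw [coord_incl_ne (by omega)]
        simp
  have hup : κ.up M • coord N (incl (M + 1) (inL M x)) =
      upRow κ.up N (incl M x) := by
    cases N with
    | zero => rw [coord_incl_ne (by omega)]; simp [upRow]
    | succ n =>
      simp only [upRow, smul_apply, ContinuousLinearMap.comp_apply]
      by_cases h : n = M
      · subst h; rw [coord_incl_self, coord_incl_self]
      · rw [coord_incl_ne (by omega), coord_incl_ne h]; simp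
  rw [hup, hdown]
  by_cases h : M = N
  · subst h
    simp only [coord_incl_self]
  · simp only [coord_incl_ne (Ne.symm h), map_zero, smul_zero]

/-- The pointwise form of the operator with the given coefficients. -/
def pointwise (κ : Coeffs) (f : FunSeq) : FunSeq := fun N v =>
  -- The coefficients are indexed by the particle number before the transition; for `N = 0` the
  -- truncated `N - 1` is harmless since `inOp f 0 = 0`.
  κ.up (N - 1) * inOp f N v + κ.diag N * f N v + κ.down (N + 1) * outOp f N v
    + κ.res N * resOp f N v
    + κ.coll N * ∑ i : Fin N, ∑ j ∈ Finset.Ioi i, collide i j (f N) v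

end Coeffs

theorem coeFn_sum_ae {X ι : Type*} [MeasurableSpace X] {μ : Measure X} (s : Finset ι)
    (f : ι → Lp ℝ 1 μ) : ⇑(∑ i ∈ s, f i) =ᵐ[μ] fun x => ∑ i ∈ s, f i x := by
  classical
  induction s using Finset.induction_on with
  | empty => simpa using! Lp.coeFn_zero ℝ 1 μ
  | insert a s ha ih =>
    rw [Finset.sum_insert ha]
    filter_upwards [Lp.coeFn_add (f a) (∑ i ∈ s, f i), ih] with x h1 h2
    rw [h1, Pi.add_apply, h2, Finset.sum_insert ha]

theorem inL_ae {N : ℕ} {x : LpN N} {f : FunSeq} (h : x =ᵐ[volume] f N) :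
    inL N x =ᵐ[volume] inOp f (N + 1) := by
  have h1 := fun i : Fin (N + 1) => (isL1Contraction_insert i).coeFn_toL1_congr h
  have h2 := Lp.coeFn_smul (1 / ((N : ℝ) + 1))
    ((∑ i : Fin (N + 1), (isL1Contraction_insert i).toL1) x)
  rw [inL, smul_apply]
  refine h2.trans ?_
  rw [sum_apply]
  have h3 := coeFn_sum_ae Finset.univ fun i : Fin (N + 1) => (isL1Contraction_insert i).toL1 x
  filter_upwards [h3, eventually_all.2 h1] with v hv3 hv1
  rw [Pi.smul_apply, hv3, smul_eq_mul]
  simp only [hv1]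
  rfl

theorem outL_ae {N : ℕ} {x : LpN (N + 1)} {f : FunSeq} (h : x =ᵐ[volume] f (N + 1)) :
    outL N x =ᵐ[volume] outOp f N := by
  have h1 := fun i : Fin (N + 1) => (isL1Contraction_remove i).coeFn_toL1_congr h
  rw [outL, sum_apply]
  have h3 := coeFn_sum_ae Finset.univ fun i : Fin (N + 1) => (isL1Contraction_remove i).toL1 x
  filter_upwards [h3, eventually_all.2 h1] with v hv3 hv1
  rw [hv3]
  simp only [hv1]
  rfl

theorem resL_ae {N : ℕ} {x : LpN N} {f : FunSeq} (h : x =ᵐ[volume] f N) :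
    resL N x =ᵐ[volume] resOp f N := by
  cases N with
  | zero => exact Lp.coeFn_zero _ _ _
  | succ n =>
    have h1 := fun i : Fin (n + 1) => (isL1Contraction_insert i).coeFn_toL1_congr
      ((isL1Contraction_remove i).coeFn_toL1_congr h)
    rw [resL, sum_apply]
    have h3 := coeFn_sum_ae Finset.univ fun i : Fin (n + 1) =>
      ((isL1Contraction_insert i).toL1 ∘L (isL1Contraction_remove i).toL1) x
    filter_upwards [h3, eventually_all.2 h1] with v hv3 hv1
    rw [hv3]
    simp only [ContinuousLinearMap.comp_apply, hv1]
    rfl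

theorem collL_ae {N : ℕ} {x : LpN N} {f : FunSeq} (h : x =ᵐ[volume] f N) :
    collL N x =ᵐ[volume] fun v => ∑ i : Fin N, ∑ j ∈ Finset.Ioi i, collide i j (f N) v := by
  have h1 : ∀ i j : Fin N, j ∈ Finset.Ioi i →
      ((if h : i ≠ j then (isL1Contraction_collide h).toL1 else 0 : LpN N →L[ℝ] LpN N) x)
        =ᵐ[volume] collide i j (f N) := by
    intro i j hij
    have hne : i ≠ j := (Finset.mem_Ioi.1 hij).ne
    rw [dif_pos hne]
    exact (isL1Contraction_collide hne).coeFn_toL1_congr h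
  simp only [collL, sum_apply]
  refine (coeFn_sum_ae _ _).trans ?_
  have h2 : ∀ᵐ v, ∀ i : Fin N, ∀ j : Fin N, j ∈ Finset.Ioi i →
      ((if h : i ≠ j then (isL1Contraction_collide h).toL1 else 0 : LpN N →L[ℝ] LpN N) x) v
        = collide i j (f N) v :=
    eventually_all.2 fun i => eventually_all.2 fun j => by
      by_cases hj : j ∈ Finset.Ioi i
      · filter_upwards [h1 i j hj] with v hv _ using hv
      · exact ae_of_all _ fun v hv => absurd hv hj
  have h3 := fun i : Fin N => coeFn_sum_ae (Finset.Ioi i) fun j : Fin N =>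
    ((if h : i ≠ j then (isL1Contraction_collide h).toL1 else 0 : LpN N →L[ℝ] LpN N) x)
  filter_upwards [h2, eventually_all.2 h3] with v hv2 hv3
  simp only [hv3]
  exact Finset.sum_congr rfl fun i _ => Finset.sum_congr rfl fun j hj => hv2 i j hj

theorem Coeffs.row_ae (κ : Coeffs) {f : L1} {g : FunSeq} (h : ∀ N, f N =ᵐ[volume] g N) (N : ℕ) :
    κ.row N f =ᵐ[volume] κ.pointwise g N := by
  have hup : Coeffs.upRow κ.up N f =ᵐ[volume] fun v => κ.up (N - 1) * inOp g N v := by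
    cases N with
    | zero =>
      refine (Lp.coeFn_zero _ _ _).trans (ae_of_all _ fun v => ?_)
      simp [inOp]
    | succ n =>
      refine (Lp.coeFn_smul (κ.up n) (inL n (coord n f))).trans ?_
      filter_upwards [inL_ae (x := coord n f) (h n)] with v hv
      rw [Pi.smul_apply, hv, smul_eq_mul, Nat.add_sub_cancel]
  have a1 := Lp.coeFn_smul (κ.diag N) (coord N f)
  have a2 := Lp.coeFn_smul (κ.down (N + 1)) (outL N (coord (N + 1) f))
  have a3 := Lp.coeFn_smul (κ.res N) (resL N (coord N f))
  have a4 := Lp.coeFn_smul (κ.coll N) (collL N (coord N f))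
  simp only [row, add_apply, smul_apply, ContinuousLinearMap.comp_apply]
  filter_upwards [hup, a1, a2, a3, a4, h N, outL_ae (x := coord (N + 1) f) (h (N + 1)),
    resL_ae (x := coord N f) (h N), collL_ae (x := coord N f) (h N),
    Lp.coeFn_add (Coeffs.upRow κ.up N f + κ.diag N • coord N f
      + κ.down (N + 1) • outL N (coord (N + 1) f) + κ.res N • resL N (coord N f))
      (κ.coll N • collL N (coord N f)),
    Lp.coeFn_add (Coeffs.upRow κ.up N f + κ.diag N • coord N f
      + κ.down (N + 1) • outL N (coord (N + 1) f)) (κ.res N • resL N (coord N f)),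
    Lp.coeFn_add (Coeffs.upRow κ.up N f + κ.diag N • coord N f)
      (κ.down (N + 1) • outL N (coord (N + 1) f)),
    Lp.coeFn_add (Coeffs.upRow κ.up N f) (κ.diag N • coord N f)]
    with v h1 h2 h3 h4 h5 h6 h7 h8 h9 h10 h11 h12 h13
  rw [h10, Pi.add_apply, h11, Pi.add_apply, h12, Pi.add_apply, h13, Pi.add_apply, h1, h2, h3, h4,
    h5]
  simp only [Pi.smul_apply, smul_eq_mul, h7, h8, h9, pointwise]
  rw [coord_apply, h6]

end KacReservoir
end

/-! ### The generator, its approximations by `k` slots, and weighted estimates -/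

noncomputable section

namespace KacReservoir

/-- The coefficients of the generator, conjugated by the weight `(N + 1) ^ p`. -/
def limitCoeffs (μ ρ lam : ℝ) (p : ℕ) : Coeffs where
  -- Conjugation multiplies a transition from `N` to `M` particles by `((M + 1) / (N + 1)) ^ p`.
  up N := μ * (((N : ℝ) + 2) / (N + 1)) ^ p
  diag N := -μ - ρ * N - lam * pairs N
  down N := ρ * ((N : ℝ) / (N + 1)) ^ p
  res _ := 0
  coll _ := lam

/-- The coefficients of the generator of the dynamics with `k` slots, each of which is refreshed at
the rate `ρ` and then occupied with probability `μ / (ρ k)`, conjugated by the weight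
`(N + 1) ^ p`. -/
def slotCoeffs (μ ρ lam : ℝ) (k p : ℕ) : Coeffs where
  -- With `q = μ / (ρ k)`, the `k - N` empty slots are filled at total rate `ρ q (k - N) = μ (1 - N
  -- / k)`; an occupied slot is emptied at rate `ρ (1 - q)` and gets a new velocity at rate `ρ q`.
  -- The sectors `N > k` are frozen, which keeps the operator bounded; nothing enters them, since
  -- the upward rate vanishes at `N = k`.
  up N := if N ≤ k then μ * (1 - N / k) * (((N : ℝ) + 2) / (N + 1)) ^ p else 0
  diag N := if N ≤ k then -μ - ρ * N * (1 - μ / (ρ * k)) - lam * pairs N else 0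
  down N := if N ≤ k then ρ * (1 - μ / (ρ * k)) * ((N : ℝ) / (N + 1)) ^ p else 0
  res N := if N ≤ k then ρ * (μ / (ρ * k)) else 0
  coll N := if N ≤ k then lam else 0

theorem limitCoeffs_pointwise (μ ρ lam : ℝ) (f : FunSeq) :
    (limitCoeffs μ ρ lam 0).pointwise f = generator μ ρ lam f := by
  ext N v
  have h : collOp f N v = ∑ i : Fin N, ∑ j ∈ Finset.Ioi i, collide i j (f N) v
      - pairs N * f N v := by
    simp only [collOp, pairs, Finset.sum_sub_distrib, Finset.sum_mul, one_mul]
  rw [generator, h]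
  simp only [Coeffs.pointwise, limitCoeffs, pow_zero, mul_one]
  ring

variable {μ ρ lam : ℝ}

theorem weight_up_le (N p : ℕ) : (((N : ℝ) + 2) / (N + 1)) ^ p ≤ 2 ^ p := by
  gcongr
  rw [div_le_iff₀ (by positivity)]
  have : (0 : ℝ) ≤ N := N.cast_nonneg
  linarith

theorem weight_down_le (N p : ℕ) : ((N : ℝ) / (N + 1)) ^ p ≤ 1 := by
  refine pow_le_one₀ (by positivity) ?_
  rw [div_le_one (by positivity)]
  linarith

theorem one_le_weight_up (N p : ℕ) : 1 ≤ (((N : ℝ) + 2) / (N + 1)) ^ p := by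
  refine one_le_pow₀ ?_
  rw [one_le_div (by positivity)]
  linarith

theorem slotCoeffs_column_of_lt {k N : ℕ} (p : ℕ) (h : k < N) :
    (slotCoeffs μ ρ lam k p).column N = 0 := by
  simp [Coeffs.column, slotCoeffs, not_le.2 h]

/-- The number of pairs grows quadratically; this is why the domain carries two powers of the
particle number. -/
theorem norm_limitCoeffs_column_le (hμ : 0 < μ) (hρ : 0 < ρ) (hlam : 0 ≤ lam) (p N : ℕ) :
    ‖(limitCoeffs μ ρ lam p).column N‖ ≤ (μ * 2 ^ p + μ + 2 * ρ + 2 * lam) * ((N : ℝ) + 1) ^ 2 := by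
  refine (Coeffs.norm_column_le _ _).trans ?_
  have hN : (0 : ℝ) ≤ N := N.cast_nonneg
  have h1 := pairs_nonneg N
  have h2 := pairs_le N
  have e1 : |(limitCoeffs μ ρ lam p).up N| ≤ μ * 2 ^ p := by
    simp only [limitCoeffs]
    rw [abs_of_nonneg (by positivity)]
    exact mul_le_mul_of_nonneg_left (weight_up_le N p) hμ.le
  have e2 : |(limitCoeffs μ ρ lam p).diag N| = μ + ρ * N + lam * pairs N := by
    simp only [limitCoeffs]
    rw [abs_of_nonpos (by have := mul_nonneg hlam h1; have := mul_nonneg hρ.le hN; linarith)]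
    ring
  have e3 : |(limitCoeffs μ ρ lam p).down N| ≤ ρ := by
    simp only [limitCoeffs]
    rw [abs_of_nonneg (by positivity)]
    exact mul_le_of_le_one_right hρ.le (weight_down_le N p)
  have e4 : |(limitCoeffs μ ρ lam p).res N| = 0 := by simp [limitCoeffs]
  have e5 : |(limitCoeffs μ ρ lam p).coll N| = lam := by simp [limitCoeffs, abs_of_nonneg hlam]
  rw [e2, e4, e5]
  have e6 := mul_le_mul_of_nonneg_right e3 hN
  have e7 := mul_le_mul_of_nonneg_left h2 hlam
  have : (0 : ℝ) < 2 ^ p := by positivity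
  have : 0 < μ * 2 ^ p := by positivity
  nlinarith [mul_nonneg hlam hN, mul_nonneg hρ.le hN, mul_nonneg hμ.le hN]

theorem norm_incl_apply (N : ℕ) (x : LpN N) : ‖incl N x‖ = ‖x‖ := lp.norm_single one_pos N x

/-- The refreshed slots are occupied with probability at most one. -/
theorem slot_prob_le_one (hρ : 0 < ρ) {k : ℕ} (hk : μ / ρ ≤ k) (hk0 : 0 < k) :
    μ / (ρ * k) ≤ 1 := by
  rw [div_le_one (by positivity)]
  rwa [div_le_iff₀ hρ, mul_comm] at hk

/-- Up to the cutoff the collision terms agree. Creation and loss differ by `μ N / k`, removal and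
replacement by `μ / k` per particle; with the weight on creation this makes `2 ^ p + 3`
contributions. -/
theorem norm_column_sub_le (hμ : 0 < μ) (hρ : 0 < ρ) (p : ℕ) {k N : ℕ} (hk0 : 0 < k)
    (hN : N ≤ k) :
    ‖(limitCoeffs μ ρ lam p).column N - (slotCoeffs μ ρ lam k p).column N‖
      ≤ (2 ^ p + 3) * μ * (N / k) := by
  have hk' : (0 : ℝ) < k := by exact_mod_cast hk0
  have hN' : (0 : ℝ) ≤ N := N.cast_nonneg
  set δ : Coeffs :=
    ⟨fun N => μ * (N / k) * (((N : ℝ) + 2) / (N + 1)) ^ p, fun N => -(μ * (N / k)),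
      fun N => μ / k * ((N : ℝ) / (N + 1)) ^ p, fun _ => -(μ / k), fun _ => 0⟩ with hδ
  have e : (limitCoeffs μ ρ lam p).column N - (slotCoeffs μ ρ lam k p).column N
      = δ.column N := by
    have hq : ρ * (μ / (ρ * k)) = μ / k := by field_simp
    have c1 : δ.up N = (limitCoeffs μ ρ lam p).up N - (slotCoeffs μ ρ lam k p).up N := by
      simp only [hδ, limitCoeffs, slotCoeffs, if_pos hN]; ring
    have c2 : δ.diag N = (limitCoeffs μ ρ lam p).diag N - (slotCoeffs μ ρ lam k p).diag N := by
      simp only [hδ, limitCoeffs, slotCoeffs, if_pos hN]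
      rw [mul_div_assoc', ← sub_eq_zero]; field_simp; ring
    have c3 : δ.down N = (limitCoeffs μ ρ lam p).down N - (slotCoeffs μ ρ lam k p).down N := by
      simp only [hδ, limitCoeffs, slotCoeffs, if_pos hN]; rw [← hq]; ring
    have c4 : δ.res N = (limitCoeffs μ ρ lam p).res N - (slotCoeffs μ ρ lam k p).res N := by
      simp only [hδ, limitCoeffs, slotCoeffs, if_pos hN]; rw [← hq]; ring
    have c5 : δ.coll N = (limitCoeffs μ ρ lam p).coll N - (slotCoeffs μ ρ lam k p).coll N := by
      simp only [hδ, limitCoeffs, slotCoeffs, if_pos hN]; ring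
    simp only [Coeffs.column, c1, c2, c3, c4, c5, sub_smul]
    abel
  rw [e]
  refine (Coeffs.norm_column_le _ _).trans ?_
  simp only [hδ, abs_neg, abs_zero, zero_mul, add_zero]
  rw [abs_of_nonneg (by positivity), abs_of_nonneg (by positivity), abs_of_nonneg (by positivity),
    abs_of_nonneg (by positivity)]
  have h1 := mul_le_mul_of_nonneg_left (weight_up_le N p) (show 0 ≤ μ * (N / k) by positivity)
  have h2 := mul_le_mul_of_nonneg_left (weight_down_le N p) (show 0 ≤ μ / k * N by positivity)
  have h3 : μ / k * N = μ * (N / k) := by ring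
  nlinarith

theorem norm_column_sub_le_sq (hμ : 0 < μ) (hρ : 0 < ρ) (hlam : 0 ≤ lam) (p : ℕ) {k : ℕ}
    (hk0 : 0 < k) (N : ℕ) :
    ‖(limitCoeffs μ ρ lam p).column N - (slotCoeffs μ ρ lam k p).column N‖
      ≤ ((2 ^ p + 4) * μ + μ * 2 ^ p + 2 * ρ + 2 * lam) * ((N : ℝ) + 1) ^ 2 := by
  have hk' : (0 : ℝ) < k := by exact_mod_cast hk0
  have hN' : (0 : ℝ) ≤ N := N.cast_nonneg
  have h2 : (0 : ℝ) < 2 ^ p := by positivity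
  have h1 : (1 : ℝ) ≤ ((N : ℝ) + 1) ^ 2 := by nlinarith
  rcases le_or_gt N k with h | h
  · refine (norm_column_sub_le hμ hρ p hk0 h).trans ?_
    have hNk : (N : ℝ) / k ≤ 1 := by
      rw [div_le_one hk']; exact_mod_cast h
    calc (2 ^ p + 3) * μ * (N / k) ≤ (2 ^ p + 3) * μ * 1 := by gcongr
      _ ≤ ((2 ^ p + 4) * μ + μ * 2 ^ p + 2 * ρ + 2 * lam) * 1 := by
        have := mul_pos hμ h2
        nlinarith
      _ ≤ _ := by gcongr
  · rw [slotCoeffs_column_of_lt p h, sub_zero]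
    refine (norm_limitCoeffs_column_le hμ hρ hlam p N).trans ?_
    refine mul_le_mul_of_nonneg_right ?_ (by positivity)
    have := mul_pos hμ h2
    nlinarith

/-- One more power of `N + 1` buys the factor `1 / k`, because `k ≤ N + 1` beyond the cutoff. -/
theorem norm_column_sub_le_cube (hμ : 0 < μ) (hρ : 0 < ρ) (hlam : 0 ≤ lam) (p : ℕ) {k : ℕ}
    (hk0 : 0 < k) (N : ℕ) :
    ‖(limitCoeffs μ ρ lam p).column N - (slotCoeffs μ ρ lam k p).column N‖
      ≤ ((2 ^ p + 4) * μ + μ * 2 ^ p + 2 * ρ + 2 * lam) / k * ((N : ℝ) + 1) ^ 3 := by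
  have hk' : (0 : ℝ) < k := by exact_mod_cast hk0
  have hN' : (0 : ℝ) ≤ N := N.cast_nonneg
  have h2 : (0 : ℝ) < 2 ^ p := by positivity
  have hC : 0 ≤ (2 ^ p + 4) * μ + μ * 2 ^ p + 2 * ρ + 2 * lam := by positivity
  rcases le_or_gt N k with h | h
  · refine (norm_column_sub_le hμ hρ p hk0 h).trans ?_
    have h3 : (N : ℝ) ≤ ((N : ℝ) + 1) ^ 3 := by nlinarith [sq_nonneg (N : ℝ), mul_nonneg hN' (sq_nonneg (N : ℝ))]
    calc (2 ^ p + 3) * μ * (N / k) = ((2 ^ p + 3) * μ) / k * N := by ring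
      _ ≤ ((2 ^ p + 4) * μ + μ * 2 ^ p + 2 * ρ + 2 * lam) / k * ((N : ℝ) + 1) ^ 3 := by
        gcongr
        have := mul_pos hμ h2
        nlinarith
  · refine (norm_column_sub_le_sq hμ hρ hlam p hk0 N).trans ?_
    have h3 : (k : ℝ) ≤ N + 1 := by exact_mod_cast h.le.trans (Nat.le_succ N)
    calc _ = ((2 ^ p + 4) * μ + μ * 2 ^ p + 2 * ρ + 2 * lam) / k * (((N : ℝ) + 1) ^ 2 * k) := by
          field_simp
      _ ≤ _ := by
          have : ((N : ℝ) + 1) ^ 2 * k ≤ ((N : ℝ) + 1) ^ 3 := by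
            rw [pow_succ _ 2]; gcongr
          gcongr

/-- The generator of the dynamics with `k` slots, conjugated by the weight `(N + 1) ^ p`. -/
def slotGen (μ ρ lam : ℝ) (k p : ℕ) : L1 →L[ℝ] L1 :=
  ofColumns (slotCoeffs μ ρ lam k p).column
    ⟨∑ N ∈ Finset.range (k + 1), ‖(slotCoeffs μ ρ lam k p).column N‖, fun N => by
      rcases lt_or_ge k N with h | h
      · rw [slotCoeffs_column_of_lt p h, norm_zero]
        exact Finset.sum_nonneg fun _ _ => norm_nonneg _
      · exact Finset.single_le_sum
          (f := fun N => ‖(slotCoeffs μ ρ lam k p).column N‖) (fun _ _ => norm_nonneg _)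
          (Finset.mem_range_succ_iff.2 h)⟩

theorem slotGen_incl (k p N : ℕ) (x : LpN N) :
    slotGen μ ρ lam k p (incl N x) = (slotCoeffs μ ρ lam k p).column N x :=
  ofColumns_single _ _ N x

/-- Division of the `N`-particle component by `(N + 1) ^ r`. -/
def weightInv (r : ℕ) : L1 →L[ℝ] L1 :=
  ofColumns (fun N => (((N : ℝ) + 1) ^ r)⁻¹ • incl N) ⟨1, fun N => by
    rw [norm_smul, norm_inv, Real.norm_of_nonneg (by positivity)]
    refine mul_le_one₀ (inv_le_one_of_one_le₀ (one_le_pow₀ ?_)) (norm_nonneg _) (norm_incl_le N)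
    linarith [(N.cast_nonneg : (0 : ℝ) ≤ N)]⟩

theorem weightInv_incl (r N : ℕ) (x : LpN N) :
    weightInv r (incl N x) = (((N : ℝ) + 1) ^ r)⁻¹ • incl N x :=
  ofColumns_single _ _ N x

theorem weightInv_apply (r N : ℕ) (f : L1) :
    weightInv r f N = (((N : ℝ) + 1) ^ r)⁻¹ • f N := by
  have : coord N ∘L weightInv r = (((N : ℝ) + 1) ^ r)⁻¹ • coord N := by
    refine lp_one_clm_ext fun M x => ?_
    change coord N (weightInv r (incl M x)) = (((N : ℝ) + 1) ^ r)⁻¹ • coord N (incl M x)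
    rw [weightInv_incl, map_smul]
    by_cases h : N = M
    · subst h; rfl
    · rw [Coeffs.coord_incl_ne h, smul_zero, smul_zero]
  exact congrArg (fun T : L1 →L[ℝ] LpN N => T f) this

/-- Elements with finitely many nonzero components lie in the range. -/
theorem denseRange_weightInv (r : ℕ) : DenseRange (weightInv r) := by
  intro f
  refine mem_closure_of_tendsto (lp.hasSum_single (p := 1) (by simp) f)
    (Eventually.of_forall fun s => ?_)
  refine ⟨∑ N ∈ s, ((N : ℝ) + 1) ^ r • incl N (f N), ?_⟩
  rw [map_sum]
  refine Finset.sum_congr rfl fun N _ => ?_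
  rw [map_smul, weightInv_incl, smul_smul, mul_inv_cancel₀ (by positivity), one_smul]
  rfl

/-- The generator, read through the weight `(N + 1) ^ p` on the image side and the weight
`(N + 1) ^ (p + r)` on the domain side. -/
def limitGen (μ ρ lam : ℝ) (hμ : 0 < μ) (hρ : 0 < ρ) (hlam : 0 ≤ lam) (p r : ℕ) (hr : 2 ≤ r) :
    L1 →L[ℝ] L1 :=
  ofColumns (fun N => (((N : ℝ) + 1) ^ r)⁻¹ • (limitCoeffs μ ρ lam p).column N)
    ⟨μ * 2 ^ p + μ + 2 * ρ + 2 * lam, fun N => by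
      rw [norm_smul, norm_inv, Real.norm_of_nonneg (by positivity), inv_mul_le_iff₀ (by positivity)]
      refine (norm_limitCoeffs_column_le hμ hρ hlam p N).trans ?_
      rw [mul_comm]
      have h1 : (1 : ℝ) ≤ N + 1 := by linarith [(N.cast_nonneg : (0 : ℝ) ≤ N)]
      gcongr⟩

theorem limitGen_incl (hμ : 0 < μ) (hρ : 0 < ρ) (hlam : 0 ≤ lam) {p r : ℕ} (hr : 2 ≤ r) (N : ℕ)
    (x : LpN N) : limitGen μ ρ lam hμ hρ hlam p r hr (incl N x)
      = (((N : ℝ) + 1) ^ r)⁻¹ • (limitCoeffs μ ρ lam p).column N x :=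
  ofColumns_single _ _ N x

theorem slotGen_weightInv_sub_incl (hμ : 0 < μ) (hρ : 0 < ρ) (hlam : 0 ≤ lam) {k p r : ℕ}
    (hr : 2 ≤ r) (N : ℕ) (x : LpN N) :
    (slotGen μ ρ lam k p ∘L weightInv r - limitGen μ ρ lam hμ hρ hlam p r hr) (incl N x)
      = -((((N : ℝ) + 1) ^ r)⁻¹ • ((limitCoeffs μ ρ lam p).column N
        - (slotCoeffs μ ρ lam k p).column N) x) := by
  rw [sub_apply, ContinuousLinearMap.comp_apply, weightInv_incl, limitGen_incl, map_smul,
    slotGen_incl, sub_apply, smul_sub, neg_sub]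

theorem norm_slotGen_weightInv_sub_le (hμ : 0 < μ) (hρ : 0 < ρ) (hlam : 0 ≤ lam) {k : ℕ} (p : ℕ)
    (hk0 : 0 < k) :
    ‖slotGen μ ρ lam k p ∘L weightInv 3 - limitGen μ ρ lam hμ hρ hlam p 3 (by norm_num)‖
      ≤ ((2 ^ p + 4) * μ + μ * 2 ^ p + 2 * ρ + 2 * lam) / k := by
  refine lp_one_opNorm_le _ (by positivity) fun N x => ?_
  rw [show lp.single 1 N x = incl N x from rfl, slotGen_weightInv_sub_incl, norm_neg, norm_smul,
    norm_inv, Real.norm_of_nonneg (by positivity), inv_mul_le_iff₀ (by positivity)]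
  refine (ContinuousLinearMap.le_of_opNorm_le _ (norm_column_sub_le_cube hμ hρ hlam p hk0 N)
    x).trans (le_of_eq (by ring))

theorem norm_slotGen_weightInv_two_sub_le (hμ : 0 < μ) (hρ : 0 < ρ) (hlam : 0 ≤ lam) {k : ℕ}
    (p : ℕ) (hk0 : 0 < k) :
    ‖slotGen μ ρ lam k p ∘L weightInv 2 - limitGen μ ρ lam hμ hρ hlam p 2 le_rfl‖
      ≤ (2 ^ p + 4) * μ + μ * 2 ^ p + 2 * ρ + 2 * lam := by
  refine lp_one_opNorm_le _ (by positivity) fun N x => ?_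
  rw [show lp.single 1 N x = incl N x from rfl, slotGen_weightInv_sub_incl, norm_neg, norm_smul,
    norm_inv, Real.norm_of_nonneg (by positivity), inv_mul_le_iff₀ (by positivity)]
  refine (ContinuousLinearMap.le_of_opNorm_le _ (norm_column_sub_le_sq hμ hρ hlam p hk0 N)
    x).trans (le_of_eq (by ring))

/-- Strong convergence of operators that are uniformly bounded and converge on every summand. -/
theorem tendsto_of_tendsto_incl {T : ℕ → L1 →L[ℝ] L1} {K : ℝ} (hK : ∀ k, ‖T k‖ ≤ K)
    (h : ∀ N x, Tendsto (fun k => T k (incl N x)) atTop (𝓝 0)) (f : L1) :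
    Tendsto (fun k => T k f) atTop (𝓝 0) := by
  have e : ∀ k, T k f = ∑' N, T k (incl N (f N)) := fun k =>
    (lp_one_hasSum_apply (T k) f).tsum_eq.symm
  simp only [e]
  rw [show (0 : L1) = ∑' _ : ℕ, (0 : L1) from tsum_zero.symm]
  refine tendsto_tsum_of_dominated_convergence (bound := fun N => K * ‖f N‖)
    ((lp_one_hasSum_norm f).summable.mul_left K) (fun N => h N _)
    (Eventually.of_forall fun k N => ?_)
  refine ((T k).le_of_opNorm_le (hK k) _).trans (le_of_eq ?_)
  rw [norm_incl_apply]

/-- This intertwining is the purpose of the parameter `p`: a bound on the semigroup with exponent `p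
+ r` is a bound on a weighted space with `r` more powers, which is thereby invariant. -/
theorem slotGen_comp_weightInv (k p r : ℕ) :
    slotGen μ ρ lam k p ∘L weightInv r = weightInv r ∘L slotGen μ ρ lam k (p + r) := by
  refine lp_one_clm_ext fun N x => ?_
  change slotGen μ ρ lam k p (weightInv r (incl N x))
    = weightInv r (slotGen μ ρ lam k (p + r) (incl N x))
  rw [weightInv_incl, map_smul, slotGen_incl, slotGen_incl]
  have hN : ((N : ℝ) + 1) ≠ 0 := by positivity
  have hN2 : ((N : ℝ) + 2) ≠ 0 := by positivity
  have hdown : (slotCoeffs μ ρ lam k (p + r)).down N • weightInv r (downL N x)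
      = (((N : ℝ) + 1) ^ r)⁻¹ • ((slotCoeffs μ ρ lam k p).down N) • downL N x := by
    cases N with
    | zero => simp [downL]
    | succ n =>
      have hn : ((n : ℝ) + 1) ≠ 0 := by positivity
      simp only [downL, ContinuousLinearMap.comp_apply]
      rw [weightInv_incl, smul_smul, smul_smul]
      congr 1
      simp only [slotCoeffs]
      split_ifs with h
      · push_cast
        rw [pow_add, div_pow _ _ r]
        field_simp
      · simp
  simp only [Coeffs.column, add_apply, map_add, smul_add, smul_apply,
    ContinuousLinearMap.comp_apply, map_smul]
  rw [hdown]
  simp only [weightInv_incl, smul_smul]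
  have hup : (((N : ℝ) + 1) ^ r)⁻¹ * (slotCoeffs μ ρ lam k p).up N
      = (slotCoeffs μ ρ lam k (p + r)).up N * ((((N + 1 : ℕ) : ℝ) + 1) ^ r)⁻¹ := by
    simp only [slotCoeffs]
    split_ifs with h
    · push_cast
      rw [add_assoc (N : ℝ) 1 1, one_add_one_eq_two, pow_add, div_pow _ _ r]
      field_simp
    · simp
  rw [hup]
  simp only [slotCoeffs]
  simp only [mul_comm]

/-- Since `d` exceeds every exit rate, the diagonal entry of `1 + A / d` is nonnegative, and so are
the others; the absolute values then add up without loss. Unweighted, the rates cancel because mass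
is conserved. A weight can only increase the sum through creation, by at most `μ (2 ^ p - 1)`, which
does not depend on `k`. -/
theorem slotCoeffs_sum_le (hμ : 0 < μ) (hρ : 0 < ρ) (hlam : 0 ≤ lam) (p : ℕ) {k N : ℕ}
    (hk0 : 0 < k) (hk : μ / ρ ≤ k) (h : N ≤ k) {d : ℝ} (hd : d = μ + ρ * k + lam * (k : ℝ) ^ 2) :
    |d⁻¹ * (slotCoeffs μ ρ lam k p).up N| + |1 + d⁻¹ * (slotCoeffs μ ρ lam k p).diag N|
      + |d⁻¹ * (slotCoeffs μ ρ lam k p).down N| * N + |d⁻¹ * (slotCoeffs μ ρ lam k p).res N| * N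
      + |d⁻¹ * (slotCoeffs μ ρ lam k p).coll N| * pairs N ≤ 1 + μ * (2 ^ p - 1) / d := by
  have hk' : (0 : ℝ) < k := by exact_mod_cast hk0
  have hd0 : 0 < d := by rw [hd]; positivity
  have hN' : (0 : ℝ) ≤ N := N.cast_nonneg
  have hNk : (N : ℝ) ≤ k := by exact_mod_cast h
  have hNk' : (N : ℝ) / k ≤ 1 := by rwa [div_le_one hk']
  have hqk : ρ * (μ / (ρ * k)) = μ / k := by field_simp
  have hq0 : 0 ≤ μ / (ρ * k) := by positivity
  have hq1 : μ / (ρ * k) ≤ 1 := slot_prob_le_one hρ hk hk0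
  have hP := pairs_nonneg N
  have hP2 : pairs N ≤ (k : ℝ) ^ 2 := (pairs_le N).trans (by gcongr)
  have hwu := weight_up_le N p
  have hwd := weight_down_le N p
  have hwu1 := one_le_weight_up N p
  have hwd0 : 0 ≤ ((N : ℝ) / (N + 1)) ^ p := by positivity
  simp only [slotCoeffs, if_pos h]
  generalize μ / (ρ * k) = q at *
  generalize (((N : ℝ) + 2) / (N + 1)) ^ p = wu at *
  generalize ((N : ℝ) / (N + 1)) ^ p = wd at *
  generalize pairs N = P at *
  have hdiag : 0 ≤ 1 + d⁻¹ * (-μ - ρ * N * (1 - q) - lam * P) := by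
    have : μ + ρ * N * (1 - q) + lam * P ≤ d := by
      have h1 : ρ * N * (1 - q) ≤ ρ * k * 1 := by gcongr; linarith
      have h2 : lam * P ≤ lam * (k : ℝ) ^ 2 := by gcongr
      rw [hd]; linarith
    have h3 : d⁻¹ * (μ + ρ * N * (1 - q) + lam * P) ≤ 1 := by
      rw [inv_mul_le_iff₀ hd0]; linarith
    linarith
  have h1N : 0 ≤ 1 - (N : ℝ) / k := by linarith
  have h1q : 0 ≤ 1 - q := by linarith
  have hwu0 : 0 ≤ wu := by linarith
  rw [abs_of_nonneg (by positivity), abs_of_nonneg hdiag, abs_of_nonneg (by positivity),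
    abs_of_nonneg (by positivity), abs_of_nonneg (by positivity)]
  -- With both weights equal to one the left side is `0`, by `ρ q N = μ N / k`.
  have main : μ * (1 - N / k) * wu + (-μ - ρ * N * (1 - q) - lam * P)
      + ρ * (1 - q) * wd * N + ρ * q * N + lam * P ≤ μ * (2 ^ p - 1) := by
    have a1 : ρ * (1 - q) * wd * N ≤ ρ * (1 - q) * 1 * N := by gcongr
    have a2 : ρ * q * N = μ * (N / k) := by rw [hqk]; ring
    have b1 : (1 - (N : ℝ) / k) * (wu - 1) ≤ 1 * (2 ^ p - 1) := by
      have : 0 ≤ (N : ℝ) / k := by positivity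
      gcongr; linarith
    have a3 := mul_le_mul_of_nonneg_left b1 hμ.le
    linarith
  calc _ = 1 + d⁻¹ * (μ * (1 - N / k) * wu + (-μ - ρ * N * (1 - q) - lam * P)
        + ρ * (1 - q) * wd * N + ρ * q * N + lam * P) := by ring
    _ ≤ 1 + d⁻¹ * (μ * (2 ^ p - 1)) := by gcongr
    _ = _ := by ring

theorem norm_one_add_slotGen_le (hμ : 0 < μ) (hρ : 0 < ρ) (hlam : 0 ≤ lam) (p : ℕ) {k : ℕ}
    (hk0 : 0 < k) (hk : μ / ρ ≤ k) {d : ℝ} (hd : d = μ + ρ * k + lam * (k : ℝ) ^ 2) :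
    ‖1 + d⁻¹ • slotGen μ ρ lam k p‖ ≤ 1 + μ * (2 ^ p - 1) / d := by
  have hd0 : 0 < d := by rw [hd]; positivity
  have hω : 0 ≤ μ * (2 ^ p - 1) / d := by
    have : 0 ≤ (2 : ℝ) ^ p - 1 := by linarith [(one_le_pow₀ one_le_two : (1 : ℝ) ≤ 2 ^ p)]
    positivity
  refine lp_one_opNorm_le _ (by linarith) fun N x => ?_
  change ‖(1 + d⁻¹ • slotGen μ ρ lam k p) (incl N x)‖ ≤ _
  rcases lt_or_ge k N with h | h
  · rw [add_apply, smul_apply, slotGen_incl, slotCoeffs_column_of_lt p h, one_apply_eq_self,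
      zero_apply, smul_zero, add_zero]
    rw [norm_incl_apply]
    exact le_mul_of_one_le_left (norm_nonneg _) (by linarith)
  have e : (1 + d⁻¹ • slotGen μ ρ lam k p) (incl N x)
      = (Coeffs.mk (fun N => d⁻¹ * (slotCoeffs μ ρ lam k p).up N)
        (fun N => 1 + d⁻¹ * (slotCoeffs μ ρ lam k p).diag N)
        (fun N => d⁻¹ * (slotCoeffs μ ρ lam k p).down N)
        (fun N => d⁻¹ * (slotCoeffs μ ρ lam k p).res N)
        (fun N => d⁻¹ * (slotCoeffs μ ρ lam k p).coll N)).column N x := by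
    rw [add_apply, smul_apply, slotGen_incl, one_apply_eq_self]
    simp only [Coeffs.column, add_apply, smul_apply, smul_add, smul_smul, add_smul, one_smul]
    abel
  rw [e]
  exact ContinuousLinearMap.le_of_opNorm_le _ ((Coeffs.norm_column_le _ _).trans
    (slotCoeffs_sum_le hμ hρ hlam p hk0 hk h hd)) x

end KacReservoir
end

/-! ### Existence and uniqueness for the master equation -/

noncomputable section

namespace KacReservoir

theorem exp_comp_comm {X : Type*} [NormedAddCommGroup X] [NormedSpace ℝ X] [CompleteSpace X]
    {A A' ι : X →L[ℝ] X} (h : A ∘L ι = ι ∘L A') (s : ℝ) :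
    NormedSpace.exp (s • A) ∘L ι = ι ∘L NormedSpace.exp (s • A') := by
  have h0 : (s • A) * ι = ι * (s • A') := by
    rw [smul_mul_assoc, mul_smul_comm]; exact congrArg (fun T => s • T) h
  have hp : ∀ n : ℕ, (s • A) ^ n * ι = ι * (s • A') ^ n := by
    intro n
    induction n with
    | zero => simp
    | succ n ih => rw [pow_succ, mul_assoc, h0, ← mul_assoc, ih, mul_assoc, ← pow_succ]
  have h1 := (NormedSpace.exp_series_hasSum_exp' (𝕂 := ℝ) (s • A)).mul_right ι
  have h2 := (NormedSpace.exp_series_hasSum_exp' (𝕂 := ℝ) (s • A')).mul_left ι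
  change NormedSpace.exp (s • A) * ι = ι * NormedSpace.exp (s • A')
  refine h1.unique ?_
  convert h2 using 2 with n
  rw [smul_mul_assoc, hp, mul_smul_comm]

/-- An increasing sequence of numbers of slots, all larger than the mean particle number. -/
def slots (μ ρ : ℝ) (n : ℕ) : ℕ := n + ⌈μ / ρ⌉₊ + 1

variable {μ ρ lam : ℝ}

theorem slots_pos (n : ℕ) : 0 < slots μ ρ n := Nat.succ_pos _

theorem le_slots (n : ℕ) : μ / ρ ≤ slots μ ρ n := by
  refine (Nat.le_ceil _).trans ?_
  exact_mod_cast (show ⌈μ / ρ⌉₊ ≤ slots μ ρ n by unfold slots; omega)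

theorem tendsto_slots : Tendsto (slots μ ρ) atTop atTop :=
  tendsto_atTop_mono (fun n => show n ≤ slots μ ρ n by unfold slots; omega) tendsto_id

theorem tendsto_div_slots (C : ℝ) :
    Tendsto (fun n => C / (slots μ ρ n : ℝ)) atTop (𝓝 0) :=
  (tendsto_const_div_atTop_nhds_zero_nat C).comp tendsto_slots

theorem norm_exp_slotGen_le (hμ : 0 < μ) (hρ : 0 < ρ) (hlam : 0 ≤ lam) (p n : ℕ) {t : ℝ}
    (ht : 0 ≤ t) :
    ‖NormedSpace.exp (t • slotGen μ ρ lam (slots μ ρ n) p)‖ ≤ Real.exp (μ * (2 ^ p - 1) * t) := by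
  have hk : (0 : ℝ) < slots μ ρ n := by exact_mod_cast slots_pos n
  exact norm_exp_smul_le _ (by positivity)
    (norm_one_add_slotGen_le hμ hρ hlam p (slots_pos n) (le_slots n) rfl) ht

theorem coord_limitGen (hμ : 0 < μ) (hρ : 0 < ρ) (hlam : 0 ≤ lam) (y : L1) (N : ℕ) :
    limitGen μ ρ lam hμ hρ hlam 0 2 le_rfl y N =ᵐ[volume]
      generator μ ρ lam (weightInv 2 y).fn N := by
  have h : coord N ∘L limitGen μ ρ lam hμ hρ hlam 0 2 le_rfl
      = (limitCoeffs μ ρ lam 0).row N ∘L weightInv 2 := by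
    refine lp_one_clm_ext fun M x => ?_
    change coord N (limitGen μ ρ lam hμ hρ hlam 0 2 le_rfl (incl M x))
      = (limitCoeffs μ ρ lam 0).row N (weightInv 2 (incl M x))
    rw [limitGen_incl, weightInv_incl, map_smul, map_smul, Coeffs.coord_column]
  have h2 := congrArg (fun T : L1 →L[ℝ] LpN N => T y) h
  simp only [ContinuousLinearMap.comp_apply] at h2
  rw [← coord_apply, h2, ← limitCoeffs_pointwise]
  exact Coeffs.row_ae _ (fun N => EventuallyEq.rfl) N

/-- With only two powers of the weight there is no rate in `k`, but the operators are uniformly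
bounded and converge on every sector, so they converge strongly. This is what makes all of `D¹`
accessible. -/
theorem tendsto_slotGen_weightInv (hμ : 0 < μ) (hρ : 0 < ρ) (hlam : 0 ≤ lam) (y : L1) :
    Tendsto (fun n => slotGen μ ρ lam (slots μ ρ n) 0 (weightInv 2 y)) atTop
      (𝓝 (limitGen μ ρ lam hμ hρ hlam 0 2 le_rfl y)) := by
  have h := tendsto_of_tendsto_incl
    (T := fun n => slotGen μ ρ lam (slots μ ρ n) 0 ∘L weightInv 2
      - limitGen μ ρ lam hμ hρ hlam 0 2 le_rfl)
    (fun n => norm_slotGen_weightInv_two_sub_le hμ hρ hlam 0 (slots_pos n)) (fun N x => ?_) y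
  · rw [tendsto_iff_norm_sub_tendsto_zero]
    simpa using h.norm
  · simp only [slotGen_weightInv_sub_incl]
    have hlim := (tendsto_div_slots (μ := μ) (ρ := ρ)
      ((2 ^ 0 + 4) * μ + μ * 2 ^ 0 + 2 * ρ + 2 * lam)).mul_const (((N : ℝ) + 1) ^ 3 * ‖x‖)
    rw [zero_mul] at hlim
    have h0 : Tendsto (fun n => ((limitCoeffs μ ρ lam 0).column N
        - (slotCoeffs μ ρ lam (slots μ ρ n) 0).column N) x) atTop (𝓝 0) :=
      squeeze_zero_norm (fun n => ?_) hlim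
    · have h1 := (h0.const_smul ((((N : ℝ) + 1) ^ 2)⁻¹)).neg
      rwa [smul_zero, neg_zero] at h1
    refine (ContinuousLinearMap.le_of_opNorm_le _
      (norm_column_sub_le_cube hμ hρ hlam 0 (slots_pos n) N) x).trans (le_of_eq (by ring))

/-- Solvability of the master equation in the domain, as a limit of the dynamics with finitely many
slots. -/
theorem exists_solution_of_weightInv (hμ : 0 < μ) (hρ : 0 < ρ) (hlam : 0 ≤ lam) (g : L1) :
    ∃ u : ℝ → L1, u 0 = weightInv 2 g ∧
      (∀ t, 0 ≤ t → ∃ y, u t = weightInv 2 y ∧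
        HasDerivWithinAt u (limitGen μ ρ lam hμ hρ hlam 0 2 le_rfl y) (Ici 0) t) ∧
      ∀ t, 0 ≤ t → Tendsto (fun n => NormedSpace.exp (t • slotGen μ ρ lam (slots μ ρ n) 0)
        (weightInv 2 g)) atTop (𝓝 (u t)) := by
  have hω : ∀ p : ℕ, 0 ≤ μ * (2 ^ p - 1) := fun p =>
    mul_nonneg hμ.le (by linarith [(one_le_pow₀ one_le_two : (1 : ℝ) ≤ 2 ^ p)])
  set C := (2 ^ 2 + 4) * μ + μ * 2 ^ 2 + 2 * ρ + 2 * lam with hC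
  -- The semigroups are run with the exponent `2`, so that the limit, read through `weightInv 2`,
  -- stays in `D¹`. The dense subspace is the range of `weightInv 3`, where the generators converge
  -- at the rate `1 / k`; there the exponent is `2 + 3`.
  obtain ⟨v, hvc, hv⟩ := exists_limit_semigroup
    (fun n => slotGen μ ρ lam (slots μ ρ n) 2) (fun n => slotGen μ ρ lam (slots μ ρ n) (2 + 3))
    (weightInv 3) (hω 2) (hω (2 + 3)) (fun n t ht => norm_exp_slotGen_le hμ hρ hlam 2 n ht)
    (fun n t ht => norm_exp_slotGen_le hμ hρ hlam (2 + 3) n ht) (denseRange_weightInv 3)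
    (fun n s => exp_comp_comm (slotGen_comp_weightInv _ _ _) s)
    (fun n => C / (slots μ ρ n : ℝ)) (tendsto_div_slots C)
    (fun n m x => by
      have e : (slotGen μ ρ lam (slots μ ρ n) 2 - slotGen μ ρ lam (slots μ ρ m) 2) (weightInv 3 x)
          = (slotGen μ ρ lam (slots μ ρ n) 2 ∘L weightInv 3
              - limitGen μ ρ lam hμ hρ hlam 2 3 (by norm_num)) x
            - (slotGen μ ρ lam (slots μ ρ m) 2 ∘L weightInv 3
              - limitGen μ ρ lam hμ hρ hlam 2 3 (by norm_num)) x := by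
        simp only [sub_apply, ContinuousLinearMap.comp_apply]; abel
      rw [e, add_mul]
      exact (norm_sub_le _ _).trans (add_le_add
        (ContinuousLinearMap.le_of_opNorm_le _
          (norm_slotGen_weightInv_sub_le hμ hρ hlam 2 (slots_pos n)) x)
        (ContinuousLinearMap.le_of_opNorm_le _
          (norm_slotGen_weightInv_sub_le hμ hρ hlam 2 (slots_pos m)) x))) g
  have hlim : ∀ t, 0 ≤ t → Tendsto (fun n =>
      NormedSpace.exp (t • slotGen μ ρ lam (slots μ ρ n) 2) g) atTop (𝓝 (v t)) :=
    fun t ht => (hv t).tendsto_at ⟨ht, le_rfl⟩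
  have hcomm : ∀ n, slotGen μ ρ lam (slots μ ρ n) 0 ∘L weightInv 2
      = weightInv 2 ∘L slotGen μ ρ lam (slots μ ρ n) 2 := fun n => by
    have := slotGen_comp_weightInv (μ := μ) (ρ := ρ) (lam := lam) (slots μ ρ n) 0 2
    rwa [zero_add] at this
  have hexp : ∀ (n : ℕ) (t : ℝ), NormedSpace.exp (t • slotGen μ ρ lam (slots μ ρ n) 0)
      (weightInv 2 g) = weightInv 2 (NormedSpace.exp (t • slotGen μ ρ lam (slots μ ρ n) 2) g) :=
    fun n t => congrArg (fun T : L1 →L[ℝ] L1 => T g) (exp_comp_comm (hcomm n) t)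
  refine ⟨fun t => weightInv 2 (v t), ?_, fun t ht => ⟨v t, rfl, ?_⟩, fun t ht => ?_⟩
  · have h0 := hlim 0 le_rfl
    simp only [zero_smul, NormedSpace.exp_zero, one_apply_eq_self] at h0
    simp only
    rw [tendsto_nhds_unique h0 tendsto_const_nhds]
  · refine hasDerivWithinAt_limit_semigroup (fun n => slotGen μ ρ lam (slots μ ρ n) 2)
      (weightInv 2) (limitGen μ ρ lam hμ hρ hlam 0 2 le_rfl) (hω 2)
      (fun n t ht => norm_exp_slotGen_le hμ hρ hlam 2 n ht)
      (K := (2 ^ 0 + 4) * μ + μ * 2 ^ 0 + 2 * ρ + 2 * lam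
        + ‖limitGen μ ρ lam hμ hρ hlam 0 2 le_rfl‖) (fun n => ?_) (fun x => ?_) g v hvc hlim t ht
    · rw [← hcomm]
      exact (norm_le_norm_sub_add _ (limitGen μ ρ lam hμ hρ hlam 0 2 le_rfl)).trans
        (add_le_add_left (norm_slotGen_weightInv_two_sub_le hμ hρ hlam 0 (slots_pos n)) _)
    · have h := tendsto_slotGen_weightInv hμ hρ hlam x
      refine h.congr fun n => ?_
      exact congrArg (fun T : L1 →L[ℝ] L1 => T x) (hcomm n)
  · simp only [hexp]
    exact ((weightInv 2).continuous.tendsto _).comp (hlim t ht)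

/-- The difference solves the same linear equation, whose generator is on `D¹` the pointwise limit
of the slot generators; unweighted, these are dissipative. -/
theorem eq_of_hasDerivWithinAt_limitGen (hμ : 0 < μ) (hρ : 0 < ρ) (hlam : 0 ≤ lam) {u w : ℝ → L1}
    (hu : ∀ t, 0 ≤ t → ∃ y, u t = weightInv 2 y ∧
        HasDerivWithinAt u (limitGen μ ρ lam hμ hρ hlam 0 2 le_rfl y) (Ici 0) t)
    (hw : ∀ t, 0 ≤ t → ∃ y, w t = weightInv 2 y ∧
        HasDerivWithinAt w (limitGen μ ρ lam hμ hρ hlam 0 2 le_rfl y) (Ici 0) t)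
    (h0 : w 0 = u 0) {t : ℝ} (ht : 0 ≤ t) : w t = u t := by
  have hz : ∀ t, ∃ y, 0 ≤ t → w t - u t = weightInv 2 y ∧
      HasDerivWithinAt (fun s => w s - u s) (limitGen μ ρ lam hμ hρ hlam 0 2 le_rfl y) (Ici 0) t := by
    intro t
    by_cases ht : 0 ≤ t
    · obtain ⟨y1, h1, h2⟩ := hu t ht
      obtain ⟨y2, h3, h4⟩ := hw t ht
      refine ⟨y2 - y1, fun _ => ⟨by rw [map_sub, h1, h3], ?_⟩⟩
      rw [map_sub]
      exact h4.sub h2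
    · exact ⟨0, fun h => absurd h ht⟩
  choose y hy using hz
  have hd : ∀ n : ℕ, 0 < μ + ρ * (slots μ ρ n : ℝ) + lam * (slots μ ρ n : ℝ) ^ 2 := fun n => by
    positivity
  have := eq_zero_of_dissipative (fun n => slotGen μ ρ lam (slots μ ρ n) 0) _ hd
    (fun n s hs hsd => norm_one_add_smul_le _ (hd n) (by
      have := norm_one_add_slotGen_le hμ hρ hlam 0 (slots_pos n) (le_slots n) rfl
      simpa using this) hs hsd)
    (fun s => w s - u s) (fun s => limitGen μ ρ lam hμ hρ hlam 0 2 le_rfl (y s))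
    (fun t ht => (hy t ht).2) (fun t ht => by
      have := tendsto_slotGen_weightInv hμ hρ hlam (y t)
      rwa [← (hy t ht).1] at this) (by simp [h0]) t ht
  exact sub_eq_zero.1 this

theorem integral_abs_fn (f : L1) (N : ℕ) : ∫ v, |f.fn N v| = ‖f N‖ := by
  rw [L1.norm_eq_integral_norm]; rfl

theorem summable_sq_weightInv (y : L1) :
    Summable fun N : ℕ => (N : ℝ) ^ 2 * ∫ v, |(weightInv 2 y).fn N v| := by
  refine Summable.of_nonneg_of_le (fun N => by positivity) (fun N => ?_)
    (lp_one_hasSum_norm y).summable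
  rw [integral_abs_fn, weightInv_apply, norm_smul, norm_inv, Real.norm_of_nonneg (by positivity),
    ← mul_assoc]
  refine mul_le_of_le_one_left (norm_nonneg _) ?_
  rw [mul_inv_le_iff₀ (by positivity), one_mul]
  gcongr
  linarith

theorem exists_eq_weightInv {f : L1} (h : MemD1 f.fn) : ∃ y, f = weightInv 2 y := by
  have hs : Summable fun N : ℕ => ‖((N : ℝ) + 1) ^ 2 • f N‖ := by
    -- Domination by `(N + 1) ^ 2 ≤ 2 N ^ 2 + 2`, the difference being `(N - 1) ^ 2`.
    have h1 := (h.summable_sq.mul_left 2).add (h.summable.mul_left 2)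
    refine Summable.of_nonneg_of_le (fun N => norm_nonneg _) (fun N => ?_) h1
    rw [norm_smul, Real.norm_of_nonneg (by positivity), integral_abs_fn]
    nlinarith [norm_nonneg (f N), mul_nonneg (sq_nonneg ((N : ℝ) - 1)) (norm_nonneg (f N))]
  refine ⟨⟨fun N => ((N : ℝ) + 1) ^ 2 • f N, memℓp_gen (by simpa using hs)⟩, ?_⟩
  ext1
  ext1 N
  rw [weightInv_apply]
  change f N = (((N : ℝ) + 1) ^ 2)⁻¹ • ((N : ℝ) + 1) ^ 2 • f N
  rw [smul_smul, inv_mul_cancel₀ (by positivity), one_smul]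

theorem IsSolution.hasDerivWithinAt_limitGen (hμ : 0 < μ) (hρ : 0 < ρ) (hlam : 0 ≤ lam)
    {w : ℝ → L1} (hw : IsSolution μ ρ lam w) {t : ℝ} (ht : 0 ≤ t) : ∃ y, w t = weightInv 2 y ∧
        HasDerivWithinAt w (limitGen μ ρ lam hμ hρ hlam 0 2 le_rfl y) (Ici 0) t := by
  obtain ⟨y, hy⟩ := exists_eq_weightInv (hw.mem_D1 t ht)
  obtain ⟨w', h1, h2⟩ := hw.master t ht
  refine ⟨y, hy, ?_⟩
  have : limitGen μ ρ lam hμ hρ hlam 0 2 le_rfl y = w' := by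
    ext1
    ext1 N
    refine Lp.ext ?_
    refine (coord_limitGen hμ hρ hlam y N).trans ?_
    rw [← hy]
    exact (h1 N).symm
  rwa [this]

end KacReservoir
end

/-! ### The entropy inequality for two independent variables -/

noncomputable section

namespace KacReservoir

section TwoVariables

theorem integrable_of_abs_le {Ω : Type*} [MeasurableSpace Ω] {ν : Measure Ω} [IsFiniteMeasure ν]
    {f : Ω → ℝ} (hf : Measurable f) {C : ℝ} (hC : ∀ x, |f x| ≤ C) : Integrable f ν :=
  Integrable.of_bound hf.aestronglyMeasurable C (ae_of_all _ hC)

theorem abs_log_le_of_mem {δ C x : ℝ} (hδ : 0 < δ) (h1 : δ ≤ x) (h2 : x ≤ C) :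
    |Real.log x| ≤ |Real.log δ| + |Real.log C| := by
  have hx := hδ.trans_le h1
  have h3 := Real.log_le_log hδ h1
  have h4 := Real.log_le_log hx h2
  rw [abs_le]
  constructor
  · linarith [neg_abs_le (Real.log δ), abs_nonneg (Real.log C)]
  · linarith [le_abs_self (Real.log C), abs_nonneg (Real.log δ)]

theorem mul_log_sub_le {x z : ℝ} (hx : 0 < x) (hz : 0 < z) :
    0 ≤ x * Real.log x - x * Real.log z - x + z := by
  have h := Real.log_le_sub_one_of_pos (div_pos hz hx)
  rw [Real.log_div hz.ne' hx.ne'] at h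
  have h2 := mul_le_mul_of_nonneg_left h hx.le
  have h3 : x * (z / x - 1) = z - x := by field_simp
  nlinarith

theorem exists_bound_mul_log (C : ℝ) : ∃ K, ∀ x, 0 ≤ x → x ≤ C → |x * Real.log x| ≤ K := by
  obtain ⟨K, hK⟩ := (isCompact_Icc (a := (0 : ℝ)) (b := C)).exists_bound_of_continuousOn
    Real.continuous_mul_log.continuousOn
  exact ⟨K, fun x h0 h1 => hK x ⟨h0, h1⟩⟩

variable {Ω : Type*} [MeasurableSpace Ω] {ν : Measure Ω} [IsProbabilityMeasure ν]

theorem integral_mem_Icc {f : Ω → ℝ} {a b : ℝ} (hf : Measurable f) (ha : ∀ x, a ≤ f x)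
    (hb : ∀ x, f x ≤ b) : a ≤ ∫ x, f x ∂ν ∧ ∫ x, f x ∂ν ≤ b := by
  have hi : Integrable f ν := integrable_of_abs_le (C := |a| + |b|) hf fun x => by
    rw [abs_le]
    constructor
    · linarith [ha x, neg_abs_le a, abs_nonneg b]
    · linarith [hb x, le_abs_self b, abs_nonneg a]
  constructor
  · calc a = ∫ _, a ∂ν := by simp
      _ ≤ _ := integral_mono (integrable_const _) hi ha
  · calc _ ≤ ∫ _, b ∂ν := integral_mono hi (integrable_const _) hb
      _ = b := by simp

/-- With `G` the marginal and `m` the mass, this is the entropy of `F` relative to `G(x) G(y) / m`.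
The integrand `F log (F / Z) - F + Z`, with `Z` that product, is pointwise nonnegative, and `F` and
`Z` have the same integral. Symmetry makes the two marginals coincide. -/
theorem two_variable_entropy_of_pos {F : Ω → Ω → ℝ}
    (hF : Measurable fun z : Ω × Ω => F z.1 z.2) (hsymm : ∀ x y, F x y = F y x) {δ C : ℝ}
    (hδ : 0 < δ) (h0 : ∀ x y, δ ≤ F x y) (hC : ∀ x y, F x y ≤ C) :
    0 ≤ (∫ x, ∫ y, F x y * Real.log (F x y) ∂ν ∂ν)
      - 2 * ∫ x, (∫ y, F x y ∂ν) * Real.log (∫ y, F x y ∂ν) ∂ν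
      + (∫ x, ∫ y, F x y ∂ν ∂ν) * Real.log (∫ x, ∫ y, F x y ∂ν ∂ν) := by
  set G : Ω → ℝ := fun x => ∫ y, F x y ∂ν with hG
  have hGm : Measurable G := (hF.stronglyMeasurable.integral_prod_right (ν := ν)).measurable
  have hGb : ∀ x, δ ≤ G x ∧ G x ≤ C := fun x =>
    integral_mem_Icc (hF.comp measurable_prodMk_left) (h0 x) (hC x)
  set m := ∫ x, G x ∂ν with hm
  have hmb : δ ≤ m ∧ m ≤ C := integral_mem_Icc hGm (fun x => (hGb x).1) fun x => (hGb x).2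
  have hm0 : 0 < m := hδ.trans_le hmb.1
  have hC0 : 0 < C := hm0.trans_le hmb.2
  set K := |Real.log δ| + |Real.log C| with hK
  have hK0 : 0 ≤ K := by positivity
  have hFabs : ∀ x y, |F x y| ≤ C := fun x y => by
    rw [abs_of_pos (hδ.trans_le (h0 x y))]; exact hC x y
  have hlG : ∀ x, |Real.log (G x)| ≤ K := fun x => abs_log_le_of_mem hδ (hGb x).1 (hGb x).2
  have b : ∀ {a b : ℝ}, |a| ≤ C → |b| ≤ K → |a * b| ≤ C * K := fun ha hb => by
    rw [abs_mul]; exact mul_le_mul ha hb (abs_nonneg _) hC0.le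
  have i1 : Integrable (fun z : Ω × Ω => F z.1 z.2 * Real.log (F z.1 z.2)) (ν.prod ν) :=
    integrable_of_abs_le (hF.mul (Real.measurable_log.comp hF)) fun z =>
      b (hFabs _ _) (abs_log_le_of_mem hδ (h0 _ _) (hC _ _))
  have i2 : Integrable (fun z : Ω × Ω => F z.1 z.2 * Real.log (G z.1)) (ν.prod ν) :=
    integrable_of_abs_le (hF.mul (Real.measurable_log.comp (hGm.comp measurable_fst))) fun z =>
      b (hFabs _ _) (hlG _)
  have i3 : Integrable (fun z : Ω × Ω => F z.1 z.2 * Real.log (G z.2)) (ν.prod ν) :=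
    integrable_of_abs_le (hF.mul (Real.measurable_log.comp (hGm.comp measurable_snd))) fun z =>
      b (hFabs _ _) (hlG _)
  have i4 : Integrable (fun z : Ω × Ω => F z.1 z.2) (ν.prod ν) :=
    integrable_of_abs_le hF fun z => hFabs _ _
  have i5 : Integrable (fun z : Ω × Ω => G z.1 * G z.2) (ν.prod ν) := by
    refine integrable_of_abs_le (C := C * C) ((hGm.comp measurable_fst).mul
      (hGm.comp measurable_snd)) fun z => ?_
    have h1 : ∀ x, |G x| ≤ C := fun x => by
      rw [abs_of_pos (hδ.trans_le (hGb x).1)]; exact (hGb x).2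
    rw [abs_mul]; exact mul_le_mul (h1 _) (h1 _) (abs_nonneg _) hC0.le
  have e1 : ∫ z, F z.1 z.2 * Real.log (F z.1 z.2) ∂(ν.prod ν)
      = ∫ x, ∫ y, F x y * Real.log (F x y) ∂ν ∂ν := integral_prod _ i1
  have e2 : ∫ z, F z.1 z.2 * Real.log (G z.1) ∂(ν.prod ν) = ∫ x, G x * Real.log (G x) ∂ν := by
    rw [integral_prod _ i2]
    simp only [integral_mul_const]
    rfl
  have e3 : ∫ z, F z.1 z.2 * Real.log (G z.2) ∂(ν.prod ν) = ∫ x, G x * Real.log (G x) ∂ν := by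
    rw [integral_prod_symm _ i3]
    simp only [integral_mul_const]
    refine integral_congr_ae (ae_of_all _ fun y => ?_)
    simp only [fun x => hsymm x y]
    rfl
  have e4 : ∫ z, F z.1 z.2 ∂(ν.prod ν) = m := integral_prod _ i4
  have e5 : ∫ z, G z.1 * G z.2 ∂(ν.prod ν) = m * m := integral_prod_mul G G
  have hpos : 0 ≤ ∫ z, (F z.1 z.2 * Real.log (F z.1 z.2) - F z.1 z.2 * Real.log (G z.1)
      - F z.1 z.2 * Real.log (G z.2) + F z.1 z.2 * (Real.log m - 1) + G z.1 * G z.2 * m⁻¹)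
      ∂(ν.prod ν) := by
    refine integral_nonneg fun z => ?_
    have hx := hδ.trans_le (h0 z.1 z.2)
    have g1 := hδ.trans_le (hGb z.1).1
    have g2 := hδ.trans_le (hGb z.2).1
    have := mul_log_sub_le hx (z := G z.1 * G z.2 * m⁻¹) (by positivity)
    rw [Real.log_mul (by positivity) (by positivity), Real.log_mul g1.ne' g2.ne', Real.log_inv]
      at this
    simp only [Pi.zero_apply]
    linarith
  have j2 : Integrable (fun z : Ω × Ω => F z.1 z.2 * Real.log (F z.1 z.2)
      - F z.1 z.2 * Real.log (G z.1)) (ν.prod ν) := i1.sub i2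
  have j3 : Integrable (fun z : Ω × Ω => F z.1 z.2 * Real.log (F z.1 z.2)
      - F z.1 z.2 * Real.log (G z.1) - F z.1 z.2 * Real.log (G z.2)) (ν.prod ν) := j2.sub i3
  have j4 : Integrable (fun z : Ω × Ω => F z.1 z.2 * Real.log (F z.1 z.2)
      - F z.1 z.2 * Real.log (G z.1) - F z.1 z.2 * Real.log (G z.2)
      + F z.1 z.2 * (Real.log m - 1)) (ν.prod ν) := j3.add (i4.mul_const _)
  rw [integral_add j4 (i5.mul_const _), integral_add j3 (i4.mul_const _), integral_sub j2 i3,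
    integral_sub i1 i2, integral_mul_const, integral_mul_const, e1, e2, e3, e4, e5,
    mul_inv_cancel_right₀ hm0.ne'] at hpos
  linarith

/-- The mixed second difference of the entropy of a symmetric function of two independent
variables is nonnegative. -/
theorem two_variable_entropy {F : Ω → Ω → ℝ}
    (hF : Measurable fun z : Ω × Ω => F z.1 z.2) (hsymm : ∀ x y, F x y = F y x) {C : ℝ}
    (h0 : ∀ x y, 0 ≤ F x y) (hC : ∀ x y, F x y ≤ C) :
    0 ≤ (∫ x, ∫ y, F x y * Real.log (F x y) ∂ν ∂ν)
      - 2 * ∫ x, (∫ y, F x y ∂ν) * Real.log (∫ y, F x y ∂ν) ∂ν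
      + (∫ x, ∫ y, F x y ∂ν ∂ν) * Real.log (∫ x, ∫ y, F x y ∂ν ∂ν) := by
  obtain ⟨K, hK⟩ := exists_bound_mul_log (C + 1)
  -- The shifts `F + δ n` are bounded below; averages commute with the shift because `ν` is a
  -- probability measure, and `δ n → 0` is a dominated limit.
  set δ : ℕ → ℝ := fun n => 1 / ((n : ℝ) + 1) with hδ
  have hδ0 : ∀ n, 0 < δ n := fun n => by positivity
  have hδ1 : ∀ n, δ n ≤ 1 := fun n => by
    rw [hδ]; simp only; rw [div_le_one (by positivity)]; linarith [(n.cast_nonneg : (0 : ℝ) ≤ n)]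
  have hδt : Tendsto δ atTop (𝓝 0) := tendsto_one_div_add_atTop_nhds_zero_nat
  have hφ : ∀ x : ℝ, Tendsto (fun n => (x + δ n) * Real.log (x + δ n)) atTop (𝓝 (x * Real.log x)) := by
    intro x
    have h1 : Tendsto (fun n => x + δ n) atTop (𝓝 x) := by
      simpa using hδt.const_add x
    exact (Real.continuous_mul_log.tendsto x).comp h1
  have hφm : Measurable fun x : ℝ => x * Real.log x := Real.continuous_mul_log.measurable
  have hGm : Measurable fun x => ∫ y, F x y ∂ν :=
    (hF.stronglyMeasurable.integral_prod_right (ν := ν)).measurable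
  have hsec : ∀ x, Measurable (F x) := fun x => hF.comp measurable_prodMk_left
  have hGb : ∀ x, 0 ≤ ∫ y, F x y ∂ν ∧ ∫ y, F x y ∂ν ≤ C := fun x =>
    integral_mem_Icc (hsec x) (h0 x) (hC x)
  have hFi : ∀ x, Integrable (F x) ν := fun x => integrable_of_abs_le (C := C) (hsec x) fun y => by
    rw [abs_of_nonneg (h0 x y)]; exact hC x y
  have hG' : ∀ n x, ∫ y, (F x y + δ n) ∂ν = (∫ y, F x y ∂ν) + δ n := fun n x => by
    rw [integral_add (hFi x) (integrable_const _)]; simp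
  have hm' : ∀ n, ∫ x, ∫ y, (F x y + δ n) ∂ν ∂ν = (∫ x, ∫ y, F x y ∂ν ∂ν) + δ n := fun n => by
    simp only [hG']
    rw [integral_add (integrable_of_abs_le (C := C) hGm fun x => by
      rw [abs_of_nonneg (hGb x).1]; exact (hGb x).2) (integrable_const _)]
    simp
  have key : ∀ n, 0 ≤ (∫ z, (F z.1 z.2 + δ n) * Real.log (F z.1 z.2 + δ n) ∂(ν.prod ν))
      - 2 * ∫ x, ((∫ y, F x y ∂ν) + δ n) * Real.log ((∫ y, F x y ∂ν) + δ n) ∂ν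
      + ((∫ x, ∫ y, F x y ∂ν ∂ν) + δ n) * Real.log ((∫ x, ∫ y, F x y ∂ν ∂ν) + δ n) := by
    intro n
    have h := two_variable_entropy_of_pos (ν := ν) (F := fun x y => F x y + δ n)
      (hF.add_const _) (fun x y => by rw [hsymm]) (hδ0 n) (fun x y => by linarith [h0 x y])
      (C := C + 1) (fun x y => by linarith [hC x y, hδ1 n])
    rw [hm'] at h
    simp only [hG'] at h
    rw [integral_prod]
    · exact h
    · exact integrable_of_abs_le (C := K) (hφm.comp (hF.add_const _)) fun z =>
        hK _ (by linarith [h0 z.1 z.2, hδ0 n]) (by linarith [hC z.1 z.2, hδ1 n])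
  have t1 : Tendsto (fun n => ∫ z, (F z.1 z.2 + δ n) * Real.log (F z.1 z.2 + δ n) ∂(ν.prod ν))
      atTop (𝓝 (∫ z, F z.1 z.2 * Real.log (F z.1 z.2) ∂(ν.prod ν))) :=
    tendsto_integral_of_dominated_convergence (fun _ => K)
      (fun n => (hφm.comp (hF.add_const _)).aestronglyMeasurable) (integrable_const _)
      (fun n => ae_of_all _ fun z =>
        hK _ (by linarith [h0 z.1 z.2, hδ0 n]) (by linarith [hC z.1 z.2, hδ1 n]))
      (ae_of_all _ fun z => hφ _)
  have t2 : Tendsto (fun n => ∫ x, ((∫ y, F x y ∂ν) + δ n) * Real.log ((∫ y, F x y ∂ν) + δ n) ∂ν)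
      atTop (𝓝 (∫ x, (∫ y, F x y ∂ν) * Real.log (∫ y, F x y ∂ν) ∂ν)) :=
    tendsto_integral_of_dominated_convergence (fun _ => K)
      (fun n => (hφm.comp (hGm.add_const _)).aestronglyMeasurable) (integrable_const _)
      (fun n => ae_of_all _ fun x =>
        hK _ (by linarith [(hGb x).1, hδ0 n]) (by linarith [(hGb x).2, hδ1 n]))
      (ae_of_all _ fun z => hφ _)
  have hfin := ge_of_tendsto' ((t1.sub (t2.const_mul 2)).add (hφ (∫ x, ∫ y, F x y ∂ν ∂ν))) key
  rwa [integral_prod] at hfin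
  exact integrable_of_abs_le (C := K) (hφm.comp hF) fun z =>
        hK _ (h0 z.1 z.2) (by linarith [hC z.1 z.2])

end TwoVariables

end KacReservoir
end

/-! ### Gaussian measures, averages over slots, subadditivity of the entropy -/

noncomputable section

namespace KacReservoir

/-- The one-particle Maxwellian. -/
def gauss : Measure ℝ :=
  volume.withDensity fun w => ENNReal.ofReal (Real.exp (-Real.pi * w ^ 2))

instance : IsProbabilityMeasure gauss := by
  constructor
  rw [gauss, withDensity_apply _ MeasurableSet.univ, Measure.restrict_univ,
    ← ofReal_integral_eq_lintegral_ofReal integrable_exp_neg_pi_sq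
      (ae_of_all _ fun w => (Real.exp_pos _).le), integral_exp_neg_pi_sq, ENNReal.ofReal_one]

theorem integral_gauss (f : ℝ → ℝ) :
    ∫ w, f w ∂gauss = ∫ w, Real.exp (-Real.pi * w ^ 2) * f w := by
  rw [gauss, integral_withDensity_eq_integral_toReal_smul₀ (by fun_prop) (by simp)]
  simp [ENNReal.toReal_ofReal (Real.exp_pos _).le]

/-- The `N`-particle Maxwellian. -/
abbrev gaussN (N : ℕ) : Measure (Fin N → ℝ) := Measure.pi fun _ => gauss

theorem maxwellian_pos (N : ℕ) (v : Fin N → ℝ) : 0 < maxwellian N v :=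
  Finset.prod_pos fun _ _ => Real.exp_pos _

theorem measurable_maxwellian (N : ℕ) : Measurable (maxwellian N) := by
  unfold maxwellian; fun_prop

theorem lintegral_fin_prod {N : ℕ} {f : Fin N → ℝ → ENNReal} (hf : ∀ i, Measurable (f i)) :
    ∫⁻ v : Fin N → ℝ, ∏ i, f i (v i) = ∏ i, ∫⁻ w, f i w := by
  induction N with
  | zero => simp [volume_pi]
  | succ n ih =>
    have hp := volume_preserving_piFinSuccAbove (fun _ : Fin (n + 1) => ℝ) 0
    have h1 := hp.lintegral_comp_emb (MeasurableEquiv.measurableEmbedding _)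
      (fun z : ℝ × (Fin n → ℝ) => f 0 z.1 * ∏ i, f i.succ (z.2 i))
    rw [show (volume : Measure (ℝ × (Fin n → ℝ))) = volume.prod volume from rfl,
      lintegral_prod_mul (g := fun z : Fin n → ℝ => ∏ i : Fin n, f i.succ (z i))
        (hf 0).aemeasurable (Finset.measurable_prod _ fun (i : Fin n) _ =>
          (hf i.succ).comp (measurable_pi_apply i)).aemeasurable,
      ih fun i => hf i.succ] at h1
    rw [Fin.prod_univ_succ, ← h1]
    refine lintegral_congr fun v => ?_
    rw [Fin.prod_univ_succ]
    rfl

theorem gaussN_eq (N : ℕ) :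
    gaussN N = volume.withDensity fun v => ENNReal.ofReal (maxwellian N v) := by
  refine (Measure.pi_eq fun s hs => ?_)
  rw [withDensity_apply _ (MeasurableSet.univ_pi hs), ← lintegral_indicator (MeasurableSet.univ_pi hs)]
  have e : ∀ v : Fin N → ℝ, (Set.pi univ s).indicator (fun v => ENNReal.ofReal (maxwellian N v)) v
      = ∏ i, (s i).indicator (fun w => ENNReal.ofReal (Real.exp (-Real.pi * w ^ 2))) (v i) := by
    intro v
    by_cases h : v ∈ Set.pi univ s
    · rw [indicator_of_mem h, maxwellian, ENNReal.ofReal_prod_of_nonneg fun _ _ => (Real.exp_pos _).le]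
      exact Finset.prod_congr rfl fun i _ => by rw [indicator_of_mem (h i (mem_univ i))]
    · rw [indicator_of_notMem h]
      simp only [Set.mem_pi, mem_univ, forall_true_left, not_forall] at h
      obtain ⟨i, hi⟩ := h
      exact (Finset.prod_eq_zero (Finset.mem_univ i) (indicator_of_notMem hi _)).symm
  simp only [e]
  rw [lintegral_fin_prod]
  · refine Finset.prod_congr rfl fun i _ => ?_
    rw [lintegral_indicator (hs i), gauss, withDensity_apply _ (hs i)]
  · intro i
    exact Measurable.indicator (by fun_prop) (hs i)

theorem integral_gaussN (N : ℕ) (f : (Fin N → ℝ) → ℝ) :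
    ∫ v, f v ∂gaussN N = ∫ v, f v * maxwellian N v := by
  rw [gaussN_eq, integral_withDensity_eq_integral_toReal_smul₀
    (measurable_maxwellian N).ennreal_ofReal.aemeasurable (by simp)]
  simp [ENNReal.toReal_ofReal (maxwellian_pos N _).le, mul_comm]

theorem maxwellian_succ {n : ℕ} (i : Fin (n + 1)) (v : Fin (n + 1) → ℝ) :
    maxwellian (n + 1) v
      = Real.exp (-Real.pi * v i ^ 2) * maxwellian n (fun j => v (i.succAbove j)) := by
  rw [maxwellian, Fin.prod_univ_succAbove _ i]; rfl

theorem maxwellian_insertNth {n : ℕ} (i : Fin (n + 1)) (w : ℝ) (v : Fin n → ℝ) :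
    maxwellian (n + 1) (i.insertNth (α := fun _ => ℝ) w v)
      = Real.exp (-Real.pi * w ^ 2) * maxwellian n v := by
  rw [maxwellian_succ i]; simp

theorem maxwellian_rotate {n : ℕ} {i j : Fin n} (hij : i ≠ j) (θ : ℝ) (v : Fin n → ℝ) :
    maxwellian n (rotate i j θ v) = maxwellian n v := by
  simp only [maxwellian]
  rw [← Real.exp_sum, ← Real.exp_sum, ← Finset.mul_sum, ← Finset.mul_sum, sum_rotate_sq hij]

/-- Sequences of bounded measurable functions. -/
structure IsBddMeas (h : FunSeq) : Prop where
  meas : ∀ N, Measurable (h N)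
  bdd : ∃ C, ∀ N v, |h N v| ≤ C

theorem IsBddMeas.integrable {h : FunSeq} (hh : IsBddMeas h) (N : ℕ) {μ : Measure (Fin N → ℝ)}
    [IsFiniteMeasure μ] : Integrable (h N) μ :=
  let ⟨_, hC⟩ := hh.bdd
  integrable_of_abs_le (hh.meas N) (hC N)

theorem measurable_cons {N : ℕ} :
    Measurable fun z : ℝ × (Fin N → ℝ) => (Fin.cons z.1 z.2 : Fin (N + 1) → ℝ) := by
  refine measurable_pi_iff.2 fun i => ?_
  refine Fin.cases ?_ (fun j => ?_) i
  · exact measurable_fst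
  · simp only [Fin.cons_succ]; fun_prop

/-- The average over the state of one slot, which is occupied with probability `q`. -/
def slotAvg (q : ℝ) (h : FunSeq) : FunSeq := fun N v =>
  (1 - q) * h N v + q * ∫ w, h (N + 1) (Fin.cons w v) ∂gauss

theorem IsBddMeas.avg {q : ℝ} {h : FunSeq} (hh : IsBddMeas h) : IsBddMeas (slotAvg q h) := by
  obtain ⟨C, hC⟩ := hh.bdd
  refine ⟨fun N => ?_, |1 - q| * C + |q| * C, fun N v => ?_⟩
  · refine ((hh.meas N).const_mul _).add (Measurable.const_mul ?_ _)
    have : Measurable fun z : (Fin N → ℝ) × ℝ => h (N + 1) (Fin.cons z.2 z.1) :=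
      (hh.meas (N + 1)).comp (measurable_cons.comp measurable_swap)
    exact (this.stronglyMeasurable.integral_prod_right (ν := gauss)).measurable
  · refine (abs_add_le _ _).trans ?_
    rw [abs_mul, abs_mul]
    have h2 := norm_integral_le_of_norm_le_const (μ := gauss) (f := fun w => h (N + 1) (Fin.cons w v))
      (C := C) (ae_of_all _ fun w => hC _ _)
    rw [probReal_univ, mul_one, Real.norm_eq_abs] at h2
    gcongr
    exact hC N v

theorem piFinSuccAbove_zero_symm {N : ℕ} (z : ℝ × (Fin N → ℝ)) :
    (MeasurableEquiv.piFinSuccAbove (fun _ => ℝ) 0).symm z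
      = (Fin.cons z.1 z.2 : Fin (N + 1) → ℝ) := by
  change Fin.insertNth (α := fun _ => ℝ) 0 z.1 z.2 = _
  rw [Fin.insertNth_zero']

theorem integral_cons {N : ℕ} {f : (Fin (N + 1) → ℝ) → ℝ} (hf : Integrable f (gaussN (N + 1))) :
    ∫ v, ∫ w, f (Fin.cons w v) ∂gauss ∂gaussN N = ∫ v, f v ∂gaussN (N + 1) := by
  have hp := (measurePreserving_piFinSuccAbove (fun _ : Fin (N + 1) => gauss) 0).symm
  have h1 := hp.integral_comp' (g := f)
  have h2 := hp.integrable_comp_of_integrable hf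
  simp only [Function.comp_def, piFinSuccAbove_zero_symm] at h1 h2
  rw [← h1]
  exact (integral_prod_symm _ h2).symm

theorem integral_removeNth {n : ℕ} (i : Fin (n + 1)) {f : (Fin n → ℝ) → ℝ} :
    ∫ v, f (fun j => v (i.succAbove j)) ∂gaussN (n + 1) = ∫ v, f v ∂gaussN n := by
  have hp := measurePreserving_piFinSuccAbove (fun _ : Fin (n + 1) => gauss) i
  have h1 := hp.integral_comp' (g := fun z : ℝ × (Fin n → ℝ) => f z.2)
  have h2 : ∫ z, f z.2 ∂(gauss.prod (gaussN n)) = ∫ v, f v ∂gaussN n := by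
    have := integral_fun_snd (μ := gauss) (ν := gaussN n) f
    simpa using this
  rw [← h2, ← h1]
  rfl

theorem integral_slotAvg {q : ℝ} {h : FunSeq} (hh : IsBddMeas h) (N : ℕ) :
    ∫ v, slotAvg q h N v ∂gaussN N
      = (1 - q) * (∫ v, h N v ∂gaussN N) + q * ∫ v, h (N + 1) v ∂gaussN (N + 1) := by
  obtain ⟨C, hC⟩ := hh.bdd
  have hp := (measurePreserving_piFinSuccAbove (fun _ : Fin (N + 1) => gauss) 0).symm
  have h2 : Integrable (fun z : ℝ × (Fin N → ℝ) => h (N + 1) (Fin.cons z.1 z.2))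
      (gauss.prod (gaussN N)) :=
    integrable_of_abs_le ((hh.meas _).comp measurable_cons) fun z => hC _ _
  have h3 : Integrable (fun v => ∫ w, h (N + 1) (Fin.cons w v) ∂gauss) (gaussN N) :=
    h2.integral_prod_right
  simp only [slotAvg]
  rw [integral_add ((hh.integrable N).const_mul _) (h3.const_mul _), integral_const_mul,
    integral_const_mul, integral_cons (hh.integrable (N + 1))]

/-- The probability that exactly `N` of `k` slots are occupied. -/
def slotWeight (q : ℝ) (k N : ℕ) : ℝ := (k.choose N : ℝ) * q ^ N * (1 - q) ^ (k - N)

theorem slotWeight_nonneg {q : ℝ} (h0 : 0 ≤ q) (h1 : q ≤ 1) (k N : ℕ) : 0 ≤ slotWeight q k N := by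
  have : 0 ≤ 1 - q := by linarith
  unfold slotWeight; positivity

theorem slotWeight_of_lt {q : ℝ} {k N : ℕ} (h : k < N) : slotWeight q k N = 0 := by
  simp [slotWeight, Nat.choose_eq_zero_of_lt h]

theorem slotWeight_succ_zero (q : ℝ) (k : ℕ) :
    slotWeight q (k + 1) 0 = (1 - q) * slotWeight q k 0 := by
  simp [slotWeight, pow_succ, mul_comm]

/-- Pascal's rule, that is, conditioning on whether one distinguished slot is occupied. -/
theorem slotWeight_succ_succ (q : ℝ) (k N : ℕ) :
    slotWeight q (k + 1) (N + 1) = (1 - q) * slotWeight q k (N + 1) + q * slotWeight q k N := by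
  rcases lt_trichotomy k N with h | h | h
  · rw [slotWeight_of_lt (by omega), slotWeight_of_lt (by omega), slotWeight_of_lt h]; ring
  · subst h
    rw [slotWeight_of_lt (Nat.lt_succ_self k)]
    simp [slotWeight, pow_succ]; ring
  · obtain ⟨d, rfl⟩ := Nat.exists_eq_add_of_lt h
    have e1 : N + d + 1 + 1 - (N + 1) = d + 1 := by omega
    have e2 : N + d + 1 - (N + 1) = d := by omega
    have e3 : N + d + 1 - N = d + 1 := by omega
    simp only [slotWeight, Nat.choose_succ_succ (N + d + 1) N, e1, e2, e3]
    push_cast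
    ring

/-- The average over the states of `k` slots. -/
def slotMean (q : ℝ) (k : ℕ) (h : FunSeq) : ℝ :=
  ∑ N ∈ Finset.range (k + 1), slotWeight q k N * ∫ v, h N v ∂gaussN N

/-- Tower property: `k + 1` independent slots are `k` slots and one more, which is averaged out
first. -/
theorem slotMean_succ {q : ℝ} {h : FunSeq} (hh : IsBddMeas h) (k : ℕ) :
    slotMean q (k + 1) h = slotMean q k (slotAvg q h) := by
  simp only [slotMean, integral_slotAvg hh]
  set a : ℕ → ℝ := fun N => ∫ v, h N v ∂gaussN N
  change ∑ N ∈ Finset.range (k + 1 + 1), slotWeight q (k + 1) N * a N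
    = ∑ N ∈ Finset.range (k + 1), slotWeight q k N * ((1 - q) * a N + q * a (N + 1))
  rw [Finset.sum_range_succ']
  have e : ∑ N ∈ Finset.range (k + 1), slotWeight q k (N + 1) * a (N + 1) + slotWeight q k 0 * a 0
      = ∑ N ∈ Finset.range (k + 1), slotWeight q k N * a N := by
    rw [← Finset.sum_range_succ' (fun N => slotWeight q k N * a N) (k + 1), Finset.sum_range_succ,
      slotWeight_of_lt (Nat.lt_succ_self k), zero_mul, add_zero]
  simp only [slotWeight_succ_succ, slotWeight_succ_zero, mul_add, add_mul,
    Finset.sum_add_distrib] at e ⊢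
  have e' := congrArg (fun x => (1 - q) * x) e
  simp only [mul_add, Finset.mul_sum] at e'
  have r1 : ∑ N ∈ Finset.range (k + 1), (1 - q) * slotWeight q k (N + 1) * a (N + 1)
      = ∑ N ∈ Finset.range (k + 1), (1 - q) * (slotWeight q k (N + 1) * a (N + 1)) :=
    Finset.sum_congr rfl fun _ _ => by ring
  have r2 : ∑ N ∈ Finset.range (k + 1), q * slotWeight q k N * a (N + 1)
      = ∑ N ∈ Finset.range (k + 1), slotWeight q k N * (q * a (N + 1)) :=
    Finset.sum_congr rfl fun _ _ => by ring
  have r3 : ∑ N ∈ Finset.range (k + 1), slotWeight q k N * ((1 - q) * a N)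
      = ∑ N ∈ Finset.range (k + 1), (1 - q) * (slotWeight q k N * a N) :=
    Finset.sum_congr rfl fun _ _ => by ring
  rw [r1, r2, r3, ← e']
  ring

theorem slotMean_zero (q : ℝ) (h : FunSeq) : slotMean q 0 h = h 0 default := by
  simp only [slotMean, zero_add, Finset.range_one, Finset.sum_singleton]
  have : ∫ v, h 0 v ∂gaussN 0 = h 0 default := by
    have e : ∀ v : Fin 0 → ℝ, h 0 v = h 0 default := fun v => by rw [Subsingleton.elim v default]
    simp only [e]; simp
  rw [this]; simp [slotWeight]

theorem slotMean_mono {q : ℝ} (h0 : 0 ≤ q) (h1 : q ≤ 1) {k : ℕ} {f g : FunSeq} (hf : IsBddMeas f)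
    (hg : IsBddMeas g) (h : ∀ N, N ≤ k → ∀ v, f N v ≤ g N v) : slotMean q k f ≤ slotMean q k g := by
  refine Finset.sum_le_sum fun N hN => ?_
  exact mul_le_mul_of_nonneg_left (integral_mono (hf.integrable N) (hg.integrable N)
    (h N (Finset.mem_range_succ_iff.1 hN))) (slotWeight_nonneg h0 h1 k N)

theorem IsBddMeas.add {f g : FunSeq} (hf : IsBddMeas f) (hg : IsBddMeas g) :
    IsBddMeas fun N v => f N v + g N v :=
  let ⟨C, hC⟩ := hf.bdd
  let ⟨D, hD⟩ := hg.bdd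
  ⟨fun N => (hf.meas N).add (hg.meas N), C + D, fun N v =>
    (abs_add_le _ _).trans (add_le_add (hC N v) (hD N v))⟩

theorem IsBddMeas.const_mul (c : ℝ) {f : FunSeq} (hf : IsBddMeas f) :
    IsBddMeas fun N v => c * f N v :=
  let ⟨C, hC⟩ := hf.bdd
  ⟨fun N => (hf.meas N).const_mul c, |c| * C, fun N v => by
    rw [abs_mul]; exact mul_le_mul_of_nonneg_left (hC N v) (abs_nonneg c)⟩

theorem slotMean_add {q : ℝ} {k : ℕ} {f g : FunSeq} (hf : IsBddMeas f) (hg : IsBddMeas g) :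
    slotMean q k (fun N v => f N v + g N v) = slotMean q k f + slotMean q k g := by
  simp only [slotMean]
  rw [← Finset.sum_add_distrib]
  refine Finset.sum_congr rfl fun N _ => ?_
  rw [integral_add (hf.integrable N) (hg.integrable N), mul_add]

theorem slotMean_const_mul {q : ℝ} {k : ℕ} (c : ℝ) (f : FunSeq) :
    slotMean q k (fun N v => c * f N v) = c * slotMean q k f := by
  simp only [slotMean, Finset.mul_sum, integral_const_mul]
  exact Finset.sum_congr rfl fun N _ => by ring

/-- The relative densities considered: bounded measurable symmetric functions with values in
`[0, C]`. -/
structure IsDensity (C : ℝ) (h : FunSeq) : Prop where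
  meas : ∀ N, Measurable (h N)
  symm : ∀ (N : ℕ) (σ : Equiv.Perm (Fin N)) (v : Fin N → ℝ), h N (v ∘ σ) = h N v
  nonneg : ∀ N v, 0 ≤ h N v
  le : ∀ N v, h N v ≤ C

variable {C q : ℝ} {h : FunSeq}

theorem IsDensity.isBddMeas (hh : IsDensity C h) : IsBddMeas h :=
  ⟨hh.meas, C, fun N v => by rw [abs_of_nonneg (hh.nonneg N v)]; exact hh.le N v⟩

/-- The sequence `h log h`. -/
def mulLog (h : FunSeq) : FunSeq := fun N v => h N v * Real.log (h N v)

theorem IsDensity.bddMulLog (hh : IsDensity C h) : IsBddMeas (mulLog h) := by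
  obtain ⟨K, hK⟩ := exists_bound_mul_log C
  exact ⟨fun N => Real.continuous_mul_log.measurable.comp (hh.meas N), K, fun N v =>
    hK _ (hh.nonneg N v) (hh.le N v)⟩

theorem cons_comp_perm {N : ℕ} (σ : Equiv.Perm (Fin N)) (w : ℝ) (v : Fin N → ℝ) :
    (Fin.cons w (v ∘ σ) : Fin (N + 1) → ℝ)
      = (Fin.cons w v : Fin (N + 1) → ℝ) ∘ (Equiv.Perm.decomposeFin.symm (0, σ)) := by
  ext i
  refine Fin.cases ?_ (fun j => ?_) i
  · simp
  · simp

theorem IsDensity.avg (h0 : 0 ≤ q) (h1 : q ≤ 1) (hh : IsDensity C h) :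
    IsDensity C (slotAvg q h) := by
  have hI : ∀ N v, 0 ≤ ∫ w, h (N + 1) (Fin.cons w v) ∂gauss
      ∧ ∫ w, h (N + 1) (Fin.cons w v) ∂gauss ≤ C := fun N v =>
    integral_mem_Icc ((hh.meas (N + 1)).comp (measurable_cons.comp measurable_prodMk_right))
      (fun _ => hh.nonneg _ _) (fun _ => hh.le _ _)
  refine ⟨hh.isBddMeas.avg.meas, fun N σ v => ?_, fun N v => ?_, fun N v => ?_⟩
  · simp only [slotAvg, hh.symm N σ v, cons_comp_perm, hh.symm (N + 1)]
  · have := hh.nonneg N v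
    have := (hI N v).1
    have : 0 ≤ 1 - q := by linarith
    unfold slotAvg; positivity
  · have e1 := mul_le_mul_of_nonneg_left (hh.le N v) (show 0 ≤ 1 - q by linarith)
    have e2 := mul_le_mul_of_nonneg_left (hI N v).2 h0
    unfold slotAvg; linarith

/-- The law of the state of one slot: occupied with probability `q`, and with a Maxwellian
velocity. -/
def slotLaw (q : ℝ) : Measure (Bool × ℝ) :=
  -- An empty slot also carries a velocity, which `addSlot` ignores; this makes the state space of a
  -- slot a plain product.
  ENNReal.ofReal (1 - q) • gauss.map (Prod.mk false) + ENNReal.ofReal q • gauss.map (Prod.mk true)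

theorem isProbabilityMeasure_slotLaw (h0 : 0 ≤ q) (h1 : q ≤ 1) :
    IsProbabilityMeasure (slotLaw q) := by
  constructor
  have e : ∀ b : Bool, gauss.map (Prod.mk b) univ = 1 := fun b => by
    rw [Measure.map_apply measurable_prodMk_left MeasurableSet.univ, preimage_univ, measure_univ]
  rw [slotLaw, Measure.add_apply, Measure.smul_apply, Measure.smul_apply, e, e, smul_eq_mul,
    smul_eq_mul, mul_one, mul_one, ← ENNReal.ofReal_add (by linarith) h0]
  simp

theorem integral_slotLaw (h0 : 0 ≤ q) (h1 : q ≤ 1) {f : Bool × ℝ → ℝ} (hf : Measurable f) {K : ℝ}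
    (hK : ∀ x, |f x| ≤ K) : ∫ x, f x ∂slotLaw q
      = (1 - q) * (∫ w, f (false, w) ∂gauss) + q * ∫ w, f (true, w) ∂gauss := by
  have hi : ∀ b, Integrable f (gauss.map (Prod.mk b)) := fun b =>
    integrable_of_abs_le hf hK
  rw [slotLaw, integral_add_measure ((hi _).smul_measure ENNReal.ofReal_ne_top)
    ((hi _).smul_measure ENNReal.ofReal_ne_top), integral_smul_measure, integral_smul_measure,
    integral_map measurable_prodMk_left.aemeasurable hf.aestronglyMeasurable,
    integral_map measurable_prodMk_left.aemeasurable hf.aestronglyMeasurable,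
    ENNReal.toReal_ofReal (by linarith), ENNReal.toReal_ofReal h0]
  rfl

/-- The value of `h` after one more slot is taken into account. -/
def addSlot (h : FunSeq) (N : ℕ) (v : Fin N → ℝ) (x : Bool × ℝ) : ℝ :=
  if x.1 = true then h (N + 1) (Fin.cons x.2 v) else h N v

theorem measurableSet_occupied {X : Type*} [MeasurableSpace X] {f : X → Bool × ℝ}
    (hf : Measurable f) : MeasurableSet {x | (f x).1 = true} :=
  (measurable_fst.comp hf) (MeasurableSet.of_discrete (s := {true}))

theorem IsBddMeas.integral_addSlot (h0 : 0 ≤ q) (h1 : q ≤ 1) (hh : IsBddMeas h) (N : ℕ)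
    (v : Fin N → ℝ) : ∫ x, addSlot h N v x ∂slotLaw q = slotAvg q h N v := by
  obtain ⟨C, hC⟩ := hh.bdd
  rw [integral_slotLaw h0 h1 (K := C)]
  · simp [addSlot, slotAvg]
  · exact Measurable.ite (measurableSet_occupied measurable_id)
      ((hh.meas _).comp (measurable_cons.comp (measurable_snd.prodMk measurable_const)))
      measurable_const
  · intro x
    unfold addSlot
    split_ifs <;> exact hC _ _

/-- The value of `h` after two more slots are taken into account. -/
def addTwoSlots (h : FunSeq) (N : ℕ) (v : Fin N → ℝ) (x y : Bool × ℝ) : ℝ :=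
  if x.1 = true then addSlot h (N + 1) (Fin.cons x.2 v) y else addSlot h N v y

theorem integral_addTwoSlots (h0 : 0 ≤ q) (h1 : q ≤ 1) (hh : IsBddMeas h) (N : ℕ)
    (v : Fin N → ℝ) (x : Bool × ℝ) :
    ∫ y, addTwoSlots h N v x y ∂slotLaw q = addSlot (slotAvg q h) N v x := by
  unfold addTwoSlots
  conv_rhs => rw [addSlot]
  split_ifs
  · exact hh.integral_addSlot h0 h1 _ _
  · exact hh.integral_addSlot h0 h1 _ _

/-- Needed when both slots are occupied: exchanging them is a permutation of the particles, so a
symmetric density does not see it. -/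
theorem cons_cons_swap {N : ℕ} (a b : ℝ) (v : Fin N → ℝ) :
    (Fin.cons a (Fin.cons b v : Fin (N + 1) → ℝ) : Fin (N + 2) → ℝ)
      = (Fin.cons b (Fin.cons a v : Fin (N + 1) → ℝ) : Fin (N + 2) → ℝ) ∘ Equiv.swap 0 1 := by
  ext i
  refine Fin.cases ?_ (fun j => Fin.cases ?_ (fun l => ?_) j) i
  · simp
  · simp
  · rw [Function.comp_apply, Equiv.swap_apply_of_ne_of_ne]
    · simp
    · exact Fin.succ_ne_zero _
    · rw [← Fin.succ_zero_eq_one]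
      exact fun h => Fin.succ_ne_zero _ (Fin.succ_injective _ h)

/-- The mixed second difference of the entropy in two slots is nonnegative. -/
theorem IsDensity.second_difference (h0 : 0 ≤ q) (h1 : q ≤ 1) (hh : IsDensity C h) (N : ℕ)
    (v : Fin N → ℝ) :
    0 ≤ slotAvg q (slotAvg q (mulLog h)) N v
      - 2 * slotAvg q (mulLog (slotAvg q h)) N v
      + mulLog (slotAvg q (slotAvg q h)) N v := by
  have := isProbabilityMeasure_slotLaw h0 h1
  have hM := hh.avg h0 h1
  have hmeas : Measurable fun z : (Bool × ℝ) × (Bool × ℝ) => addTwoSlots h N v z.1 z.2 := by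
    have hc1 : Measurable fun z : (Bool × ℝ) × (Bool × ℝ) => (Fin.cons z.1.2 v : Fin (N + 1) → ℝ) :=
      measurable_cons.comp ((measurable_snd.comp measurable_fst).prodMk measurable_const)
    have hc2 : Measurable fun z : (Bool × ℝ) × (Bool × ℝ) => (Fin.cons z.2.2 v : Fin (N + 1) → ℝ) :=
      measurable_cons.comp ((measurable_snd.comp measurable_snd).prodMk measurable_const)
    have hc3 : Measurable fun z : (Bool × ℝ) × (Bool × ℝ) =>
        (Fin.cons z.2.2 (Fin.cons z.1.2 v : Fin (N + 1) → ℝ) : Fin (N + 2) → ℝ) :=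
      measurable_cons.comp ((measurable_snd.comp measurable_snd).prodMk hc1)
    refine Measurable.ite (measurableSet_occupied measurable_fst) ?_ ?_
    · exact Measurable.ite (measurableSet_occupied measurable_snd) ((hh.meas _).comp hc3)
        ((hh.meas _).comp hc1)
    · exact Measurable.ite (measurableSet_occupied measurable_snd) ((hh.meas _).comp hc2)
        measurable_const
  have hsymm : ∀ x y, addTwoSlots h N v x y = addTwoSlots h N v y x := by
    intro x y
    unfold addTwoSlots addSlot
    split_ifs
    · rw [cons_cons_swap, hh.symm]
    all_goals rfl
  have hlog : ∀ x y, addTwoSlots h N v x y * Real.log (addTwoSlots h N v x y)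
      = addTwoSlots (mulLog h) N v x y := by
    intro x y
    unfold addTwoSlots addSlot
    split_ifs <;> rfl
  have hlog1 : ∀ x, addSlot (slotAvg q h) N v x
        * Real.log (addSlot (slotAvg q h) N v x)
      = addSlot (mulLog (slotAvg q h)) N v x := by
    intro x
    unfold addSlot
    split_ifs <;> rfl
  -- The inner integral of `addTwoSlots h` is `addSlot (slotAvg q h)`, so the three terms of the
  -- two-variable inequality are the three nested averages.
  have key := two_variable_entropy (ν := slotLaw q) hmeas hsymm (C := C)
    (fun x y => by unfold addTwoSlots addSlot; split_ifs <;> exact hh.nonneg _ _)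
    (fun x y => by unfold addTwoSlots addSlot; split_ifs <;> exact hh.le _ _)
  simp only [hlog, integral_addTwoSlots h0 h1 hh.isBddMeas, integral_addTwoSlots h0 h1 hh.bddMulLog,
    hlog1, hh.bddMulLog.avg.integral_addSlot h0 h1, hM.isBddMeas.integral_addSlot h0 h1,
    hM.bddMulLog.integral_addSlot h0 h1] at key
  exact key

/-- The subadditivity of the entropy, for `k + 1` independent slots. -/
theorem IsDensity.slotMean_mulLog_slotAvg_le (h0 : 0 ≤ q) (h1 : q ≤ 1) (k : ℕ)
    (hh : IsDensity C h) :
    slotMean q (k + 1) (mulLog h)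
        - slotMean q (k + 1) h * Real.log (slotMean q (k + 1) h)
      ≤ ((k : ℝ) + 1) * (slotMean q (k + 1) (mulLog h)
        - slotMean q k (mulLog (slotAvg q h))) := by
  induction k generalizing h with
  | zero =>
    rw [slotMean_zero, slotMean_succ hh.isBddMeas, slotMean_zero]
    simp [mulLog]
  | succ k ih =>
    have hM := hh.avg h0 h1
    -- Write `e_j` for the entropy with `j` slots averaged out. The induction hypothesis for
    -- `slotAvg q h` bounds `e_1 - e_{k+2}` by `(k + 1) (e_1 - e_2)`, and `h3` says `e_1 - e_2 ≤ e_0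
    -- - e_1`.
    have h2 := ih hM
    rw [slotMean_succ hh.isBddMeas]
    have h3 : 0 ≤ slotMean q k (fun N v =>
        (slotAvg q (slotAvg q (mulLog h)) N v
        + (-2) * slotAvg q (mulLog (slotAvg q h)) N v)
        + mulLog (slotAvg q (slotAvg q h)) N v) := by
      refine Finset.sum_nonneg fun N _ => mul_nonneg (slotWeight_nonneg h0 h1 k N)
        (integral_nonneg fun v => ?_)
      have := hh.second_difference h0 h1 N v
      simp only [Pi.zero_apply]
      linarith
    rw [slotMean_add (hh.bddMulLog.avg.avg.add (hM.bddMulLog.avg.const_mul _))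
      (hM.avg h0 h1).bddMulLog, slotMean_add hh.bddMulLog.avg.avg
      (hM.bddMulLog.avg.const_mul _), slotMean_const_mul, ← slotMean_succ hh.bddMulLog.avg,
      ← slotMean_succ hh.bddMulLog, ← slotMean_succ hM.bddMulLog] at h3
    push_cast
    nlinarith
end KacReservoir
end

/-! ### One Euler step of the slot dynamics and its entropy decay -/

noncomputable section

namespace KacReservoir

variable {C q : ℝ} {h : FunSeq}

/-- The sum over all pairs of the collision averages. -/
def pairSum (h : FunSeq) : FunSeq := fun N v =>
  ∑ i : Fin N, ∑ j ∈ Finset.Ioi i, collide i j (h N) v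

/-- The average over the `k` slots of a function of the configuration in the other slots. -/
def slotMix (k : ℕ) (g : FunSeq) : FunSeq
  | 0 => g 0
  -- A uniformly chosen slot is empty with probability `1 - (n + 1) / k`, and then the other slots
  -- hold all particles; with probability `1 / k` it holds particle `i`, which is deleted.
  | n + 1 => fun v => if n + 1 ≤ k then (1 - ((n : ℝ) + 1) / k) * g (n + 1) v
      + 1 / k * ∑ i : Fin (n + 1), g n (fun j => v (i.succAbove j)) else 0

/-- A convex combination of `h` and its collision averages. -/
def collAvg (τ : ℝ) (k : ℕ) (h : FunSeq) : FunSeq := fun N v =>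
  if N ≤ k then (1 - τ * pairs N) * h N v + τ * pairSum h N v else h N v

/-- One step of the explicit Euler scheme for the relative density. -/
def slotStep (ρ lam q : ℝ) (k : ℕ) (s : ℝ) (h : FunSeq) : FunSeq := fun N v =>
  -- Refreshing and collisions are separated as an average of two Euler steps of doubled length, so
  -- that each is a convex combination by itself.
  1 / 2 * ((1 - 2 * s * (ρ * k)) * h N v + 2 * s * (ρ * k) * slotMix k (slotAvg q h) N v)
    + 1 / 2 * collAvg (2 * s * lam) k h N v

section Permutations

theorem exists_perm_removeNth {n : ℕ} (σ : Equiv.Perm (Fin (n + 1))) (i : Fin (n + 1)) :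
    ∃ τ : Equiv.Perm (Fin n), ∀ j, σ (i.succAbove j) = (σ i).succAbove (τ j) := by
  refine ⟨(finSuccAboveEquiv i).trans ((σ.subtypeEquiv (p := (· ≠ i)) (q := (· ≠ σ i))
    fun a => by simp).trans (finSuccAboveEquiv (σ i)).symm), fun j => ?_⟩
  have := (finSuccAboveEquiv (σ i)).apply_symm_apply
    ⟨σ (i.succAbove j), by simp [Fin.succAbove_ne]⟩
  have h2 := congrArg Subtype.val this
  exact h2.symm

theorem rotate_comp_perm {n : ℕ} (σ : Equiv.Perm (Fin n)) (i j : Fin n) (θ : ℝ) (v : Fin n → ℝ) :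
    rotate i j θ (v ∘ σ) = rotate (σ i) (σ j) θ v ∘ σ := by
  ext k
  simp only [rotate, Function.comp_apply, EmbeddingLike.apply_eq_iff_eq]

theorem rotate_swap {n : ℕ} {i j : Fin n} (hij : i ≠ j) (θ : ℝ) (v : Fin n → ℝ) :
    rotate j i θ v = rotate i j (-θ) v := by
  ext k
  simp only [rotate, Real.cos_neg, Real.sin_neg]
  by_cases h1 : k = i
  · subst h1
    simp only [if_true, if_neg hij]; ring
  · by_cases h2 : k = j
    · subst h2
      simp only [if_true, if_neg hij.symm]; ring
    · simp only [if_neg h1, if_neg h2]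

/-- Exchanging the two particles reverses the angle, and the average over a full period is
unchanged. -/
theorem collide_swap {n : ℕ} {i j : Fin n} (hij : i ≠ j) (f : (Fin n → ℝ) → ℝ) (v : Fin n → ℝ) :
    collide j i f v = collide i j f v := by
  unfold collide
  congr 1
  simp only [rotate_swap hij]
  rw [intervalIntegral.integral_comp_neg (fun θ => f (rotate i j θ v)), neg_zero]
  have hp : Function.Periodic (fun θ => f (rotate i j θ v)) (2 * Real.pi) := by
    intro θ
    have e : rotate i j (θ + 2 * Real.pi) v = rotate i j θ v := by
      ext k
      simp only [rotate, Real.cos_add_two_pi, Real.sin_add_two_pi]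
    exact congrArg f e
  have := hp.intervalIntegral_add_eq (-(2 * Real.pi)) 0
  simpa using this

/-- A permutation does not preserve the order `i < j`; on the sum over all off-diagonal pairs it
acts by reindexing. -/
theorem sum_Ioi_eq {n : ℕ} {c : Fin n → Fin n → ℝ} (hc : ∀ i j, i ≠ j → c i j = c j i) :
    2 * ∑ i : Fin n, ∑ j ∈ Finset.Ioi i, c i j
      = ∑ i : Fin n, ∑ j : Fin n, if i ≠ j then c i j else 0 := by
  have h1 : ∑ i : Fin n, ∑ j ∈ Finset.Ioi i, c i j
      = ∑ i : Fin n, ∑ j : Fin n, if i < j then c i j else 0 := by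
    refine Finset.sum_congr rfl fun i _ => ?_
    rw [← Finset.sum_filter]
    refine Finset.sum_congr ?_ fun _ _ => rfl
    ext j; simp
  have h2 : ∑ i : Fin n, ∑ j : Fin n, (if i < j then c i j else 0)
      = ∑ i : Fin n, ∑ j : Fin n, if j < i then c i j else 0 := by
    rw [Finset.sum_comm]
    refine Finset.sum_congr rfl fun i _ => Finset.sum_congr rfl fun j _ => ?_
    split_ifs with h
    · exact hc _ _ h.ne
    · rfl
  rw [two_mul]
  nth_rewrite 2 [h1]
  rw [h2, h1, ← Finset.sum_add_distrib]
  refine Finset.sum_congr rfl fun i _ => ?_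
  rw [← Finset.sum_add_distrib]
  refine Finset.sum_congr rfl fun j _ => ?_
  rcases lt_trichotomy i j with h | h | h
  · simp [h, h.ne, h.not_gt]
  · simp [h]
  · simp [h, h.ne', h.not_gt]

theorem IsDensity.pairSum_comp_perm (hh : IsDensity C h) (N : ℕ) (σ : Equiv.Perm (Fin N))
    (v : Fin N → ℝ) : pairSum h N (v ∘ σ) = pairSum h N v := by
  have e : ∀ i j, collide i j (h N) (v ∘ σ) = collide (σ i) (σ j) (h N) v := fun i j => by
    unfold collide
    simp only [rotate_comp_perm, hh.symm]
  have h1 := sum_Ioi_eq (c := fun i j => collide i j (h N) v)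
    fun i j hij => (collide_swap hij _ _).symm
  have h2 := sum_Ioi_eq (c := fun i j => collide (σ i) (σ j) (h N) v)
    fun i j hij => (collide_swap (σ.injective.ne hij) _ _).symm
  have h3 : ∑ i : Fin N, ∑ j : Fin N, (if i ≠ j then collide (σ i) (σ j) (h N) v else 0)
      = ∑ i : Fin N, ∑ j : Fin N, if i ≠ j then collide i j (h N) v else 0 := by
    rw [← Equiv.sum_comp σ (fun i => ∑ j : Fin N, if i ≠ j then collide i j (h N) v else 0)]
    refine Finset.sum_congr rfl fun i _ => ?_
    rw [← Equiv.sum_comp σ (fun j => if σ i ≠ j then collide (σ i) j (h N) v else 0)]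
    simp
  unfold pairSum
  simp only [e]
  linarith

end Permutations

section Collisions

variable {N : ℕ} {f : (Fin N → ℝ) → ℝ}

theorem measurable_collide (hf : Measurable f) (i j : Fin N) : Measurable (collide i j f) := by
  have e : collide i j f = fun v => ∫ θ, f (rotate i j θ v) ∂angleMeasure := by
    ext v; exact collide_eq i j f v
  rw [e]
  have : Measurable fun z : (Fin N → ℝ) × ℝ => f (rotate i j z.2 z.1) :=
    hf.comp ((continuous_rotate i j).measurable.comp measurable_swap)
  exact (this.stronglyMeasurable.integral_prod_right (ν := angleMeasure)).measurable

theorem measurable_rotate_angle (hf : Measurable f) (i j : Fin N) (v : Fin N → ℝ) :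
    Measurable fun θ => f (rotate i j θ v) :=
  hf.comp ((continuous_rotate i j).measurable.comp measurable_prodMk_right)

theorem collide_mem_Icc (hf : Measurable f) {a b : ℝ} (ha : ∀ v, a ≤ f v) (hb : ∀ v, f v ≤ b)
    (i j : Fin N) (v : Fin N → ℝ) : a ≤ collide i j f v ∧ collide i j f v ≤ b := by
  rw [collide_eq]
  exact integral_mem_Icc (measurable_rotate_angle hf i j v) (fun _ => ha _) fun _ => hb _

/-- The rotations preserve both Lebesgue measure and the Maxwellian. -/
theorem integral_collide {i j : Fin N} (hij : i ≠ j) (hf : Integrable f (gaussN N)) :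
    ∫ v, collide i j f v ∂gaussN N = ∫ v, f v ∂gaussN N := by
  have hint : Integrable (fun v => f v * maxwellian N v) := by
    rw [gaussN_eq, integrable_withDensity_iff_integrable_smul₀'
      (measurable_maxwellian N).ennreal_ofReal.aemeasurable (by simp)] at hf
    refine hf.congr (ae_of_all _ fun v => ?_)
    simp [ENNReal.toReal_ofReal (maxwellian_pos N v).le, mul_comm]
  rw [integral_gaussN, integral_gaussN]
  have e : ∀ v, collide i j f v * maxwellian N v
      = ∫ θ, f (rotate i j θ v) * maxwellian N (rotate i j θ v) ∂angleMeasure := fun v => by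
    simp only [maxwellian_rotate hij]
    rw [integral_mul_const, collide_eq]
  simp only [e]
  have hp := measurePreserving_rotate_prod (i := i) (j := j) volume (measurePreserving_rotate hij)
  have h1 := hp.integrable_comp_of_integrable hint
  refine (integral_prod_symm _ h1).symm.trans ?_
  have h2 := integral_map (μ := angleMeasure.prod volume) hp.measurable.aemeasurable
    (f := fun v => f v * maxwellian N v) (by rw [hp.map_eq]; exact hint.aestronglyMeasurable)
  rw [hp.map_eq] at h2
  exact h2.symm

theorem collide_mul_log_le (hf : Measurable f) (h0 : ∀ v, 0 ≤ f v) (hC : ∀ v, f v ≤ C)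
    (i j : Fin N) (v : Fin N → ℝ) :
    collide i j f v * Real.log (collide i j f v) ≤ collide i j (fun v => f v * Real.log (f v)) v := by
  obtain ⟨K, hK⟩ := exists_bound_mul_log C
  have hm := measurable_rotate_angle hf i j v
  rw [collide_eq, collide_eq]
  exact Real.convexOn_mul_log.map_integral_le Real.continuous_mul_log.continuousOn isClosed_Ici
    (ae_of_all _ fun θ => h0 _)
    (integrable_of_abs_le (C := C) hm fun θ => by rw [abs_of_nonneg (h0 _)]; exact hC _)
    (integrable_of_abs_le (C := K) (Real.continuous_mul_log.measurable.comp hm) fun θ =>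
      hK _ (h0 _) (hC _))

end Collisions

theorem IsBddMeas.slotMix_bdd {g : FunSeq} (hg : IsBddMeas g) (k : ℕ) :
    IsBddMeas (slotMix k g) := by
  obtain ⟨C, hC⟩ := hg.bdd
  have hC0 : 0 ≤ C := (abs_nonneg _).trans (hC 0 default)
  refine ⟨fun N => ?_, 2 * C, fun N v => ?_⟩
  · cases N with
    | zero => exact hg.meas 0
    | succ n =>
      by_cases hn : n + 1 ≤ k
      · simp only [slotMix, if_pos hn]
        refine ((hg.meas _).const_mul _).add (Measurable.const_mul
          (Finset.measurable_sum _ fun i _ => (hg.meas n).comp ?_) _)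
        fun_prop
      · simp only [slotMix, if_neg hn]; exact measurable_const
  · cases N with
    | zero => exact (hC 0 v).trans (by linarith)
    | succ n =>
      simp only [slotMix]
      split_ifs with hn
      · have hk : (0 : ℝ) < k := by exact_mod_cast (Nat.succ_pos n).trans_le hn
        have hn' : ((n : ℝ) + 1) / k ≤ 1 := by
          rw [div_le_one hk]; exact_mod_cast hn
        have hn0 : 0 ≤ ((n : ℝ) + 1) / k := by positivity
        have hsum : |∑ i : Fin (n + 1), g n (fun j => v (i.succAbove j))| ≤ ((n : ℝ) + 1) * C := by
          refine (Finset.abs_sum_le_sum_abs _ _).trans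
            ((Finset.sum_le_sum fun i _ => hC n _).trans ?_)
          simp
        refine (abs_add_le _ _).trans ?_
        rw [abs_mul, abs_mul, abs_of_nonneg (show 0 ≤ 1 - ((n : ℝ) + 1) / k by linarith),
          abs_of_nonneg (show 0 ≤ 1 / (k : ℝ) by positivity)]
        have e1 := mul_le_mul_of_nonneg_left (hC (n + 1) v)
          (show 0 ≤ 1 - ((n : ℝ) + 1) / k by linarith)
        have e2 := mul_le_mul_of_nonneg_left hsum (show 0 ≤ 1 / (k : ℝ) by positivity)
        have e3 : 1 / (k : ℝ) * (((n : ℝ) + 1) * C) = ((n : ℝ) + 1) / k * C := by ring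
        nlinarith
      · rw [abs_zero]; linarith

/-- The value of `slotMix` is a convex combination. -/
theorem slotMix_succ_eq {k n : ℕ} (hn : n + 1 ≤ k) (g : FunSeq) (v : Fin (n + 1) → ℝ) :
    slotMix k g (n + 1) v = ∑ o : Option (Fin (n + 1)),
      (o.elim (1 - ((n : ℝ) + 1) / k) fun _ => 1 / (k : ℝ))
        * (o.elim (g (n + 1) v) fun i => g n (fun j => v (i.succAbove j))) := by
  simp only [slotMix, if_pos hn]
  simp [Fintype.sum_option, Finset.mul_sum]

theorem slotMix_weights {k n : ℕ} (hn : n + 1 ≤ k) :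
    (∀ o : Option (Fin (n + 1)), 0 ≤ (o.elim (1 - ((n : ℝ) + 1) / k) fun _ => 1 / (k : ℝ))) ∧
      ∑ o : Option (Fin (n + 1)), (o.elim (1 - ((n : ℝ) + 1) / k) fun _ => 1 / (k : ℝ)) = 1 := by
  have hk : (0 : ℝ) < k := by exact_mod_cast (Nat.succ_pos n).trans_le hn
  have hn' : ((n : ℝ) + 1) / k ≤ 1 := by
    rw [div_le_one hk]; exact_mod_cast hn
  constructor
  · rintro (_ | i)
    · simp only [Option.elim]; linarith
    · simp only [Option.elim]; positivity
  · simp [Fintype.sum_option]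
    field_simp
    ring

theorem IsDensity.slotMix {g : FunSeq} (hg : IsDensity C g) (k : ℕ) : IsDensity C (slotMix k g) := by
  have hC0 : 0 ≤ C := (hg.nonneg 0 default).trans (hg.le 0 default)
  refine ⟨(hg.isBddMeas.slotMix_bdd k).meas, fun N σ v => ?_, fun N v => ?_, fun N v => ?_⟩
  · cases N with
    | zero => exact hg.symm 0 σ v
    | succ n =>
      simp only [KacReservoir.slotMix, hg.symm]
      split_ifs
      · congr 2
        rw [← Equiv.sum_comp σ fun i => g n (fun j => v (i.succAbove j))]
        refine Finset.sum_congr rfl fun i _ => ?_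
        obtain ⟨τ, hτ⟩ := exists_perm_removeNth σ i
        simp only [Function.comp_apply, hτ]
        exact hg.symm n τ (fun j => v ((σ i).succAbove j))
      · rfl
  · cases N with
    | zero => exact hg.nonneg 0 v
    | succ n =>
      by_cases hn : n + 1 ≤ k
      · rw [slotMix_succ_eq hn]
        refine Finset.sum_nonneg fun o _ => mul_nonneg ((slotMix_weights hn).1 o) ?_
        cases o <;> exact hg.nonneg _ _
      · simp only [KacReservoir.slotMix, if_neg hn, le_refl]
  · cases N with
    | zero => exact hg.le 0 v
    | succ n =>
      by_cases hn : n + 1 ≤ k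
      · rw [slotMix_succ_eq hn]
        refine (Finset.sum_le_sum fun o _ => mul_le_mul_of_nonneg_left (b := o.elim (g (n + 1) v)
          fun i => g n (fun j => v (i.succAbove j))) (c := C) ?_
          ((slotMix_weights hn).1 o)).trans ?_
        · cases o <;> exact hg.le _ _
        · rw [← Finset.sum_mul, (slotMix_weights hn).2, one_mul]
      · simpa only [KacReservoir.slotMix, if_neg hn] using hC0

/-- Jensen's inequality for the choice of the slot. -/
theorem IsDensity.mulLog_slotMix_le {g : FunSeq} (hg : IsDensity C g) (k N : ℕ) (hN : N ≤ k)
    (v : Fin N → ℝ) :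
    mulLog (KacReservoir.slotMix k g) N v ≤ KacReservoir.slotMix k (mulLog g) N v := by
  cases N with
  | zero => exact le_rfl
  | succ n =>
    simp only [mulLog]
    rw [slotMix_succ_eq hN, slotMix_succ_eq hN]
    refine (Real.convexOn_mul_log.map_sum_le (fun o _ => (slotMix_weights hN).1 o)
      (slotMix_weights hN).2 (fun o _ => ?_)).trans (le_of_eq ?_)
    · cases o <;> exact hg.nonneg _ _
    · refine Finset.sum_congr rfl fun o _ => ?_
      cases o <;> rfl

/-- Both sides are the probability that `N` of `k + 1` slots are occupied and a chosen one is empty.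
-/
theorem slotWeight_mul_sub {k N : ℕ} :
    slotWeight q (k + 1) N * (1 - (N : ℝ) / ((k : ℝ) + 1)) = (1 - q) * slotWeight q k N := by
  have hk : ((k : ℝ) + 1) ≠ 0 := by positivity
  rcases lt_trichotomy N (k + 1) with h | h | h
  · obtain ⟨d, rfl⟩ := Nat.exists_eq_add_of_le (Nat.lt_succ_iff.1 h)
    have h1 := Nat.choose_mul_succ_eq (N + d) N
    have h2 : ((N + d).choose N : ℝ) * ((N + d : ℕ) + 1) = ((N + d + 1).choose N : ℝ) * (d + 1) := by
      have e : N + d + 1 - N = d + 1 := by omega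
      rw [e] at h1
      exact_mod_cast h1
    have e1 : N + d + 1 - N = d + 1 := by omega
    have e2 : N + d - N = d := by omega
    simp only [slotWeight, e1, e2]
    push_cast at h2 hk ⊢
    have e3 : 1 - (N : ℝ) / (N + d + 1) = (d + 1) / (N + d + 1) := by field_simp; ring
    rw [e3, pow_succ]
    have e4 : ((N + d + 1).choose N : ℝ) * ((d + 1) / (N + d + 1)) = (N + d).choose N := by
      rw [mul_div_assoc', ← h2]; field_simp
    linear_combination (q ^ N * (1 - q) ^ d * (1 - q)) * e4
  · subst h
    rw [slotWeight_of_lt (Nat.lt_succ_self k)]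
    push_cast
    rw [div_self hk]; ring
  · rw [slotWeight_of_lt h, slotWeight_of_lt (by omega)]; ring

/-- The companion count, with the chosen slot occupied. -/
theorem slotWeight_succ_mul {k N : ℕ} :
    slotWeight q (k + 1) (N + 1) * (((N : ℝ) + 1) / ((k : ℝ) + 1)) = q * slotWeight q k N := by
  have hk : ((k : ℝ) + 1) ≠ 0 := by positivity
  have h1 := Nat.add_one_mul_choose_eq k N
  have h2 : ((k : ℝ) + 1) * (k.choose N : ℝ) = ((k + 1).choose (N + 1) : ℝ) * ((N : ℝ) + 1) := by
    exact_mod_cast h1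
  have e : k + 1 - (N + 1) = k - N := by omega
  simp only [slotWeight, e, pow_succ]
  have e4 : ((k + 1).choose (N + 1) : ℝ) * (((N : ℝ) + 1) / ((k : ℝ) + 1)) = k.choose N := by
    rw [mul_div_assoc', ← h2]; field_simp
  linear_combination (q ^ N * q * (1 - q) ^ (k - N)) * e4

/-- Deleting a random slot from `k + 1` independent ones leaves `k` independent ones. -/
theorem slotMean_slotMix {g : FunSeq} (hg : IsBddMeas g) (k : ℕ) :
    slotMean q (k + 1) (slotMix (k + 1) g) = slotMean q k g := by
  have hk : ((k : ℝ) + 1) ≠ 0 := by positivity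
  set a : ℕ → ℝ := fun N => ∫ v, g N v ∂gaussN N with ha
  have hint : ∀ n, n + 1 ≤ k + 1 → ∫ v, slotMix (k + 1) g (n + 1) v ∂gaussN (n + 1)
      = (1 - ((n + 1 : ℕ) : ℝ) / ((k : ℝ) + 1)) * a (n + 1) + ((n : ℝ) + 1) / ((k : ℝ) + 1) * a n := by
    intro n hn
    simp only [slotMix, if_pos hn]
    have hi : ∀ i : Fin (n + 1), Integrable (fun v : Fin (n + 1) → ℝ =>
        g n (fun j => v (i.succAbove j))) (gaussN (n + 1)) := fun i => by
      obtain ⟨C, hC⟩ := hg.bdd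
      exact integrable_of_abs_le ((hg.meas n).comp (by fun_prop)) fun v => hC n _
    rw [integral_add ((hg.integrable _).const_mul _)
      ((integrable_finsetSum _ fun i _ => hi i).const_mul _), integral_const_mul,
      integral_const_mul, integral_finsetSum _ fun i _ => hi i]
    simp only [integral_removeNth]
    rw [Finset.sum_const, Finset.card_univ, Fintype.card_fin, nsmul_eq_mul]
    push_cast
    simp only [ha]
    ring
  have hrhs : slotMean q k g = ∑ N ∈ Finset.range (k + 1), slotWeight q k N * a N := rfl
  rw [hrhs, slotMean, Finset.sum_range_succ']
  have e1 : ∑ N ∈ Finset.range (k + 1), slotWeight q (k + 1) (N + 1)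
        * ∫ v, slotMix (k + 1) g (N + 1) v ∂gaussN (N + 1)
      = ∑ N ∈ Finset.range (k + 1), ((1 - q) * slotWeight q k (N + 1) * a (N + 1)
        + q * slotWeight q k N * a N) := by
    refine Finset.sum_congr rfl fun n hn => ?_
    rw [hint n (Finset.mem_range.1 hn), mul_add, ← mul_assoc, ← mul_assoc, slotWeight_succ_mul,
      slotWeight_mul_sub]
  have e2 : slotWeight q (k + 1) 0 * ∫ v, slotMix (k + 1) g 0 v ∂gaussN 0
      = (1 - q) * slotWeight q k 0 * a 0 := by
    rw [slotWeight_succ_zero]; rfl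
  rw [e1, e2, Finset.sum_add_distrib, add_right_comm,
    ← Finset.sum_range_succ' (fun N => (1 - q) * slotWeight q k N * a N) (k + 1),
    Finset.sum_range_succ, slotWeight_of_lt (Nat.lt_succ_self k), mul_zero, zero_mul, add_zero,
    ← Finset.sum_add_distrib]
  exact Finset.sum_congr rfl fun n _ => by ring

theorem IsBddMeas.integrable_collide {g : FunSeq} (hg : IsBddMeas g) {N : ℕ} (i j : Fin N) :
    Integrable (collide i j (g N)) (gaussN N) := by
  obtain ⟨C, hC⟩ := hg.bdd
  refine integrable_of_abs_le (C := C) (measurable_collide (hg.meas N) i j) fun v => ?_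
  rw [abs_le]
  exact collide_mem_Icc (hg.meas N) (fun v => (abs_le.1 (hC N v)).1)
    (fun v => (abs_le.1 (hC N v)).2) i j v

theorem IsBddMeas.integral_pairSum {g : FunSeq} (hg : IsBddMeas g) (N : ℕ) :
    ∫ v, pairSum g N v ∂gaussN N = pairs N * ∫ v, g N v ∂gaussN N := by
  unfold pairSum
  rw [integral_finsetSum _ fun i _ => integrable_finsetSum _ fun j _ => hg.integrable_collide i j,
    pairs, Finset.sum_mul]
  refine Finset.sum_congr rfl fun i _ => ?_
  rw [integral_finsetSum _ fun j _ => hg.integrable_collide i j, Finset.sum_mul]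
  refine Finset.sum_congr rfl fun j hj => ?_
  rw [integral_collide (Finset.mem_Ioi.1 hj).ne (hg.integrable N), one_mul]

theorem IsBddMeas.integrable_pairSum {g : FunSeq} (hg : IsBddMeas g) (N : ℕ) :
    Integrable (pairSum g N) (gaussN N) :=
  integrable_finsetSum _ fun i _ => integrable_finsetSum _ fun j _ => hg.integrable_collide i j

theorem IsBddMeas.integral_collAvg {g : FunSeq} (hg : IsBddMeas g) (τ : ℝ) (k N : ℕ) :
    ∫ v, collAvg τ k g N v ∂gaussN N = ∫ v, g N v ∂gaussN N := by
  unfold collAvg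
  split_ifs
  · rw [integral_add ((hg.integrable N).const_mul _) ((hg.integrable_pairSum N).const_mul _),
      integral_const_mul, integral_const_mul, hg.integral_pairSum]
    ring
  · rfl

theorem IsBddMeas.slotMean_collAvg {g : FunSeq} (hg : IsBddMeas g) (τ : ℝ) (k : ℕ) :
    slotMean q k (collAvg τ k g) = slotMean q k g := by
  simp only [slotMean, hg.integral_collAvg]

theorem measurable_pairSum {g : FunSeq} (hg : ∀ N, Measurable (g N)) (N : ℕ) :
    Measurable (pairSum g N) :=
  Finset.measurable_sum _ fun i _ => Finset.measurable_sum _ fun j _ =>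
    measurable_collide (hg N) i j

theorem measurable_collAvg {g : FunSeq} (hg : ∀ N, Measurable (g N)) (τ : ℝ) (k N : ℕ) :
    Measurable (collAvg τ k g N) := by
  by_cases hN : N ≤ k
  · unfold collAvg
    simp only [if_pos hN]
    exact ((hg N).const_mul _).add ((measurable_pairSum hg N).const_mul _)
  · unfold collAvg
    simp only [if_neg hN]
    exact hg N

theorem pairSum_mem_Icc {g : FunSeq} (hg : ∀ N, Measurable (g N)) {a b : ℝ} {N : ℕ}
    (ha : ∀ v, a ≤ g N v) (hb : ∀ v, g N v ≤ b) (v : Fin N → ℝ) :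
    pairs N * a ≤ pairSum g N v ∧ pairSum g N v ≤ pairs N * b := by
  unfold pairs pairSum
  simp only [Finset.sum_mul, one_mul]
  exact ⟨Finset.sum_le_sum fun i _ => Finset.sum_le_sum fun j _ =>
      (collide_mem_Icc (hg N) ha hb i j v).1,
    Finset.sum_le_sum fun i _ => Finset.sum_le_sum fun j _ =>
      (collide_mem_Icc (hg N) ha hb i j v).2⟩

theorem mul_pairs_le {τ : ℝ} (h0 : 0 ≤ τ) {k N : ℕ} (h1 : τ * (k : ℝ) ^ 2 ≤ 1) (hN : N ≤ k) :
    τ * pairs N ≤ 1 := by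
  refine le_trans ?_ h1
  refine mul_le_mul_of_nonneg_left ((pairs_le N).trans ?_) h0
  gcongr

theorem collAvg_mem_Icc {g : FunSeq} (hg : ∀ N, Measurable (g N)) {a b τ : ℝ} {k N : ℕ}
    (h0 : 0 ≤ τ) (h1 : τ * (k : ℝ) ^ 2 ≤ 1) (ha : ∀ v, a ≤ g N v) (hb : ∀ v, g N v ≤ b)
    (v : Fin N → ℝ) : a ≤ collAvg τ k g N v ∧ collAvg τ k g N v ≤ b := by
  unfold collAvg
  split_ifs with hN
  · have e := mul_pairs_le h0 h1 hN
    have e1 := pairSum_mem_Icc hg ha hb v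
    have e2 := mul_le_mul_of_nonneg_left e1.1 h0
    have e3 := mul_le_mul_of_nonneg_left e1.2 h0
    have e4 := mul_le_mul_of_nonneg_left (ha v) (show 0 ≤ 1 - τ * pairs N by linarith)
    have e5 := mul_le_mul_of_nonneg_left (hb v) (show 0 ≤ 1 - τ * pairs N by linarith)
    constructor <;> nlinarith
  · exact ⟨ha v, hb v⟩

theorem IsDensity.collAvg (hh : IsDensity C h) {τ : ℝ} {k : ℕ} (h0 : 0 ≤ τ)
    (h1 : τ * (k : ℝ) ^ 2 ≤ 1) : IsDensity C (collAvg τ k h) := by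
  refine ⟨measurable_collAvg hh.meas τ k, fun N σ v => ?_, fun N v =>
    (collAvg_mem_Icc hh.meas h0 h1 (hh.nonneg N) (hh.le N) v).1, fun N v =>
    (collAvg_mem_Icc hh.meas h0 h1 (hh.nonneg N) (hh.le N) v).2⟩
  simp only [KacReservoir.collAvg, hh.symm, hh.pairSum_comp_perm]

theorem IsBddMeas.collAvg {g : FunSeq} (hg : IsBddMeas g) {τ : ℝ} {k : ℕ} (h0 : 0 ≤ τ)
    (h1 : τ * (k : ℝ) ^ 2 ≤ 1) : IsBddMeas (collAvg τ k g) := by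
  obtain ⟨C, hC⟩ := hg.bdd
  refine ⟨measurable_collAvg hg.meas τ k, C, fun N v => ?_⟩
  rw [abs_le]
  exact collAvg_mem_Icc hg.meas h0 h1 (fun v => (abs_le.1 (hC N v)).1)
    (fun v => (abs_le.1 (hC N v)).2) v

theorem mul_log_convex {x y a b : ℝ} (hx : 0 ≤ x) (hy : 0 ≤ y) (ha : 0 ≤ a) (hb : 0 ≤ b)
    (hab : a + b = 1) :
    (a * x + b * y) * Real.log (a * x + b * y)
      ≤ a * (x * Real.log x) + b * (y * Real.log y) :=
  Real.convexOn_mul_log.2 hx hy ha hb hab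

/-- Jensen three times: over the angle, over the pairs with the uniform weights `1 / pairs N`, and
between colliding and not colliding. -/
theorem IsDensity.mulLog_collAvg_le (hh : IsDensity C h) {τ : ℝ} {k : ℕ} (h0 : 0 ≤ τ)
    (h1 : τ * (k : ℝ) ^ 2 ≤ 1) (N : ℕ) (v : Fin N → ℝ) :
    mulLog (KacReservoir.collAvg τ k h) N v ≤ KacReservoir.collAvg τ k (mulLog h) N v := by
  unfold mulLog KacReservoir.collAvg
  split_ifs with hN
  · have e := mul_pairs_le h0 h1 hN
    have hP := pairs_nonneg N
    have hpos : 0 ≤ pairSum h N v := by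
      simpa using (pairSum_mem_Icc hh.meas (hh.nonneg N) (hh.le N) v).1
    have hpair : pairSum h N v * Real.log (pairSum h N v / pairs N)
        ≤ pairSum (mulLog h) N v := by
      -- Without pairs both pair sums vanish, and the quotient by `pairs N` has no meaning as an
      -- average.
      rcases hP.eq_or_lt with hz | hP0
      · have hp0 : pairSum h N v = 0 := by
          have := (pairSum_mem_Icc hh.meas (hh.nonneg N) (hh.le N) v).2
          rw [← hz, zero_mul] at this
          exact le_antisymm this hpos
        have hmul : pairSum (mulLog h) N v = 0 := by
          obtain ⟨K, hK⟩ := hh.bddMulLog.bdd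
          have := pairSum_mem_Icc hh.bddMulLog.meas (fun v => (abs_le.1 (hK N v)).1)
            (fun v => (abs_le.1 (hK N v)).2) v
          rw [← hz, zero_mul, zero_mul] at this
          exact le_antisymm this.2 this.1
        rw [hp0, hmul, zero_mul]
      · have hc := Real.convexOn_mul_log.map_sum_le
          (t := (Finset.univ : Finset (Fin N)).sigma fun i => Finset.Ioi i)
          (w := fun _ => (pairs N)⁻¹) (p := fun z => collide z.1 z.2 (h N) v)
          (fun _ _ => (inv_pos.2 hP0).le) (by
            rw [← inv_mul_cancel₀ hP0.ne']
            conv_rhs => rw [pairs, Finset.mul_sum]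
            rw [Finset.sum_sigma]
            refine Finset.sum_congr rfl fun i _ => ?_
            rw [Finset.mul_sum]
            exact Finset.sum_congr rfl fun _ _ => (mul_one _).symm)
          (fun z _ => (collide_mem_Icc (hh.meas N) (hh.nonneg N) (hh.le N) z.1 z.2 v).1)
        simp only [smul_eq_mul, Finset.sum_sigma, ← Finset.mul_sum] at hc
        have hc2 : (pairs N)⁻¹ * pairSum h N v * Real.log ((pairs N)⁻¹ * pairSum h N v)
            ≤ (pairs N)⁻¹ * pairSum (mulLog h) N v := by
          refine hc.trans ?_
          refine mul_le_mul_of_nonneg_left ?_ (inv_pos.2 hP0).le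
          exact Finset.sum_le_sum fun i _ => Finset.sum_le_sum fun j _ =>
            collide_mul_log_le (hh.meas N) (hh.nonneg N) (hh.le N) i j v
        rw [mul_assoc] at hc2
        have := le_of_mul_le_mul_left hc2 (inv_pos.2 hP0)
        rwa [inv_mul_eq_div] at this
    rcases hP.eq_or_lt with hz | hP0
    · have hp0 : pairSum h N v = 0 := by
        have := (pairSum_mem_Icc hh.meas (hh.nonneg N) (hh.le N) v).2
        rw [← hz, zero_mul] at this
        exact le_antisymm this hpos
      rw [hp0, zero_mul] at hpair
      rw [hp0, ← hz]
      simp only [mul_zero, sub_zero, one_mul, add_zero]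
      have := mul_nonneg h0 hpair
      change _ ≤ h N v * Real.log (h N v) + τ * pairSum (mulLog h) N v
      linarith
    · have hc := mul_log_convex (hh.nonneg N v) (div_nonneg hpos hP)
        (show 0 ≤ 1 - τ * pairs N by linarith) (mul_nonneg h0 hP) (by ring)
      have e1 : τ * pairs N * (pairSum h N v / pairs N) = τ * pairSum h N v := by field_simp
      have e2 : τ * pairs N * (pairSum h N v / pairs N * Real.log (pairSum h N v / pairs N))
          = τ * (pairSum h N v * Real.log (pairSum h N v / pairs N)) := by field_simp
      rw [e1, e2] at hc
      have := mul_le_mul_of_nonneg_left hpair h0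
      change _ ≤ (1 - τ * pairs N) * (h N v * Real.log (h N v)) + τ * pairSum (mulLog h) N v
      linarith
  · exact le_rfl

variable {ρ lam s : ℝ} {k : ℕ}

theorem IsDensity.convexComb {g : FunSeq} (hh : IsDensity C h) (hg : IsDensity C g) {a b : ℝ}
    (ha : 0 ≤ a) (hb : 0 ≤ b) (hab : a + b = 1) :
    IsDensity C fun N v => a * h N v + b * g N v := by
  refine ⟨fun N => ((hh.meas N).const_mul a).add ((hg.meas N).const_mul b), fun N σ v => ?_,
    fun N v => add_nonneg (mul_nonneg ha (hh.nonneg N v)) (mul_nonneg hb (hg.nonneg N v)),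
    fun N v => ?_⟩
  · simp only [hh.symm, hg.symm]
  · have e1 := mul_le_mul_of_nonneg_left (hh.le N v) ha
    have e2 := mul_le_mul_of_nonneg_left (hg.le N v) hb
    calc _ ≤ a * C + b * C := add_le_add e1 e2
      _ = C := by rw [← add_mul, hab, one_mul]

theorem IsDensity.slotStep (hh : IsDensity C h) (h0 : 0 ≤ q) (h1 : q ≤ 1) (hρ : 0 ≤ ρ)
    (hlam : 0 ≤ lam) (hs : 0 ≤ s) (hs1 : 2 * s * (ρ * k) ≤ 1)
    (hs2 : 2 * s * lam * (k : ℝ) ^ 2 ≤ 1) : IsDensity C (slotStep ρ lam q k s h) :=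
  ((hh.convexComb ((hh.avg h0 h1).slotMix k) (by linarith) (by positivity)
    (sub_add_cancel _ _)).convexComb (hh.collAvg (by positivity) hs2) (by norm_num) (by norm_num)
    (by norm_num))

theorem IsDensity.slotMean_slotStep (hh : IsDensity C h) (hk : 0 < k) (hlam : 0 ≤ lam) (hs : 0 ≤ s)
    (hs2 : 2 * s * lam * (k : ℝ) ^ 2 ≤ 1) :
    slotMean q k (KacReservoir.slotStep ρ lam q k s h) = slotMean q k h := by
  obtain ⟨m, rfl⟩ := Nat.exists_eq_succ_of_ne_zero hk.ne'
  have hb := hh.isBddMeas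
  have hmix := hb.avg (q := q).slotMix_bdd (m + 1)
  have hcoll := hb.collAvg (by positivity) hs2
  unfold KacReservoir.slotStep
  rw [slotMean_add (((hb.const_mul _).add (hmix.const_mul _)).const_mul _) (hcoll.const_mul _),
    slotMean_const_mul, slotMean_add (hb.const_mul _) (hmix.const_mul _), slotMean_const_mul,
    slotMean_const_mul, slotMean_const_mul, slotMean_slotMix hb.avg, ← slotMean_succ hb,
    hb.slotMean_collAvg]
  ring

/-- The entropy decays along the explicit Euler scheme. -/
theorem IsDensity.slotMean_mulLog_slotStep_le (hh : IsDensity C h) (h0 : 0 ≤ q) (h1 : q ≤ 1)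
    (hk : 0 < k) (hρ : 0 ≤ ρ) (hlam : 0 ≤ lam) (hs : 0 ≤ s) (hs1 : 2 * s * (ρ * k) ≤ 1)
    (hs2 : 2 * s * lam * (k : ℝ) ^ 2 ≤ 1) (hmass : slotMean q k h = 1) :
    slotMean q k (mulLog (KacReservoir.slotStep ρ lam q k s h))
      ≤ (1 - s * ρ) * slotMean q k (mulLog h) := by
  obtain ⟨m, rfl⟩ := Nat.exists_eq_succ_of_ne_zero hk.ne'
  have hM := hh.avg h0 h1
  have hmix := hM.slotMix (m + 1)
  have hcoll := hh.collAvg (τ := 2 * s * lam) (by positivity) hs2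
  have hstep := hh.slotStep h0 h1 hρ hlam hs hs1 hs2
  set σ := 2 * s * (ρ * ((m + 1 : ℕ) : ℝ)) with hσ
  have hσ0 : 0 ≤ σ := by positivity
  have hL := hh.bddMulLog
  have hLmix := hM.bddMulLog.slotMix_bdd (m + 1)
  have hLcoll := hL.collAvg (τ := 2 * s * lam) (by positivity) hs2
  have hle : slotMean q (m + 1) (mulLog (KacReservoir.slotStep ρ lam q (m + 1) s h))
      ≤ slotMean q (m + 1) (fun N v => 1 / 2 * ((1 - σ) * mulLog h N v
        + σ * KacReservoir.slotMix (m + 1) (mulLog (slotAvg q h)) N v)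
        + 1 / 2 * KacReservoir.collAvg (2 * s * lam) (m + 1) (mulLog h) N v) := by
    refine slotMean_mono h0 h1 hstep.bddMulLog
      ((((hL.const_mul _).add (hLmix.const_mul _)).const_mul _).add (hLcoll.const_mul _))
      fun N hN v => ?_
    have a1 := mul_log_convex (hh.nonneg N v) (hmix.nonneg N v) (show 0 ≤ 1 - σ by linarith) hσ0
      (sub_add_cancel _ _)
    have hx : 0 ≤ (1 - σ) * h N v + σ * KacReservoir.slotMix (m + 1) (slotAvg q h) N v :=
      add_nonneg (mul_nonneg (by linarith) (hh.nonneg N v)) (mul_nonneg hσ0 (hmix.nonneg N v))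
    have a2 := mul_log_convex hx (hcoll.nonneg N v) (show (0 : ℝ) ≤ 1 / 2 by norm_num)
      (show (0 : ℝ) ≤ 1 / 2 by norm_num) (by norm_num)
    have a3 := mul_le_mul_of_nonneg_left (hM.mulLog_slotMix_le (m + 1) N hN v) hσ0
    have a4 := hh.mulLog_collAvg_le (τ := 2 * s * lam) (by positivity) hs2 N v
    refine a2.trans ?_
    have a5 : (1 - σ) * (h N v * Real.log (h N v))
        + σ * (KacReservoir.slotMix (m + 1) (slotAvg q h) N v
          * Real.log (KacReservoir.slotMix (m + 1) (slotAvg q h) N v))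
        ≤ (1 - σ) * mulLog h N v
          + σ * KacReservoir.slotMix (m + 1) (mulLog (slotAvg q h)) N v := by
      change _ + σ * mulLog (KacReservoir.slotMix (m + 1) (slotAvg q h)) N v ≤ _
      change (1 - σ) * mulLog h N v + _ ≤ _
      linarith
    have a6 := a1.trans a5
    change _ + 1 / 2 * mulLog (KacReservoir.collAvg (2 * s * lam) (m + 1) h) N v ≤ _
    linarith
  refine hle.trans ?_
  rw [slotMean_add (((hL.const_mul _).add (hLmix.const_mul _)).const_mul _) (hLcoll.const_mul _),
    slotMean_const_mul, slotMean_add (hL.const_mul _) (hLmix.const_mul _), slotMean_const_mul,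
    slotMean_const_mul, slotMean_const_mul, slotMean_slotMix hM.bddMulLog, hL.slotMean_collAvg]
  -- With mass one, averaging out a slot removes at least `1 / (m + 1)` of the entropy. It enters
  -- with the weight `σ / 2 = s ρ (m + 1)`, so the factor `m + 1` cancels and `s ρ` remains.
  have key := hh.slotMean_mulLog_slotAvg_le h0 h1 m
  rw [hmass, Real.log_one, mul_zero, sub_zero] at key
  have := mul_le_mul_of_nonneg_left key (show 0 ≤ s * ρ by positivity)
  rw [hσ]
  push_cast
  nlinarith

end KacReservoir
end

/-! ### From states in `L¹` to densities relative to the slot equilibrium -/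

noncomputable section

namespace KacReservoir

variable {C q : ℝ} {h : FunSeq}

/-- The state whose density relative to the equilibrium of `k` slots is `h`. -/
def slotState (q : ℝ) (k : ℕ) (h : FunSeq) : FunSeq := fun N v =>
  slotWeight q k N * maxwellian N v * h N v

/-- Filling one of `k - n` empty slots balances emptying one of `n + 1` occupied ones. Reversibility
is what turns the evolution of states into averaging operators on relative densities. -/
theorem slotWeight_detailed_balance (q : ℝ) {k n : ℕ} (hn : n ≤ k) :
    slotWeight q k (n + 1) * ((n : ℝ) + 1) * (1 - q) = slotWeight q k n * ((k : ℝ) - n) * q := by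
  rcases hn.eq_or_lt with rfl | hlt
  · rw [slotWeight_of_lt (Nat.lt_succ_self n)]; ring
  · have h1 : (k.choose (n + 1) : ℝ) * ((n : ℝ) + 1) = k.choose n * ((k : ℝ) - n) := by
      rw [← Nat.cast_sub hn]
      exact_mod_cast Nat.choose_succ_right_eq k n
    obtain ⟨d, rfl⟩ := Nat.exists_eq_add_of_lt hlt
    have e1 : n + d + 1 - (n + 1) = d := by omega
    have e2 : n + d + 1 - n = d + 1 := by omega
    simp only [slotWeight, e1, e2, pow_succ]
    linear_combination (q ^ n * q * ((1 - q) ^ d * (1 - q))) * h1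

theorem insertNth_eq_cons_comp {N : ℕ} (i : Fin (N + 1)) (w : ℝ) (v : Fin N → ℝ) :
    ∃ σ : Equiv.Perm (Fin (N + 1)),
      i.insertNth (α := fun _ => ℝ) w v = (Fin.cons w v : Fin (N + 1) → ℝ) ∘ σ := by
  refine ⟨i.cycleRange, ?_⟩
  ext j
  refine Fin.succAboveCases i ?_ (fun l => ?_) j
  · simp
  · simp

theorem IsDensity.insertNth (hh : IsDensity C h) {N : ℕ} (i : Fin (N + 1)) (w : ℝ)
    (v : Fin N → ℝ) :
    h (N + 1) (i.insertNth (α := fun _ => ℝ) w v) = h (N + 1) (Fin.cons w v) := by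
  obtain ⟨σ, hσ⟩ := insertNth_eq_cons_comp i w v
  rw [hσ, hh.symm]

theorem IsDensity.integral_slotState_insertNth (hh : IsDensity C h) (k : ℕ) {N : ℕ}
    (i : Fin (N + 1)) (v : Fin N → ℝ) :
    ∫ w, slotState q k h (N + 1) (i.insertNth (α := fun _ => ℝ) w v)
      = slotWeight q k (N + 1) * maxwellian N v * ∫ w, h (N + 1) (Fin.cons w v) ∂gauss := by
  rw [integral_gauss, ← integral_const_mul]
  congr 1
  ext w
  rw [slotState, maxwellian_insertNth, hh.insertNth]
  ring

theorem inOp_slotState (k n : ℕ) (v : Fin (n + 1) → ℝ) :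
    inOp (slotState q k h) (n + 1) v = slotWeight q k n * maxwellian (n + 1) v / ((n : ℝ) + 1)
      * ∑ i : Fin (n + 1), h n (fun j => v (i.succAbove j)) := by
  have e : ∀ i : Fin (n + 1), Real.exp (-Real.pi * v i ^ 2)
        * slotState q k h n (fun j => v (i.succAbove j))
      = slotWeight q k n * maxwellian (n + 1) v * h n (fun j => v (i.succAbove j)) := fun i => by
    rw [maxwellian_succ i, slotState]; ring
  simp only [inOp, e, ← Finset.mul_sum]
  ring

theorem IsDensity.outOp_slotState (hh : IsDensity C h) (k N : ℕ) (v : Fin N → ℝ) :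
    outOp (slotState q k h) N v = slotWeight q k (N + 1) * ((N : ℝ) + 1) * maxwellian N v
      * ∫ w, h (N + 1) (Fin.cons w v) ∂gauss := by
  simp only [outOp, hh.integral_slotState_insertNth]
  rw [Finset.sum_const, Finset.card_univ, Fintype.card_fin, nsmul_eq_mul]
  push_cast
  ring

theorem IsDensity.resOp_slotState (hh : IsDensity C h) (k n : ℕ) (v : Fin (n + 1) → ℝ) :
    resOp (slotState q k h) (n + 1) v = slotWeight q k (n + 1) * maxwellian (n + 1) v
      * ∑ i : Fin (n + 1), ∫ w, h (n + 1) (Fin.cons w (fun j => v (i.succAbove j))) ∂gauss := by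
  simp only [resOp, hh.integral_slotState_insertNth]
  rw [Finset.mul_sum]
  refine Finset.sum_congr rfl fun i _ => ?_
  rw [maxwellian_succ i]
  ring

theorem collide_slotState (k N : ℕ) {i j : Fin N} (hij : i ≠ j) (v : Fin N → ℝ) :
    collide i j (slotState q k h N) v
      = slotWeight q k N * maxwellian N v * collide i j (h N) v := by
  simp only [collide, slotState, maxwellian_rotate hij]
  rw [intervalIntegral.integral_const_mul]
  ring

theorem sum_collide_slotState (k N : ℕ) (v : Fin N → ℝ) :
    ∑ i : Fin N, ∑ j ∈ Finset.Ioi i, collide i j (slotState q k h N) v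
      = slotWeight q k N * maxwellian N v * pairSum h N v := by
  rw [pairSum, Finset.mul_sum]
  refine Finset.sum_congr rfl fun i _ => ?_
  rw [Finset.mul_sum]
  exact Finset.sum_congr rfl fun j hj => collide_slotState k N (Finset.mem_Ioi.1 hj).ne v

variable {μ ρ lam s : ℝ}

/-- In terms of relative densities, the generator of the slot dynamics is given by `slotStep`. -/
theorem pointwise_slotState (hh : IsDensity C h) (hρ : 0 < ρ) {k : ℕ} (hk : 0 < k)
    (N : ℕ) (v : Fin N → ℝ) :
    slotState (μ / (ρ * k)) k h N v
        + s * (slotCoeffs μ ρ lam k 0).pointwise (slotState (μ / (ρ * k)) k h) N v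
      = slotState (μ / (ρ * k)) k (slotStep ρ lam (μ / (ρ * k)) k s h) N v := by
  have hk' : (0 : ℝ) < k := by exact_mod_cast hk
  -- Eliminating `μ` in favour of the occupation probability `q` leaves an identity in `q`, `ρ` and
  -- `k`.
  obtain ⟨q, hq⟩ : ∃ q, q = μ / (ρ * k) := ⟨_, rfl⟩
  rw [← hq]
  have hqμ : μ = ρ * k * q := by rw [hq]; field_simp
  by_cases hN : N ≤ k
  · have hdown : (slotCoeffs μ ρ lam k 0).down (N + 1) * outOp (slotState q k h) N v
        = ρ * (slotWeight q k N * ((k : ℝ) - N) * q) * maxwellian N v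
          * ∫ w, h (N + 1) (Fin.cons w v) ∂gauss := by
      rw [hh.outOp_slotState, ← slotWeight_detailed_balance q hN]
      simp only [slotCoeffs]
      split_ifs with h1
      · rw [← hq]; ring
      · rw [slotWeight_of_lt (not_le.1 h1)]; ring
    rw [Coeffs.pointwise, hdown, sum_collide_slotState]
    simp only [slotCoeffs, if_pos hN, ← hq, pow_zero, mul_one]
    cases N with
    | zero =>
      simp only [inOp, resOp, slotState, slotStep, collAvg, slotMix, slotAvg, if_pos hN,
        Nat.cast_zero]
      rw [hqμ]
      ring
    | succ n =>
      have hn : n ≤ k := by omega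
      have hb := slotWeight_detailed_balance q hn
      -- Detailed balance rewrites the inflow from `n` particles with the equilibrium weight of `n +
      -- 1` particles, as a common factor requires.
      have hb' : μ * (1 - n / k) * (slotWeight q k n * maxwellian (n + 1) v / ((n : ℝ) + 1))
          = ρ * (1 - q) * slotWeight q k (n + 1) * maxwellian (n + 1) v := by
        rw [hqμ]; field_simp; linear_combination (-maxwellian (n + 1) v) * hb
      rw [inOp_slotState, hh.resOp_slotState, Nat.add_sub_cancel, if_pos hn, ← mul_assoc, hb']
      simp only [slotState, slotStep, collAvg, slotMix, slotAvg, if_pos hN,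
        Finset.sum_add_distrib, ← Finset.mul_sum]
      generalize (∑ i : Fin (n + 1), h n fun j => v (i.succAbove j)) = X
      generalize (∑ i : Fin (n + 1),
        ∫ w, h (n + 1) (Fin.cons w fun j => v (i.succAbove j)) ∂gauss) = Y
      generalize (∫ w, h (n + 1 + 1) (Fin.cons w v) ∂gauss) = Z
      generalize slotWeight q k (n + 1) = b
      push_cast
      rw [hqμ]
      field_simp
      ring
  · have hN' := not_le.1 hN
    have hup : (slotCoeffs μ ρ lam k 0).up (N - 1) * inOp (slotState q k h) N v = 0 := by
      cases N with
      | zero => simp [inOp]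
      | succ n =>
        simp only [slotCoeffs, Nat.add_sub_cancel]
        split_ifs with h1
        · obtain rfl : n = k := by omega
          -- The only possible inflow beyond the cutoff is from `n = k`, where the rate has the
          -- factor `1 - k / k`.
          rw [div_self hk'.ne']; ring
        · ring
    have hN2 : ¬ N + 1 ≤ k := by omega
    rw [Coeffs.pointwise, hup]
    simp only [slotCoeffs, if_neg hN, if_neg hN2, slotState, slotWeight_of_lt hN']
    ring

/-- The components of an element of `⨁_N L¹(ℝᴺ)` are given by `slotState`. -/
def HasSlotDensity (q : ℝ) (k : ℕ) (g : L1) (h : FunSeq) : Prop :=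
  ∀ N, g N =ᵐ[volume] slotState q k h N

theorem coord_slotGen (k : ℕ) (g : L1) (N : ℕ) :
    coord N (slotGen μ ρ lam k 0 g) = (slotCoeffs μ ρ lam k 0).row N g := by
  have : coord N ∘L slotGen μ ρ lam k 0 = (slotCoeffs μ ρ lam k 0).row N :=
    lp_one_clm_ext fun M x => by
      rw [ContinuousLinearMap.comp_apply]
      exact (congrArg (coord N) (slotGen_incl k 0 M x)).trans (Coeffs.coord_column _ M N x)
  exact congrArg (fun A => A g) this

theorem HasSlotDensity.step {k : ℕ} {g : L1} (hg : HasSlotDensity (μ / (ρ * k)) k g h)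
    (hh : IsDensity C h) (hρ : 0 < ρ) (hk : 0 < k) :
    HasSlotDensity (μ / (ρ * k)) k ((1 + s • slotGen μ ρ lam k 0) g)
      (slotStep ρ lam (μ / (ρ * k)) k s h) := by
  intro N
  have h1 := Coeffs.row_ae (slotCoeffs μ ρ lam k 0) hg N
  have h2 : ((1 + s • slotGen μ ρ lam k 0) g : L1) N
      = g N + s • (slotCoeffs μ ρ lam k 0).row N g := by
    rw [← coord_slotGen]
    rfl
  rw [h2]
  filter_upwards [Lp.coeFn_add (g N) (s • (slotCoeffs μ ρ lam k 0).row N g),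
    Lp.coeFn_smul s ((slotCoeffs μ ρ lam k 0).row N g), h1, hg N] with v e1 e2 e3 e4
  rw [e1, Pi.add_apply, e2, Pi.smul_apply, e3, e4, smul_eq_mul]
  exact pointwise_slotState hh hρ hk N v

theorem integral_abs_slotState {k : ℕ} (h0 : 0 ≤ q) (h1 : q ≤ 1) (hh : IsDensity C h) (N : ℕ) :
    ∫ v, |slotState q k h N v| = slotWeight q k N * ∫ v, h N v ∂gaussN N := by
  rw [integral_gaussN, ← integral_const_mul]
  congr 1
  ext v
  rw [slotState, abs_of_nonneg (mul_nonneg (mul_nonneg (slotWeight_nonneg h0 h1 k N)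
    (maxwellian_pos N v).le) (hh.nonneg N v))]
  ring

theorem HasSlotDensity.norm_eq {k : ℕ} {g : L1} (hg : HasSlotDensity q k g h)
    (hh : IsDensity C h) (h0 : 0 ≤ q) (h1 : q ≤ 1) : ‖g‖ = slotMean q k h := by
  have e : ∀ N, ‖g N‖ = slotWeight q k N * ∫ v, h N v ∂gaussN N := fun N => by
    rw [← integral_abs_slotState h0 h1 hh, ← integral_abs_fn]
    exact integral_congr_ae ((hg N).fun_comp abs)
  rw [← (lp_one_hasSum_norm g).tsum_eq]
  simp only [e]
  rw [slotMean]
  refine tsum_eq_sum fun N hN => ?_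
  rw [slotWeight_of_lt (by simpa using hN), zero_mul]

/-- The Euler scheme for the slot dynamics preserves the relative densities and makes the entropy
decay. -/
theorem HasSlotDensity.exists_euler {k : ℕ} {g : L1} (hg : HasSlotDensity (μ / (ρ * k)) k g h)
    (hh : IsDensity C h) (hμ : 0 < μ) (hρ : 0 < ρ) (hlam : 0 ≤ lam) (hk : 0 < k)
    (hq : μ / (ρ * k) ≤ 1) (hs : 0 ≤ s) (hs1 : 2 * s * (ρ * k) ≤ 1)
    (hs2 : 2 * s * lam * (k : ℝ) ^ 2 ≤ 1) (hsρ : s * ρ ≤ 1)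
    (hmass : slotMean (μ / (ρ * k)) k h = 1) (n : ℕ) :
    ∃ h' : FunSeq, IsDensity C h' ∧
      HasSlotDensity (μ / (ρ * k)) k (((1 + s • slotGen μ ρ lam k 0) ^ n) g) h' ∧
      slotMean (μ / (ρ * k)) k h' = 1 ∧
      slotMean (μ / (ρ * k)) k (mulLog h')
        ≤ (1 - s * ρ) ^ n * slotMean (μ / (ρ * k)) k (mulLog h) := by
  have hq0 : 0 ≤ μ / (ρ * k) := by positivity
  induction n with
  | zero => exact ⟨h, hh, by simpa using hg, hmass, by simp⟩
  | succ n ih =>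
    obtain ⟨h', hh', hg', hm', he'⟩ := ih
    refine ⟨_, hh'.slotStep hq0 hq hρ.le hlam hs hs1 hs2, ?_,
      (hh'.slotMean_slotStep hk hlam hs hs2).trans hm', ?_⟩
    · rw [pow_succ', mul_apply_eq_comp]
      exact hg'.step hh' hρ hk
    · refine (hh'.slotMean_mulLog_slotStep_le hq0 hq hk hρ.le hlam hs hs1 hs2 hm').trans ?_
      rw [pow_succ', mul_assoc]
      exact mul_le_mul_of_nonneg_left he' (by linarith)

end KacReservoir
end

/-! ### Passage to the limit and lower semicontinuity of the entropy -/

noncomputable section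

namespace KacReservoir

/-- Summable distances make `∑ |x j - y|` integrable, hence finite almost everywhere; this is why
limits below are taken at the speed `(1 / 2) ^ j`, with no passage to subsequences. -/
theorem ae_tendsto_of_norm_sub_le {X : Type*} [MeasurableSpace X] {ν : Measure X}
    {x : ℕ → Lp ℝ 1 ν} {y : Lp ℝ 1 ν} (h : ∀ j, ‖x j - y‖ ≤ (1 / 2) ^ j) :
    ∀ᵐ v ∂ν, Tendsto (fun j => x j v) atTop (𝓝 (y v)) := by
  have hm : ∀ j, AEMeasurable (fun v => ‖x j v - y v‖ₑ) ν := fun j =>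
    ((Lp.aestronglyMeasurable (x j)).sub (Lp.aestronglyMeasurable y)).enorm
  have h1 : ∫⁻ v, ∑' j, ‖x j v - y v‖ₑ ∂ν ≠ ⊤ := by
    rw [lintegral_tsum hm]
    simp only [← L1.ofReal_norm_sub_eq_lintegral]
    have hs : Summable fun j : ℕ => ((1 : ℝ) / 2) ^ j :=
      summable_geometric_of_lt_one (by norm_num) (by norm_num)
    refine ne_top_of_le_ne_top (hs.tsum_ofReal_ne_top)
      (ENNReal.tsum_le_tsum fun j => ENNReal.ofReal_le_ofReal (h j))
  filter_upwards [ae_lt_top' (AEMeasurable.tsum hm) h1] with v hv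
  have h2 := ENNReal.tendsto_atTop_zero_of_tsum_ne_top hv.ne
  rw [tendsto_iff_edist_tendsto_0]
  simpa only [edist_eq_enorm_sub] using h2

theorem measurePreserving_comp_perm {N : ℕ} (σ : Equiv.Perm (Fin N)) :
    MeasurePreserving fun v : Fin N → ℝ => v ∘ σ := by
  have h := volume_measurePreserving_piCongrLeft (fun _ : Fin N => ℝ) σ.symm
  have e : (fun v : Fin N → ℝ => v ∘ σ)
      = MeasurableEquiv.piCongrLeft (fun _ : Fin N => ℝ) σ.symm := by
    ext v i
    rw [MeasurableEquiv.coe_piCongrLeft]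
    have h2 := Equiv.piCongrLeft_apply_apply (fun _ : Fin N => ℝ) σ.symm v (σ i)
    rw [Equiv.symm_apply_apply] at h2
    exact h2.symm
  rw [e]
  exact h

theorem maxwellian_comp_perm {N : ℕ} (σ : Equiv.Perm (Fin N)) (v : Fin N → ℝ) :
    maxwellian N (v ∘ σ) = maxwellian N v :=
  Equiv.prod_comp σ fun i => Real.exp (-Real.pi * v i ^ 2)

variable {μ ρ E : ℝ}

theorem poissonWeight_pos (hμ : 0 < μ) (hρ : 0 < ρ) (N : ℕ) : 0 < poissonWeight μ ρ N := by
  unfold poissonWeight; positivity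

theorem steadyState_pos (hμ : 0 < μ) (hρ : 0 < ρ) (N : ℕ) (v : Fin N → ℝ) :
    0 < steadyState μ ρ N v := mul_pos (poissonWeight_pos hμ hρ N) (maxwellian_pos N v)

theorem hasSum_poissonWeight (μ ρ : ℝ) : HasSum (poissonWeight μ ρ) 1 := by
  have h := (NormedSpace.expSeries_div_hasSum_exp (𝔸 := ℝ) (μ / ρ)).mul_right (Real.exp (-(μ / ρ)))
  rw [← Real.exp_eq_exp_ℝ, ← Real.exp_add, add_neg_cancel, Real.exp_zero] at h
  refine h.congr_fun ?_ |> fun h => h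
  intro N
  unfold poissonWeight
  ring

/-- The Poisson limit theorem: the mean number `k q` of occupied slots is `μ / ρ`. -/
theorem tendsto_slotWeight (hρ : 0 < ρ) {k : ℕ → ℕ} (hk : Tendsto k atTop atTop) (N : ℕ) :
    Tendsto (fun j => slotWeight (μ / (ρ * k j)) (k j) N) atTop (𝓝 (poissonWeight μ ρ N)) := by
  have hr : Tendsto (fun n : ℕ => (n : ℝ) * (μ / (ρ * n))) atTop (𝓝 (μ / ρ)) := by
    refine tendsto_const_nhds.congr' ?_
    filter_upwards [eventually_gt_atTop 0] with n hn
    have : (0 : ℝ) < n := by exact_mod_cast hn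
    field_simp
  have h := (ProbabilityTheory.tendsto_choose_mul_pow_of_tendsto_mul_atTop N hr).comp hk
  rw [mul_comm (Real.exp _)] at h
  exact h

theorem sum_slotWeight (q : ℝ) (k : ℕ) : ∑ N ∈ Finset.range (k + 1), slotWeight q k N = 1 := by
  have h := add_pow q (1 - q) k
  rw [add_sub_cancel, one_pow] at h
  rw [h]
  exact Finset.sum_congr rfl fun N _ => by rw [slotWeight]; ring

theorem integrable_maxwellian (N : ℕ) : Integrable (maxwellian N) := by
  have := (integrable_const (μ := gaussN N) (1 : ℝ))
  rw [gaussN_eq, integrable_withDensity_iff_integrable_smul₀'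
    (measurable_maxwellian N).ennreal_ofReal.aemeasurable (by simp)] at this
  refine this.congr (ae_of_all _ fun v => ?_)
  simp [ENNReal.toReal_ofReal (maxwellian_pos N v).le]

theorem integral_maxwellian (N : ℕ) : ∫ v, maxwellian N v = 1 := by
  have := integral_gaussN N fun _ => 1
  simpa using this.symm

/-- The state `U` is the limit of states of the slot systems, whose entropies are asymptotically
bounded by `E`. -/
structure IsSlotLimit (μ ρ E : ℝ) (U : L1) (k : ℕ → ℕ) (g : ℕ → L1) (h : ℕ → FunSeq) (C : ℕ → ℝ) :
    Prop where
  tendsto : Tendsto k atTop atTop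
  pos : ∀ j, 0 < k j
  prob_le : ∀ j, μ / (ρ * k j) ≤ 1
  density : ∀ j, IsDensity (C j) (h j)
  state : ∀ j, HasSlotDensity (μ / (ρ * k j)) (k j) (g j) (h j)
  mass : ∀ j, slotMean (μ / (ρ * k j)) (k j) (h j) = 1
  entropy : ∀ j, slotMean (μ / (ρ * k j)) (k j) (mulLog (h j)) ≤ E + (1 / 2) ^ j
  close : ∀ j, ‖g j - U‖ ≤ (1 / 2) ^ j

namespace IsSlotLimit

variable {U : L1} {k : ℕ → ℕ} {g : ℕ → L1} {h : ℕ → FunSeq} {C : ℕ → ℝ}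

theorem ae_tendsto (H : IsSlotLimit μ ρ E U k g h C) (N : ℕ) : ∀ᵐ v, Tendsto
    (fun j => slotState (μ / (ρ * k j)) (k j) (h j) N v) atTop (𝓝 (U.fn N v)) := by
  have h1 := ae_tendsto_of_norm_sub_le (x := fun j => g j N) (y := U N) fun j =>
    (lp.norm_apply_le_norm one_ne_zero (g j - U) N).trans (H.close j)
  have h2 := ae_all_iff.2 fun j => H.state j N
  filter_upwards [h1, h2] with v hv1 hv2
  exact hv1.congr hv2

theorem prob_nonneg (H : IsSlotLimit μ ρ E U k g h C) (hμ : 0 < μ) (hρ : 0 < ρ) (j : ℕ) :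
    0 ≤ μ / (ρ * k j) := by
  have : (0 : ℝ) < k j := by exact_mod_cast H.pos j
  positivity

theorem nonneg (H : IsSlotLimit μ ρ E U k g h C) (hμ : 0 < μ) (hρ : 0 < ρ) (N : ℕ) :
    0 ≤ᵐ[volume] U.fn N := by
  filter_upwards [H.ae_tendsto N] with v hv
  exact ge_of_tendsto' hv fun j => mul_nonneg (mul_nonneg
    (slotWeight_nonneg (H.prob_nonneg hμ hρ j) (H.prob_le j) _ _) (maxwellian_pos N v).le)
    ((H.density j).nonneg N v)

theorem isSymm (H : IsSlotLimit μ ρ E U k g h C) : IsSymm U.fn := by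
  intro N σ
  have h1 := (measurePreserving_comp_perm σ).quasiMeasurePreserving.ae (H.ae_tendsto N)
  filter_upwards [H.ae_tendsto N, h1] with v hv1 hv2
  refine tendsto_nhds_unique (hv2.congr fun j => ?_) hv1
  rw [slotState, slotState, (H.density j).symm, maxwellian_comp_perm]

theorem norm_eq (H : IsSlotLimit μ ρ E U k g h C) (hμ : 0 < μ) (hρ : 0 < ρ) : ‖U‖ = 1 := by
  have h0 : Tendsto g atTop (𝓝 U) := by
    rw [tendsto_iff_norm_sub_tendsto_zero]
    exact squeeze_zero (fun _ => norm_nonneg _) H.close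
      (tendsto_pow_atTop_nhds_zero_of_lt_one (by norm_num) (by norm_num))
  refine tendsto_nhds_unique h0.norm (tendsto_const_nhds.congr fun j => ?_)
  rw [(H.state j).norm_eq (H.density j) (H.prob_nonneg hμ hρ j) (H.prob_le j), H.mass]

theorem memL1s (H : IsSlotLimit μ ρ E U k g h C) : MemL1s U.fn where
  symm := H.isSymm
  integrable N := L1.integrable_coeFn (U N)
  summable := by
    simp only [integral_abs_fn]
    exact (lp_one_hasSum_norm U).summable

theorem isProbDist (H : IsSlotLimit μ ρ E U k g h C) (hμ : 0 < μ) (hρ : 0 < ρ) :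
    IsProbDist U.fn where
  toMemL1s := H.memL1s
  nonneg := H.nonneg hμ hρ
  norm_eq_one := by
    simp only [integral_abs_fn]
    rw [(lp_one_hasSum_norm U).tsum_eq, H.norm_eq hμ hρ]

end IsSlotLimit

/-- The nonnegative function `x log x - x + 1`. -/
def entropyFun (x : ℝ) : ℝ := x * Real.log x - x + 1

theorem entropyFun_nonneg {x : ℝ} (hx : 0 ≤ x) : 0 ≤ entropyFun x := by
  rcases hx.eq_or_lt with rfl | hx
  · simp [entropyFun]
  · have := mul_log_sub_le hx one_pos
    rw [Real.log_one, mul_zero, sub_zero] at this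
    exact this

theorem continuous_entropyFun : Continuous entropyFun :=
  (Real.continuous_mul_log.sub continuous_id).add continuous_const

namespace IsSlotLimit

variable {U : L1} {k : ℕ → ℕ} {g : ℕ → L1} {h : ℕ → FunSeq} {C : ℕ → ℝ}

theorem ae_tendsto_entropyFun (H : IsSlotLimit μ ρ E U k g h C) (hμ : 0 < μ) (hρ : 0 < ρ) (N : ℕ) :
    ∀ᵐ v, Tendsto (fun j => slotWeight (μ / (ρ * k j)) (k j) N * maxwellian N v
      * entropyFun (h j N v)) atTop
      (𝓝 (steadyState μ ρ N v * entropyFun (relDensity μ ρ U.fn N v))) := by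
  filter_upwards [H.ae_tendsto N] with v hv
  have h1 : Tendsto (fun j => slotWeight (μ / (ρ * k j)) (k j) N * maxwellian N v) atTop
      (𝓝 (steadyState μ ρ N v)) := (tendsto_slotWeight hρ H.tendsto N).mul_const _
  have hpos := steadyState_pos hμ hρ N v
  refine h1.mul ((continuous_entropyFun.tendsto _).comp ?_)
  refine (hv.div h1 hpos.ne').congr' ?_
  -- For `N > k j` the weight vanishes and the state does not determine the density; for large `j`
  -- the weight is positive.
  filter_upwards [h1.eventually (lt_mem_nhds hpos)] with j hj
  change slotWeight (μ / (ρ * k j)) (k j) N * maxwellian N v * h j N v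
    / (slotWeight (μ / (ρ * k j)) (k j) N * maxwellian N v) = h j N v
  rw [mul_div_cancel_left₀ _ hj.ne']

/-- The density and the constant `1` both have mean one, so the correction `-x + 1` in `entropyFun`
contributes nothing to the slot entropy, while it makes every integrand nonnegative. -/
theorem tsum_lintegral_le (H : IsSlotLimit μ ρ E U k g h C) (hμ : 0 < μ) (hρ : 0 < ρ) (j : ℕ) :
    0 ≤ E + (1 / 2) ^ j ∧ ∑' N, ∫⁻ v, ENNReal.ofReal (slotWeight (μ / (ρ * k j)) (k j) N
      * maxwellian N v * entropyFun (h j N v)) ≤ ENNReal.ofReal (E + (1 / 2) ^ j) := by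
  have hq := H.prob_nonneg hμ hρ j
  have hd := H.density j
  set q := μ / (ρ * k j)
  have hb : IsBddMeas fun N v => entropyFun (h j N v) := by
    have hone : IsBddMeas fun _ _ => (1 : ℝ) := ⟨fun _ => measurable_const, 1, by simp⟩
    have := (hd.bddMulLog.add (hd.isBddMeas.const_mul (-1))).add hone
    convert this using 3
    rw [entropyFun, mulLog]; ring
  have hI : ∀ N, ∫⁻ v, ENNReal.ofReal (slotWeight q (k j) N * maxwellian N v
      * entropyFun (h j N v))
      = ENNReal.ofReal (slotWeight q (k j) N * ∫ v, entropyFun (h j N v) ∂gaussN N) := by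
    intro N
    rw [integral_gaussN, ← integral_const_mul, ofReal_integral_eq_lintegral_ofReal]
    · refine lintegral_congr fun v => ?_
      congr 1; ring
    · obtain ⟨K, hK⟩ := hb.bdd
      refine Integrable.const_mul ?_ _
      refine (integrable_maxwellian N).bdd_mul (c := K) (hb.meas N).aestronglyMeasurable
        (ae_of_all _ (hK N))
    · exact ae_of_all _ fun v => mul_nonneg (slotWeight_nonneg hq (H.prob_le j) _ _)
        (mul_nonneg (entropyFun_nonneg (hd.nonneg N v)) (maxwellian_pos N v).le)
  have hnn : ∀ N, 0 ≤ slotWeight q (k j) N * ∫ v, entropyFun (h j N v) ∂gaussN N := fun N =>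
    mul_nonneg (slotWeight_nonneg hq (H.prob_le j) _ _)
      (integral_nonneg fun v => entropyFun_nonneg (hd.nonneg N v))
  have hsum : ∑ N ∈ Finset.range (k j + 1), slotWeight q (k j) N
      * ∫ v, entropyFun (h j N v) ∂gaussN N ≤ E + (1 / 2) ^ j := by
    have e : ∀ N, ∫ v, entropyFun (h j N v) ∂gaussN N
        = (∫ v, mulLog (h j) N v ∂gaussN N) - (∫ v, h j N v ∂gaussN N) + 1 := fun N => by
      have i1 := hd.bddMulLog.integrable N (μ := gaussN N)
      have i2 := hd.isBddMeas.integrable N (μ := gaussN N)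
      simp only [entropyFun]
      rw [integral_add, integral_sub]
      · simp [mulLog]
      · exact i1
      · exact i2
      · exact i1.sub i2
      · exact integrable_const 1
    simp only [e, mul_add, mul_sub, mul_one, Finset.sum_add_distrib, Finset.sum_sub_distrib]
    rw [sum_slotWeight]
    have h1 := H.mass j
    have h2 := H.entropy j
    rw [slotMean] at h1 h2
    linarith
  refine ⟨(Finset.sum_nonneg fun N _ => hnn N).trans hsum, ?_⟩
  simp only [hI]
  rw [tsum_eq_sum (s := Finset.range (k j + 1)), ← ENNReal.ofReal_sum_of_nonneg fun N _ => hnn N]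
  · exact ENNReal.ofReal_le_ofReal hsum
  · intro N hN
    rw [slotWeight_of_lt (by simpa using hN), zero_mul, ENNReal.ofReal_zero]

/-- Lower semicontinuity of the relative entropy. -/
theorem tsum_lintegral_entropyFun_le (H : IsSlotLimit μ ρ E U k g h C) (hμ : 0 < μ)
    (hρ : 0 < ρ) : 0 ≤ E ∧ ∑' N, ∫⁻ v, ENNReal.ofReal (steadyState μ ρ N v
      * entropyFun (relDensity μ ρ U.fn N v)) ≤ ENNReal.ofReal E := by
  have hlim : Tendsto (fun j : ℕ => E + (1 / 2) ^ j) atTop (𝓝 E) := by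
    simpa using (tendsto_pow_atTop_nhds_zero_of_lt_one (r := (1 / 2 : ℝ)) (by norm_num)
      (by norm_num)).const_add E
  refine ⟨ge_of_tendsto' hlim fun j => (H.tsum_lintegral_le hμ hρ j).1, ?_⟩
  have hmeas : ∀ j N, Measurable fun v => ENNReal.ofReal (slotWeight (μ / (ρ * k j)) (k j) N
      * maxwellian N v * entropyFun (h j N v)) := fun j N =>
    (((measurable_maxwellian N).const_mul _).mul
      (continuous_entropyFun.measurable.comp ((H.density j).meas N))).ennreal_ofReal
  have h1 : ∀ N, ∫⁻ v, ENNReal.ofReal (steadyState μ ρ N v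
      * entropyFun (relDensity μ ρ U.fn N v)) ≤ liminf (fun j : ℕ => ∫⁻ v, ENNReal.ofReal
        (slotWeight (μ / (ρ * k j)) (k j) N * maxwellian N v * entropyFun (h j N v))) atTop := by
    intro N
    refine le_trans (le_of_eq ?_) (lintegral_liminf_le (u := atTop) fun j => hmeas j N)
    refine lintegral_congr_ae ?_
    filter_upwards [H.ae_tendsto_entropyFun hμ hρ N] with v hv
    exact ((ENNReal.continuous_ofReal.tendsto _).comp hv).liminf_eq.symm
  refine (ENNReal.tsum_le_tsum h1).trans ?_
  -- Fatou a second time, now for the sum over `N` as an integral against counting measure.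
  have h2 := lintegral_liminf_le (μ := Measure.count) (u := atTop) (f := fun (j : ℕ) (N : ℕ) =>
    ∫⁻ v, ENNReal.ofReal (slotWeight (μ / (ρ * k j)) (k j) N * maxwellian N v
      * entropyFun (h j N v))) fun j => measurable_of_countable _
  simp only [lintegral_count] at h2
  refine h2.trans ?_
  have h3 := (ENNReal.continuous_ofReal.tendsto _).comp hlim
  rw [← h3.liminf_eq]
  exact liminf_le_liminf (Eventually.of_forall fun j => (H.tsum_lintegral_le hμ hρ j).2)

theorem hasSum_entropyFun (H : IsSlotLimit μ ρ E U k g h C) (hμ : 0 < μ) (hρ : 0 < ρ) :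
    (∀ N, Integrable fun v => steadyState μ ρ N v * entropyFun (relDensity μ ρ U.fn N v)) ∧
      (Summable fun N => ∫ v, steadyState μ ρ N v * entropyFun (relDensity μ ρ U.fn N v)) ∧
      ∑' N, ∫ v, steadyState μ ρ N v * entropyFun (relDensity μ ρ U.fn N v) ≤ E := by
  obtain ⟨hE, hle⟩ := H.tsum_lintegral_entropyFun_le hμ hρ
  have hmeas : ∀ N, Measurable fun v => steadyState μ ρ N v
      * entropyFun (relDensity μ ρ U.fn N v) := fun N => by
    have h1 : Measurable (steadyState μ ρ N) := (measurable_maxwellian N).const_mul _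
    exact h1.mul (continuous_entropyFun.measurable.comp
      ((Lp.stronglyMeasurable (U N)).measurable.div h1))
  have hnn : ∀ N, 0 ≤ᵐ[volume] fun v => steadyState μ ρ N v
      * entropyFun (relDensity μ ρ U.fn N v) := fun N => by
    filter_upwards [H.nonneg hμ hρ N] with v hv
    exact mul_nonneg (steadyState_pos hμ hρ N v).le
      (entropyFun_nonneg (div_nonneg hv (steadyState_pos hμ hρ N v).le))
  have htop : ∑' N, ∫⁻ v, ENNReal.ofReal (steadyState μ ρ N v
      * entropyFun (relDensity μ ρ U.fn N v)) ≠ ⊤ := ne_top_of_le_ne_top ENNReal.ofReal_ne_top hle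
  have hint : ∀ N, Integrable fun v => steadyState μ ρ N v
      * entropyFun (relDensity μ ρ U.fn N v) := fun N => by
    refine ⟨(hmeas N).aestronglyMeasurable, ?_⟩
    rw [hasFiniteIntegral_iff_ofReal (hnn N)]
    exact (ENNReal.ne_top_of_tsum_ne_top htop N).lt_top
  have e : ∀ N, ∫ v, steadyState μ ρ N v * entropyFun (relDensity μ ρ U.fn N v)
      = (∫⁻ v, ENNReal.ofReal (steadyState μ ρ N v
        * entropyFun (relDensity μ ρ U.fn N v))).toReal := fun N =>
    integral_eq_lintegral_of_nonneg_ae (hnn N) (hmeas N).aestronglyMeasurable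
  simp only [e]
  refine ⟨hint, ENNReal.summable_toReal htop, ?_⟩
  rw [← ENNReal.tsum_toReal_eq fun N => ENNReal.ne_top_of_tsum_ne_top htop N]
  exact ENNReal.toReal_le_of_le_ofReal hE hle

theorem entropyDensity_eq (hμ : 0 < μ) (hρ : 0 < ρ) (f : FunSeq) (N : ℕ) (v : Fin N → ℝ) :
    entropyDensity μ ρ f N v
      = steadyState μ ρ N v * entropyFun (relDensity μ ρ f N v) + f N v - steadyState μ ρ N v := by
  have h1 : f N v = steadyState μ ρ N v * relDensity μ ρ f N v := by
    rw [relDensity, mul_div_cancel₀ _ (steadyState_pos hμ hρ N v).ne']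
  conv_rhs => rw [h1]
  rw [entropyDensity, entropyFun]
  have h2 : relDensity μ ρ (fun N v => steadyState μ ρ N v * relDensity μ ρ f N v) N v
      = relDensity μ ρ f N v := by
    rw [relDensity, mul_div_cancel_left₀ _ (steadyState_pos hμ hρ N v).ne']
  ring

theorem integrable_steadyState (N : ℕ) : Integrable (steadyState μ ρ N) :=
  (integrable_maxwellian N).const_mul _

theorem integral_steadyState (N : ℕ) : ∫ v, steadyState μ ρ N v = poissonWeight μ ρ N := by
  simp only [steadyState]
  rw [integral_const_mul, integral_maxwellian, mul_one]

/-- The entropy density differs from the nonnegative, summable `entropyFun` terms only by `U - Γ`,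
which is absolutely integrable; hence the absolute convergence. -/
theorem memL1s_entropyDensity (H : IsSlotLimit μ ρ E U k g h C) (hμ : 0 < μ) (hρ : 0 < ρ) :
    MemL1s (entropyDensity μ ρ U.fn) := by
  obtain ⟨h1, h2, -⟩ := H.hasSum_entropyFun hμ hρ
  have hU := H.memL1s
  have hint : ∀ N, Integrable (entropyDensity μ ρ U.fn N) := fun N =>
    (((h1 N).add (hU.integrable N)).sub (integrable_steadyState N)).congr
      (ae_of_all _ fun v => (entropyDensity_eq hμ hρ U.fn N v).symm)
  refine ⟨fun N σ => ?_, hint, ?_⟩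
  · filter_upwards [hU.symm N σ] with v hv
    simp only [entropyDensity, relDensity, steadyState, maxwellian_comp_perm, hv]
  · refine Summable.of_nonneg_of_le (fun N => integral_nonneg fun v => abs_nonneg _) (fun N => ?_)
      ((h2.add hU.summable).add (hasSum_poissonWeight μ ρ).summable)
    have h12 : Integrable fun v => steadyState μ ρ N v * entropyFun (relDensity μ ρ U.fn N v)
      + |U.fn N v| := (h1 N).add (hU.integrable N).abs
    rw [← integral_steadyState, ← integral_add (h1 N) (hU.integrable N).abs,
      ← integral_add h12 (integrable_steadyState N)]
    refine integral_mono_ae (hint N).abs (h12.add (integrable_steadyState N)) ?_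
    filter_upwards [H.nonneg hμ hρ N] with v hv
    have hs := steadyState_pos hμ hρ N v
    have he := mul_nonneg hs.le (entropyFun_nonneg (div_nonneg hv hs.le))
    change |entropyDensity μ ρ U.fn N v| ≤ steadyState μ ρ N v
      * entropyFun (relDensity μ ρ U.fn N v) + |U.fn N v| + steadyState μ ρ N v
    rw [entropyDensity_eq hμ hρ]
    refine (abs_sub _ _).trans (add_le_add ((abs_add_le _ _).trans ?_) (abs_of_pos hs).le)
    exact add_le_add (abs_of_nonneg he).le le_rfl

theorem relEntropy_le (H : IsSlotLimit μ ρ E U k g h C) (hμ : 0 < μ) (hρ : 0 < ρ) :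
    relEntropy μ ρ U.fn ≤ E := by
  obtain ⟨h1, h2, h3⟩ := H.hasSum_entropyFun hμ hρ
  have hU := H.isProbDist hμ hρ
  have e : ∀ N, poissonWeight μ ρ N * ∫ v, relDensity μ ρ U.fn N v
        * Real.log (relDensity μ ρ U.fn N v) * maxwellian N v
      = (∫ v, steadyState μ ρ N v * entropyFun (relDensity μ ρ U.fn N v))
        + (∫ v, |U.fn N v|) - poissonWeight μ ρ N := fun N => by
    have e1 : ∫ v, |U.fn N v| = ∫ v, U.fn N v := by
      refine integral_congr_ae ?_
      filter_upwards [hU.nonneg N] with v hv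
      exact abs_of_nonneg hv
    have h12 : Integrable fun v => steadyState μ ρ N v * entropyFun (relDensity μ ρ U.fn N v)
      + U.fn N v := (h1 N).add (hU.integrable N)
    rw [e1, ← integral_add (h1 N) (hU.integrable N), ← integral_const_mul]
    nth_rewrite 2 [← integral_steadyState]
    rw [← integral_sub h12 (integrable_steadyState N)]
    refine integral_congr_ae (ae_of_all _ fun v => ?_)
    change _ = steadyState μ ρ N v * entropyFun (relDensity μ ρ U.fn N v) + U.fn N v
      - steadyState μ ρ N v
    rw [← entropyDensity_eq hμ hρ, entropyDensity, steadyState]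
    ring
  rw [relEntropy]
  simp only [e]
  rw [(h2.add hU.summable).tsum_sub (hasSum_poissonWeight μ ρ).summable, h2.tsum_add hU.summable,
    hU.norm_eq_one, (hasSum_poissonWeight μ ρ).tsum_eq]
  linarith

end IsSlotLimit

end KacReservoir
end

/-! ### Approximation of the initial state by bounded slot densities -/

noncomputable section

namespace KacReservoir

/-- A nonnegative and exactly symmetric version of the relative density. -/
def symmDensity (μ ρ : ℝ) (f : FunSeq) : FunSeq := fun N v =>
  (∑ σ : Equiv.Perm (Fin N), max 0 (relDensity μ ρ f N (v ∘ σ))) / (N.factorial : ℝ)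

/-- The truncation at the level `M`, both of the values and of the number of particles. -/
def trunc (M : ℕ) (r : FunSeq) : FunSeq := fun N v => if N ≤ M then min (r N v) M else 0

variable {μ ρ : ℝ}

theorem symmDensity_nonneg (f : FunSeq) (N : ℕ) (v : Fin N → ℝ) : 0 ≤ symmDensity μ ρ f N v :=
  div_nonneg (Finset.sum_nonneg fun _ _ => le_max_left _ _) (Nat.cast_nonneg _)

theorem symmDensity_comp_perm (f : FunSeq) (N : ℕ) (τ : Equiv.Perm (Fin N)) (v : Fin N → ℝ) :
    symmDensity μ ρ f N (v ∘ τ) = symmDensity μ ρ f N v := by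
  unfold symmDensity
  congr 1
  rw [← Equiv.sum_comp (Equiv.mulLeft τ) fun σ : Equiv.Perm (Fin N) =>
    max 0 (relDensity μ ρ f N (v ∘ σ))]
  rfl

theorem measurable_symmDensity (f : L1) (N : ℕ) : Measurable (symmDensity μ ρ f.fn N) := by
  have h1 : Measurable (relDensity μ ρ f.fn N) :=
    (Lp.stronglyMeasurable (f N)).measurable.div ((measurable_maxwellian N).const_mul _)
  refine Measurable.div_const (Finset.measurable_sum _ fun σ _ => ?_) _
  exact measurable_const.max (h1.comp (measurePreserving_comp_perm σ).measurable)

theorem symmDensity_ae_eq (hμ : 0 < μ) (hρ : 0 < ρ) {f : L1} (hf : IsProbDist f.fn) (N : ℕ) :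
    symmDensity μ ρ f.fn N =ᵐ[volume] relDensity μ ρ f.fn N := by
  filter_upwards [ae_all_iff.2 fun σ => hf.symm N σ, hf.nonneg N] with v h1 h2
  have e : ∀ σ : Equiv.Perm (Fin N), max 0 (relDensity μ ρ f.fn N (v ∘ σ))
      = relDensity μ ρ f.fn N v := fun σ => by
    have : relDensity μ ρ f.fn N (v ∘ σ) = relDensity μ ρ f.fn N v := by
      simp only [relDensity, steadyState, maxwellian_comp_perm, h1 σ]
    rw [this]
    exact max_eq_right (div_nonneg h2 (steadyState_pos hμ hρ N v).le)
  simp only [symmDensity, e]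
  rw [Finset.sum_const, Finset.card_univ, Fintype.card_perm, Fintype.card_fin, nsmul_eq_mul,
    mul_div_cancel_left₀]
  exact_mod_cast N.factorial_ne_zero

section Truncation

variable {r : FunSeq}

theorem isDensity_trunc (hm : ∀ N, Measurable (r N))
    (hs : ∀ (N : ℕ) (σ : Equiv.Perm (Fin N)) (v : Fin N → ℝ), r N (v ∘ σ) = r N v)
    (h0 : ∀ N v, 0 ≤ r N v) (M : ℕ) : IsDensity M (trunc M r) := by
  refine ⟨fun N => ?_, fun N σ v => ?_, fun N v => ?_, fun N v => ?_⟩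
  · unfold trunc
    split_ifs
    · exact (hm N).min measurable_const
    · exact measurable_const
  · simp only [trunc, hs]
  · unfold trunc
    split_ifs
    · exact le_min (h0 N v) (Nat.cast_nonneg M)
    · exact le_rfl
  · unfold trunc
    split_ifs
    · exact min_le_right _ _
    · exact Nat.cast_nonneg M

theorem trunc_of_lt {M N : ℕ} (h : M < N) (v : Fin N → ℝ) : trunc M r N v = 0 :=
  if_neg (not_le.2 h)

theorem trunc_le (h0 : ∀ N v, 0 ≤ r N v) (M N : ℕ) (v : Fin N → ℝ) : trunc M r N v ≤ r N v := by
  unfold trunc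
  split_ifs
  · exact min_le_left _ _
  · exact h0 N v

theorem eventually_trunc_eq (N : ℕ) (v : Fin N → ℝ) :
    ∀ᶠ M : ℕ in atTop, trunc M r N v = r N v := by
  filter_upwards [eventually_ge_atTop N, eventually_ge_atTop ⌈r N v⌉₊] with M h1 h2
  rw [trunc, if_pos h1, min_eq_left (Nat.ceil_le.1 h2)]

/-- Dominated convergence in the velocities and in `N`. It serves both the mass, with `Φ x = x`, and
the entropy, with `Φ x = x log x`. -/
theorem tendsto_tsum_trunc (hm : ∀ N, Measurable (r N))
    (h0 : ∀ N v, 0 ≤ r N v) {Φ : ℝ → ℝ} (hΦ : Continuous Φ) (hΦ0 : Φ 0 = 0)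
    (hle : ∀ x M : ℝ, 0 ≤ x → 1 ≤ M → |Φ (min x M)| ≤ |Φ x|)
    (hint : ∀ N, Integrable fun v => steadyState μ ρ N v * Φ (r N v))
    (hsum : Summable fun N => ∫ v, |steadyState μ ρ N v * Φ (r N v)|) :
    Tendsto (fun M : ℕ => ∑ N ∈ Finset.range (M + 1), poissonWeight μ ρ N
        * ∫ v, Φ (trunc M r N v) ∂gaussN N) atTop
      (𝓝 (∑' N, ∫ v, steadyState μ ρ N v * Φ (r N v))) := by
  have hb : ∀ M : ℕ, 1 ≤ M → ∀ N v, |steadyState μ ρ N v * Φ (trunc M r N v)|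
      ≤ |steadyState μ ρ N v * Φ (r N v)| := by
    intro M hM N v
    rw [abs_mul, abs_mul]
    refine mul_le_mul_of_nonneg_left ?_ (abs_nonneg _)
    unfold trunc
    split_ifs
    · exact hle _ _ (h0 N v) (by exact_mod_cast hM)
    · rw [hΦ0, abs_zero]; exact abs_nonneg _
  have hmeas : ∀ M N, Measurable fun v => steadyState μ ρ N v * Φ (trunc M r N v) := by
    intro M N
    refine ((measurable_maxwellian N).const_mul _).mul (hΦ.measurable.comp ?_)
    unfold trunc
    split_ifs
    · exact (hm N).min measurable_const
    · exact measurable_const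
  have h1 : Tendsto (fun M : ℕ => ∑' N, ∫ v, steadyState μ ρ N v * Φ (trunc M r N v)) atTop
      (𝓝 (∑' N, ∫ v, steadyState μ ρ N v * Φ (r N v))) := by
    refine tendsto_tsum_of_dominated_convergence hsum (fun N => ?_) ?_
    · refine tendsto_integral_filter_of_dominated_convergence
        (fun v => |steadyState μ ρ N v * Φ (r N v)|)
        (Eventually.of_forall fun M => (hmeas M N).aestronglyMeasurable) ?_ (hint N).abs ?_
      · filter_upwards [eventually_ge_atTop 1] with M hM
        exact ae_of_all _ (hb M hM N)
      · refine ae_of_all _ fun v => tendsto_const_nhds.congr' ?_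
        filter_upwards [eventually_trunc_eq (r := r) N v] with M hM
        rw [hM]
    · filter_upwards [eventually_ge_atTop 1] with M hM N
      refine (norm_integral_le_integral_norm _).trans ?_
      exact integral_mono_of_nonneg (ae_of_all _ fun v => norm_nonneg _) (hint N).abs
        (ae_of_all _ (hb M hM N))
  refine h1.congr fun M => ?_
  rw [tsum_eq_sum (s := Finset.range (M + 1))]
  · refine Finset.sum_congr rfl fun N _ => ?_
    rw [integral_gaussN, ← integral_const_mul]
    refine integral_congr_ae (ae_of_all _ fun v => ?_)
    simp only [steadyState]
    ring
  · intro N hN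
    simp [trunc_of_lt (r := r) (show M < N by simpa using hN), hΦ0]

/-- On `[1, ∞)` the function `x log x` is nonnegative and increasing; a cut below `1` could increase
its absolute value. -/
theorem abs_mul_log_min_le {x M : ℝ} (hx : 0 ≤ x) (hM : 1 ≤ M) :
    |min x M * Real.log (min x M)| ≤ |x * Real.log x| := by
  rcases le_total x M with h | h
  · rw [min_eq_left h]
  · rw [min_eq_right h, abs_mul, abs_mul, abs_of_nonneg (zero_le_one.trans hM), abs_of_nonneg hx,
      abs_of_nonneg (Real.log_nonneg hM), abs_of_nonneg (Real.log_nonneg (hM.trans h))]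
    exact mul_le_mul h (Real.log_le_log (zero_lt_one.trans_le hM) h) (Real.log_nonneg hM) hx

/-- The cutoff in the particle number leaves finitely many terms, and each converges by the Poisson
limit. -/
theorem tendsto_slotMean (hρ : 0 < ρ) {F : FunSeq} {M : ℕ} (hF : ∀ N, M < N → ∀ v, F N v = 0)
    {k : ℕ → ℕ} (hk : Tendsto k atTop atTop) :
    Tendsto (fun n => slotMean (μ / (ρ * k n)) (k n) F) atTop
      (𝓝 (∑ N ∈ Finset.range (M + 1), poissonWeight μ ρ N * ∫ v, F N v ∂gaussN N)) := by
  have h1 : Tendsto (fun n => ∑ N ∈ Finset.range (M + 1), slotWeight (μ / (ρ * k n)) (k n) N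
      * ∫ v, F N v ∂gaussN N) atTop
      (𝓝 (∑ N ∈ Finset.range (M + 1), poissonWeight μ ρ N * ∫ v, F N v ∂gaussN N)) :=
    tendsto_finsetSum _ fun N _ => (tendsto_slotWeight hρ hk N).mul_const _
  refine h1.congr' ?_
  filter_upwards [hk.eventually_ge_atTop M] with n hn
  refine Finset.sum_subset (fun N hN => ?_) fun N _ hN => ?_
  · simp only [Finset.mem_range] at hN ⊢; omega
  · simp [hF N (by simpa using hN)]

end Truncation

theorem coord_sum_incl (M : ℕ) (x : ∀ N, LpN N) (c : ℕ → ℝ) (N : ℕ) :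
    (∑ n ∈ Finset.range (M + 1), c n • incl n (x n) : L1) N = if N ≤ M then c N • x N else 0 := by
  rw [← coord_apply, map_sum]
  simp only [map_smul]
  split_ifs with hN
  · rw [Finset.sum_eq_single N, Coeffs.coord_incl_self]
    · intro n _ hn
      rw [Coeffs.coord_incl_ne hn.symm, smul_zero]
    · intro h
      exact absurd (Finset.mem_range_succ_iff.2 hN) h
  · refine Finset.sum_eq_zero fun n hn => ?_
    rw [Coeffs.coord_incl_ne, smul_zero]
    rintro rfl
    exact hN (Finset.mem_range_succ_iff.1 hn)

section Approximation

variable {C : ℝ} {F : FunSeq}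

theorem IsDensity.integrable_mul_maxwellian (hF : IsDensity C F) (N : ℕ) :
    Integrable fun v => maxwellian N v * F N v := by
  obtain ⟨K, hK⟩ := hF.isBddMeas.bdd
  exact (integrable_maxwellian N).mul_bdd (c := K) (hF.meas N).aestronglyMeasurable
    (ae_of_all _ (hK N))

/-- The elements of `⨁_N L¹(ℝᴺ)` with the components `c_N γ_N F_N` for `N ≤ M`. -/
def IsDensity.toState (hF : IsDensity C F) (M : ℕ) (c : ℕ → ℝ) : L1 :=
  ∑ n ∈ Finset.range (M + 1), c n • incl n (hF.integrable_mul_maxwellian n).toL1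

theorem IsDensity.toState_ae (hF : IsDensity C F) {M : ℕ} (hM : ∀ N, M < N → ∀ v, F N v = 0)
    (c : ℕ → ℝ) (N : ℕ) :
    hF.toState M c N =ᵐ[volume] fun v => c N * maxwellian N v * F N v := by
  rw [IsDensity.toState, coord_sum_incl]
  split_ifs with hN
  · filter_upwards [Lp.coeFn_smul (c N) (hF.integrable_mul_maxwellian N).toL1,
      (hF.integrable_mul_maxwellian N).coeFn_toL1] with v h1 h2
    rw [h1, Pi.smul_apply, h2, smul_eq_mul, mul_assoc]
  · filter_upwards [Lp.coeFn_zero ℝ 1 (volume : Measure (Fin N → ℝ))] with v hv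
    rw [hv, hM N (not_le.1 hN)]
    simp

theorem IsDensity.tendsto_toState (hF : IsDensity C F) (M : ℕ) {c : ℕ → ℕ → ℝ} {c' : ℕ → ℝ}
    (hc : ∀ N, Tendsto (fun n => c n N) atTop (𝓝 (c' N))) :
    Tendsto (fun n => hF.toState M (c n)) atTop (𝓝 (hF.toState M c')) :=
  tendsto_finsetSum _ fun N _ => (hc N).smul_const _

theorem IsDensity.mul (hF : IsDensity C F) {c : ℝ} (hc : 0 ≤ c) :
    IsDensity (c * C) fun N v => c * F N v :=
  ⟨fun N => (hF.meas N).const_mul c, fun N σ v => by simp only [hF.symm],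
    fun N v => mul_nonneg hc (hF.nonneg N v), fun N v => mul_le_mul_of_nonneg_left (hF.le N v) hc⟩

theorem IsDensity.slotMean_mulLog_mul (hF : IsDensity C F) (q : ℝ) (k : ℕ) {c : ℝ} (hc : 0 < c) :
    slotMean q k (mulLog fun N v => c * F N v)
      = c * slotMean q k (mulLog F) + c * Real.log c * slotMean q k F := by
  have e : (mulLog fun N v => c * F N v)
      = fun N v => c * mulLog F N v + c * Real.log c * F N v := by
    ext N v
    simp only [mulLog]
    rcases (hF.nonneg N v).eq_or_lt with h | h
    · rw [← h]; simp
    · rw [Real.log_mul hc.ne' h.ne']; ring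
  rw [e, slotMean_add (hF.bddMulLog.const_mul _) (hF.isBddMeas.const_mul _), slotMean_const_mul,
    slotMean_const_mul]

/-- The relative density is truncated at a level `M`, the Poisson weights are replaced by the
binomial ones, and the result is normalised. For large `M` this changes mass and entropy little, and
for fixed `M` the error in the weights vanishes as `n → ∞`. -/
theorem exists_slot_approximation (hμ : 0 < μ) (hρ : 0 < ρ) {f : L1} (hf : IsProbDist f.fn)
    (hent : MemL1s (entropyDensity μ ρ f.fn)) {k : ℕ → ℕ} (hk : Tendsto k atTop atTop)
    {ε : ℝ} (hε : 0 < ε) :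
    ∀ᶠ n in atTop, ∃ (C : ℝ) (h : FunSeq) (g : L1), IsDensity C h ∧
      HasSlotDensity (μ / (ρ * k n)) (k n) g h ∧ slotMean (μ / (ρ * k n)) (k n) h = 1 ∧
      slotMean (μ / (ρ * k n)) (k n) (mulLog h) < relEntropy μ ρ f.fn + ε ∧ ‖g - f‖ < ε := by
  set r := symmDensity μ ρ f.fn with hr
  have hrm : ∀ N, Measurable (r N) := measurable_symmDensity f
  have hr0 : ∀ N v, 0 ≤ r N v := symmDensity_nonneg f.fn
  have hd : ∀ M : ℕ, IsDensity M (trunc M r) := isDensity_trunc hrm (symmDensity_comp_perm f.fn) hr0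
  have hrf : ∀ N, (fun v => steadyState μ ρ N v * r N v) =ᵐ[volume] f.fn N := fun N => by
    filter_upwards [symmDensity_ae_eq hμ hρ hf N] with v hv
    rw [hr, hv, relDensity, mul_div_cancel₀ _ (steadyState_pos hμ hρ N v).ne']
  have hrl : ∀ N, (fun v => steadyState μ ρ N v * (r N v * Real.log (r N v)))
      =ᵐ[volume] entropyDensity μ ρ f.fn N := fun N => by
    filter_upwards [symmDensity_ae_eq hμ hρ hf N] with v hv
    rw [hr, hv, entropyDensity]
  have habs : ∀ N, ∫ v, steadyState μ ρ N v * r N v = ‖f N‖ := fun N => by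
    rw [← integral_abs_fn, integral_congr_ae (hrf N)]
    refine integral_congr_ae ?_
    filter_upwards [hf.nonneg N] with v hv
    exact (abs_of_nonneg hv).symm
  have hnorm : ‖f‖ = 1 := by
    rw [← (lp_one_hasSum_norm f).tsum_eq, ← hf.norm_eq_one]
    simp only [integral_abs_fn]
  set Z : ℕ → ℝ := fun M => ∑ N ∈ Finset.range (M + 1), poissonWeight μ ρ N
    * ∫ v, trunc M r N v ∂gaussN N with hZ
  set T : ℕ → ℝ := fun M => ∑ N ∈ Finset.range (M + 1), poissonWeight μ ρ N
    * ∫ v, mulLog (trunc M r) N v ∂gaussN N with hT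
  have hint : ∀ N, Integrable fun v => steadyState μ ρ N v * r N v := fun N =>
    (hf.integrable N).congr (hrf N).symm
  have hZ1 : Tendsto Z atTop (𝓝 1) := by
    have := tendsto_tsum_trunc hrm hr0 (Φ := fun x => x) continuous_id rfl
      (fun x M hx hM => by
        rw [abs_of_nonneg (le_min hx (zero_le_one.trans hM)), abs_of_nonneg hx]
        exact min_le_left _ _) hint (by
        refine hf.summable.congr fun N => integral_congr_ae ?_
        filter_upwards [hrf N] with v hv
        rw [hv])
    simp only [habs] at this
    rwa [(lp_one_hasSum_norm f).tsum_eq, hnorm] at this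
  have hT1 : Tendsto T atTop (𝓝 (relEntropy μ ρ f.fn)) := by
    have := tendsto_tsum_trunc hrm hr0 (Φ := fun x => x * Real.log x)
      Real.continuous_mul_log (by simp) (fun x M hx hM => abs_mul_log_min_le hx hM)
      (fun N => (hent.integrable N).congr (hrl N).symm) (by
        refine hent.summable.congr fun N => integral_congr_ae ?_
        filter_upwards [hrl N] with v hv
        rw [hv])
    have e : relEntropy μ ρ f.fn
        = ∑' N, ∫ v, steadyState μ ρ N v * (r N v * Real.log (r N v)) := by
      refine tsum_congr fun N => ?_
      rw [integral_congr_ae (hrl N), ← integral_const_mul]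
      refine integral_congr_ae (ae_of_all _ fun v => ?_)
      simp only [entropyDensity, steadyState]
      ring
    rw [e]
    exact this
  -- The truncated density lies below `r`, so the `L¹` distance is exactly the lost mass.
  have hy : ∀ M, ‖(hd M).toState M (poissonWeight μ ρ) - f‖ = 1 - Z M := by
    intro M
    have hae := (hd M).toState_ae (M := M) (fun N hN v => trunc_of_lt hN v) (poissonWeight μ ρ)
    have hti : ∀ N, Integrable fun v => steadyState μ ρ N v * trunc M r N v := fun N => by
      refine (((hd M).integrable_mul_maxwellian N).const_mul (poissonWeight μ ρ N)).congr
        (ae_of_all _ fun v => ?_)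
      simp only [steadyState]; ring
    have e1 : ∀ N, ‖((hd M).toState M (poissonWeight μ ρ) - f) N‖
        = ‖f N‖ - poissonWeight μ ρ N * ∫ v, trunc M r N v ∂gaussN N := by
      intro N
      have e2 : poissonWeight μ ρ N * ∫ v, trunc M r N v ∂gaussN N
          = ∫ v, steadyState μ ρ N v * trunc M r N v := by
        rw [integral_gaussN, ← integral_const_mul]
        refine integral_congr_ae (ae_of_all _ fun v => ?_)
        simp only [steadyState]; ring
      rw [e2, ← habs, ← integral_sub (hint N) (hti N), L1.norm_eq_integral_norm]
      refine integral_congr_ae ?_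
      filter_upwards [Lp.coeFn_sub ((hd M).toState M (poissonWeight μ ρ) N) (f N), hae N, hrf N]
        with v h1 h2 h3
      change ‖((hd M).toState M (poissonWeight μ ρ) N - f N : LpN N) v‖ = _
      have h4 := mul_le_mul_of_nonneg_left (trunc_le hr0 M N v) (steadyState_pos hμ hρ N v).le
      rw [h1, Pi.sub_apply, h2]
      change ‖steadyState μ ρ N v * trunc M r N v - f.fn N v‖ = _
      rw [← h3, Real.norm_eq_abs, abs_of_nonpos (by linarith)]
      ring
    rw [← (lp_one_hasSum_norm _).tsum_eq]
    simp only [e1]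
    have hz : ∀ N ∉ Finset.range (M + 1),
        poissonWeight μ ρ N * ∫ v, trunc M r N v ∂gaussN N = 0 := fun N hN => by
      simp [trunc_of_lt (r := r) (show M < N by simpa using hN)]
    rw [(lp_one_hasSum_norm f).summable.tsum_sub (summable_of_ne_finset_zero hz),
      (lp_one_hasSum_norm f).tsum_eq, hnorm, tsum_eq_sum hz]
  have hy1 : Tendsto (fun M => (hd M).toState M (poissonWeight μ ρ)) atTop (𝓝 f) := by
    rw [tendsto_iff_norm_sub_tendsto_zero]
    simp only [hy]
    simpa using hZ1.const_sub 1
  have hZi : Tendsto (fun M => (Z M)⁻¹) atTop (𝓝 1) := by simpa using hZ1.inv₀ one_ne_zero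
  have hA : Tendsto (fun M => ‖(Z M)⁻¹ • (hd M).toState M (poissonWeight μ ρ) - f‖) atTop
      (𝓝 0) := by
    simpa using ((hZi.smul hy1).sub_const f).norm
  -- This is the entropy of the normalised density, from `c x log (c x) = c x log x + c log c x`
  -- with `c = (Z M)⁻¹`.
  have hB : Tendsto (fun M => (Z M)⁻¹ * T M + (Z M)⁻¹ * Real.log (Z M)⁻¹ * Z M) atTop
      (𝓝 (relEntropy μ ρ f.fn)) := by
    have hlog := (Real.continuousAt_log one_ne_zero).tendsto.comp hZi
    rw [Real.log_one] at hlog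
    simpa using (hZi.mul hT1).add ((hZi.mul hlog).mul hZ1)
  -- The strict inequalities at this fixed `M` persist for large `n`.
  obtain ⟨M, hM0, hMA, hMB⟩ := ((hZ1.eventually (lt_mem_nhds zero_lt_one)).and
    ((hA.eventually (gt_mem_nhds hε)).and (hB.eventually (gt_mem_nhds
      (show relEntropy μ ρ f.fn < relEntropy μ ρ f.fn + ε by linarith))))).exists
  have hZn : Tendsto (fun n => slotMean (μ / (ρ * k n)) (k n) (trunc M r)) atTop (𝓝 (Z M)) :=
    tendsto_slotMean hρ (fun N hN v => trunc_of_lt hN v) hk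
  have hTn : Tendsto (fun n => slotMean (μ / (ρ * k n)) (k n) (mulLog (trunc M r))) atTop
      (𝓝 (T M)) :=
    tendsto_slotMean hρ (fun N hN v => by simp [mulLog, trunc_of_lt hN v]) hk
  have hZin := hZn.inv₀ hM0.ne'
  have hAn := (((hZin.smul ((hd M).tendsto_toState M
    fun N => tendsto_slotWeight (μ := μ) hρ hk N)).sub_const f).norm).eventually (gt_mem_nhds hMA)
  have hlogn := (Real.continuousAt_log (inv_pos.2 hM0).ne').tendsto.comp hZin
  have hBn := ((hZin.mul hTn).add ((hZin.mul hlogn).mul hZn)).eventually (gt_mem_nhds hMB)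
  filter_upwards [hZn.eventually (lt_mem_nhds hM0), hAn, hBn] with n h1 h2 h3
  have hc := inv_pos.2 h1
  refine ⟨_, _, _, (hd M).mul hc.le, ?_, ?_, ?_, h2⟩
  · intro N
    filter_upwards [Lp.coeFn_smul (slotMean (μ / (ρ * k n)) (k n) (trunc M r))⁻¹
      ((hd M).toState M (fun N => slotWeight (μ / (ρ * k n)) (k n) N) N),
      (hd M).toState_ae (M := M) (fun N hN v => trunc_of_lt hN v)
        (fun N => slotWeight (μ / (ρ * k n)) (k n) N) N] with v e1 e2
    refine e1.trans ?_
    rw [Pi.smul_apply, e2, slotState, smul_eq_mul]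
    ring
  · rw [slotMean_const_mul, inv_mul_cancel₀ h1.ne']
  · rw [(hd M).slotMean_mulLog_mul _ _ hc]
    exact h3

end Approximation

end KacReservoir
end

/-! ### Entropy decay along the limiting dynamics -/

noncomputable section

namespace KacReservoir

variable {μ ρ lam : ℝ}

/-- Three errors of size `ε / 3` in the state: finitely many slots, the approximate initial state,
and `m` Euler steps. Along the scheme the entropy is multiplied by `(1 - ρ t / m) ^ m`, which tends
to `exp(-ρ t)`. -/
theorem exists_euler_approximation (hμ : 0 < μ) (hρ : 0 < ρ) (hlam : 0 ≤ lam) {f U : L1}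
    (hf : IsProbDist f.fn) (hent : MemL1s (entropyDensity μ ρ f.fn)) {t : ℝ} (ht : 0 ≤ t)
    (hU : Tendsto (fun n => NormedSpace.exp (t • slotGen μ ρ lam (slots μ ρ n) 0) f) atTop (𝓝 U))
    (j : ℕ) {ε : ℝ} (hε : 0 < ε) :
    ∃ (n : ℕ) (C : ℝ) (h : FunSeq) (g : L1), j ≤ n ∧ IsDensity C h ∧
      HasSlotDensity (μ / (ρ * slots μ ρ n)) (slots μ ρ n) g h ∧
      slotMean (μ / (ρ * slots μ ρ n)) (slots μ ρ n) h = 1 ∧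
      slotMean (μ / (ρ * slots μ ρ n)) (slots μ ρ n) (mulLog h)
        ≤ Real.exp (-ρ * t) * relEntropy μ ρ f.fn + ε ∧ ‖g - U‖ ≤ ε := by
  have hε3 : 0 < ε / 3 := by positivity
  obtain ⟨n, hjn, hUn, C, h, g, hd, hg, hmass, hE, hgf⟩ := ((eventually_ge_atTop j).and
    (((tendsto_iff_norm_sub_tendsto_zero.1 hU).eventually (gt_mem_nhds hε3)).and
    (exists_slot_approximation hμ hρ hf hent tendsto_slots hε3))).exists
  set k := slots μ ρ n with hk
  have hk0 : 0 < k := slots_pos n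
  have hq : μ / (ρ * k) ≤ 1 := slot_prob_le_one hρ (le_slots n) hk0
  set A := slotGen μ ρ lam k 0 with hA
  have hEuler : Tendsto (fun m : ℕ => ((1 + (t / m) • A) ^ m) g) atTop
      (𝓝 (NormedSpace.exp (t • A) g)) := by
    have h1 := norm_one_add_slotGen_le hμ hρ hlam 0 hk0 (le_slots n) rfl
    have hkr : (0 : ℝ) < k := by exact_mod_cast hk0
    have h2 := tendsto_euler A (d := μ + ρ * k + lam * (k : ℝ) ^ 2) (by positivity)
      (by simpa using h1) ht
    exact ((ContinuousLinearMap.apply ℝ L1 g).continuous.tendsto _).comp h2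
  have hsmall : ∀ c : ℝ, ∀ᶠ m : ℕ in atTop, t / m * c ≤ 1 := fun c => by
    have := (tendsto_const_div_atTop_nhds_zero_nat t).mul_const c
    rw [zero_mul] at this
    exact (this.eventually (gt_mem_nhds zero_lt_one)).mono fun _ h => h.le
  have hpow : Tendsto (fun m : ℕ => (1 - t / m * ρ) ^ m * slotMean (μ / (ρ * k)) k (mulLog h))
      atTop (𝓝 (Real.exp (-ρ * t) * slotMean (μ / (ρ * k)) k (mulLog h))) := by
    refine Tendsto.mul_const _ ((Real.tendsto_one_add_div_pow_exp (-ρ * t)).congr fun m => ?_)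
    congr 1
    ring
  -- The decay factor is at most one, so it does not amplify the error made in the initial entropy.
  have hexp : Real.exp (-ρ * t) ≤ 1 := Real.exp_le_one_iff.2 (by nlinarith)
  have hlt : Real.exp (-ρ * t) * slotMean (μ / (ρ * k)) k (mulLog h)
      < Real.exp (-ρ * t) * relEntropy μ ρ f.fn + ε := by
    have h1 := mul_lt_mul_of_pos_left hE (Real.exp_pos (-ρ * t))
    have h2 := mul_le_mul_of_nonneg_right hexp hε3.le
    linarith
  -- The last three conditions make the step `t / m` so short that the refreshing and collision
  -- steps are convex combinations and the decay factor is nonnegative; `k` is already fixed here.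
  obtain ⟨m, h1, h2, h3, h4, h5⟩ := (((tendsto_iff_norm_sub_tendsto_zero.1 hEuler).eventually
    (gt_mem_nhds hε3)).and ((hpow.eventually (gt_mem_nhds hlt)).and ((hsmall (2 * (ρ * k))).and
    ((hsmall (2 * lam * (k : ℝ) ^ 2)).and (hsmall ρ))))).exists
  obtain ⟨h', hd', hg', hmass', hent'⟩ := hg.exists_euler hd hμ hρ hlam hk0 hq
    (s := t / m) (by positivity) (by linarith) (by linarith) h5 hmass m
  refine ⟨n, C, h', _, hjn, hd', hg', hmass', hent'.trans h2.le, ?_⟩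
  have hc : ‖NormedSpace.exp (t • A) g - NormedSpace.exp (t • A) f‖ ≤ ε / 3 := by
    rw [← map_sub]
    refine (ContinuousLinearMap.le_opNorm _ _).trans ?_
    have hb := norm_exp_slotGen_le hμ hρ hlam 0 n ht
    rw [pow_zero, sub_self, mul_zero, zero_mul, Real.exp_zero] at hb
    exact (mul_le_of_le_one_left (norm_nonneg _) hb).trans hgf.le
  have e : ((1 + (t / m) • A) ^ m) g - U
      = (((1 + (t / m) • A) ^ m) g - NormedSpace.exp (t • A) g)
        + (NormedSpace.exp (t • A) g - NormedSpace.exp (t • A) f)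
        + (NormedSpace.exp (t • A) f - U) := by abel
  rw [e]
  refine (norm_add₃_le).trans ?_
  linarith

theorem exists_isSlotLimit (hμ : 0 < μ) (hρ : 0 < ρ) (hlam : 0 ≤ lam) {f U : L1}
    (hf : IsProbDist f.fn) (hent : MemL1s (entropyDensity μ ρ f.fn)) {t : ℝ} (ht : 0 ≤ t)
    (hU : Tendsto (fun n => NormedSpace.exp (t • slotGen μ ρ lam (slots μ ρ n) 0) f) atTop
      (𝓝 U)) :
    ∃ k g h C, IsSlotLimit μ ρ (Real.exp (-ρ * t) * relEntropy μ ρ f.fn) U k g h C := by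
  choose n C h g hn hd hg hm hE hc using fun j : ℕ =>
    exists_euler_approximation hμ hρ hlam hf hent ht hU j
      (ε := (1 / 2) ^ j) (by positivity)
  exact ⟨fun j => slots μ ρ (n j), g, h, C,
    tendsto_slots.comp (tendsto_atTop_mono hn tendsto_id), fun j => slots_pos _,
    fun j => slot_prob_le_one hρ (le_slots _) (slots_pos _), hd, hg, hm, hE, hc⟩

end KacReservoir
end

theorem theorem3 (μ ρ lam : ℝ) (hμ : 0 < μ) (hρ : 0 < ρ) (hlam : 0 ≤ lam)
    (f : KacReservoir.L1)
    (hprob : KacReservoir.IsProbDist f.fn)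
    (hD : KacReservoir.MemD1 f.fn)
    (hent : KacReservoir.MemD1 (KacReservoir.entropyDensity μ ρ f.fn)) :
    ∃ u : ℝ → KacReservoir.L1,
      (KacReservoir.IsSolution μ ρ lam u ∧ u 0 = f) ∧
      (∀ w : ℝ → KacReservoir.L1, KacReservoir.IsSolution μ ρ lam w → w 0 = f →
        ∀ t : ℝ, 0 ≤ t → w t = u t) ∧
      ∀ t : ℝ, 0 ≤ t →
        KacReservoir.IsProbDist (u t).fn ∧
        KacReservoir.MemL1s (KacReservoir.entropyDensity μ ρ (u t).fn) ∧
        KacReservoir.relEntropy μ ρ (u t).fn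
          ≤ Real.exp (-ρ * t) * KacReservoir.relEntropy μ ρ f.fn := by
  obtain ⟨g, rfl⟩ := KacReservoir.exists_eq_weightInv hD
  obtain ⟨u, h0, hu, hlim⟩ := KacReservoir.exists_solution_of_weightInv hμ hρ hlam g
  -- A single slot limit at each time yields symmetry, positivity, mass one and the entropy bound
  -- together.
  have key := fun (t : ℝ) (ht : 0 ≤ t) =>
    KacReservoir.exists_isSlotLimit hμ hρ hlam hprob hent.toMemL1s ht (hlim t ht)
  refine ⟨u, ⟨⟨fun t ht => ?_, fun t ht => ?_⟩, h0⟩, fun w hw hw0 t ht => ?_, fun t ht => ?_⟩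
  · obtain ⟨k, g', h, C, H⟩ := key t ht
    obtain ⟨y, hy, -⟩ := hu t ht
    refine ⟨H.memL1s, ?_⟩
    rw [hy]
    exact KacReservoir.summable_sq_weightInv y
  · obtain ⟨y, hy, hder⟩ := hu t ht
    refine ⟨_, fun N => ?_, hder⟩
    rw [hy]
    exact KacReservoir.coord_limitGen hμ hρ hlam y N
  · exact KacReservoir.eq_of_hasDerivWithinAt_limitGen hμ hρ hlam hu
      (fun s hs => hw.hasDerivWithinAt_limitGen hμ hρ hlam hs) (hw0.trans h0.symm) ht
  · obtain ⟨k, g', h, C, H⟩ := key t ht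
    exact ⟨H.isProbDist hμ hρ, H.memL1s_entropyDensity hμ hρ, H.relEntropy_le hμ hρ⟩
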